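/- Let $n\ge 1$ and $\lambda\ge 1$. For $\lambda>1$ let $\mathbb A^{(\lambda)}(\mathbb D^n)$ be the weighted Bergman space of all holomorphic functions in $L^2(\mathbb D^n,dV^{(\lambda)})$, where $dV^{(\lambda)}=\big(\tfrac{\lambda-1}{\pi}\big)^n\prod_{i=1}^n(1-|z_i|^2)^{\lambda-2}\,dV$ and $dV$ is Lebesgue measure on the open unit polydisc $\mathbb D^n$; for $\lambda=1$ let $\mathbb A^{(1)}(\mathbb D^n)=H^2(\mathbb D^n)$ be the Hardy space, regarded through boundary values as the closure of the holomorphic polynomials in $L^2(\mathbb T^n)$ ($\mathbb T^n$ with normalized Lebesgue measure). The symmetric group $\mathfrak S_n$ acts by $\sigma\cdot z=(z_{\sigma(1)},\dots,z_{\sigma(n)})$. For every partition $\boldsymbol p\vdash n$ let $\pi_{\boldsymbol p}=(\pi_{\boldsymbol p}^{ij})_{i,j=1}^{d_{\boldsymbol p}}$ be a unitary matrix representation of $\mathfrak S_n$ in the equivalence class of irreducible representations labelled by $\boldsymbol p$ (that of the Specht module of $\boldsymbol p$, so that $(n)$ labels the trivial and $(1^n)$ the sign representation), and put $$(\mathbb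 P_{\boldsymbol p}^{ij}f)(z)=\frac{d_{\boldsymbol p}}{n!}\sum_{\sigma\in\mathfrak S_n}\pi_{\boldsymbol p}^{ji}(\sigma^{-1})\,f(\sigma^{-1}\cdot z),\qquad f\in\mathbb A^{(\lambda)}(\mathbb D^n).$$ Let $s_1,\dots,s_n$ be the elementary symmetric polynomials in $n$ variables, $s=(s_1,\dots,s_n)$, and let $\Gamma_n=\overline{s(\mathbb D^n)}=s(\overline{\mathbb D}^n)$ be the closed symmetrized polydisc. A commuting tuple $(T_1,\dots,T_n)$ of bounded operators on a Hilbert space is a $\Gamma_n$-contraction if $\|f(T_1,\dots,T_n)\|\le\sup_{\Gamma_n}|f|$ for every $f\in\mathbb C[z_1,\dots,z_n]$. Two tuples $(T_i)$ on $H$ and $(S_i)$ on $K$ are unitarily equivalent if there is a unitary $U:H\to K$ with $UT_i=S_iU$ for all $i$. Then, for every choice of the representations $\pi_{\boldsymbol p}$ and of indices $1\le i_{\boldsymbol p}\le d_{\boldsymbol p}$ (in particular for $i_{\boldsymbol p}=1$), each space $\mathbb P_{\boldsymbol p}^{i_{\boldsymbol p}i_{\boldsymbol p}}\big(\mathbb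 A^{(\lambda)}(\mathbb D^n)\big)$ is a Hilbert space that is invariant under multiplication by $s_1,\dots,s_n$, the tuple of multiplication operators $(M_{s_1},\dots,M_{s_n})$ restricted to it is a $\Gamma_n$-contraction, and for distinct partitions $\boldsymbol p\ne\boldsymbol q$ of $n$ the corresponding tuples are not unitarily equivalent. -/

import Mathlib

open MeasureTheory
open scoped ENNReal

noncomputable section

/-! ### Partitions, Specht modules and unitary matrix representations of the symmetric group -/

/-- The Young diagram of a partition `p` of `n`: its cells are the pairs `(i, j)` with
`j < p_i`, where `p_0 ≥ p_1 ≥ …` are the parts of `p` in decreasing order. -/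
def Nat.Partition.diagram {n : ℕ} (p : n.Partition) : YoungDiagram :=
  YoungDiagram.ofRowLens (p.parts.sort (· ≥ ·)) (p.parts.pairwise_sort (· ≥ ·)).sortedGE

/-- The Specht polynomial of a tableau `T` (a bijective filling of the diagram of `p` by the
symbols of `Fin n`): the product of `x_{T(i,j)} - x_{T(i',j)}` over all pairs of cells
in the same column `j` with `i < i'`. -/
def spechtPolynomial {n : ℕ} (p : n.Partition) (T : p.diagram.cells ≃ Fin n) :
    MvPolynomial (Fin n) ℂ :=
  ∏ c : p.diagram.cells, ∏ c' : p.diagram.cells,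
    if c.1.2 = c'.1.2 ∧ c.1.1 < c'.1.1 then MvPolynomial.X (T c) - MvPolynomial.X (T c') else 1

/-- The Specht module of `p`, the irreducible `ℂ[𝔖_n]`-module labelled by `p`: the span of
all Specht polynomials of shape `p`, on which `𝔖_n` acts by permuting the variables. -/
def spechtModule {n : ℕ} (p : n.Partition) : Submodule ℂ (MvPolynomial (Fin n) ℂ) :=
  Submodule.span ℂ (Set.range (spechtPolynomial p))

/-- The unitary matrix representation `π` belongs to the equivalence class of irreducible
representations labelled by `p`. -/
def BelongsTo {n d : ℕ} (π : Equiv.Perm (Fin n) →* Matrix.unitaryGroup (Fin d) ℂ)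
    (p : n.Partition) : Prop :=
  ∃ e : (Fin d → ℂ) ≃ₗ[ℂ] spechtModule p, ∀ (σ : Equiv.Perm (Fin n)) (v : Fin d → ℂ),
    (e ((π σ : Matrix (Fin d) (Fin d) ℂ).mulVec v) : MvPolynomial (Fin n) ℂ) =
      MvPolynomial.rename σ (e v : MvPolynomial (Fin n) ℂ)

/-! ### The weighted Bergman spaces `𝔸^(lam)(𝔻^n)`, `lam ≥ 1` -/

/-- The open unit polydisc. -/
def polydisc (n : ℕ) : Set (Fin n → ℂ) := {z | ∀ i, ‖z i‖ < 1}

/-- The normalized Lebesgue measure of the torus `𝕋^n`, as a measure on `ℂ^n`. -/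
def torusMeasure (n : ℕ) : Measure (Fin n → ℂ) :=
  (Measure.pi fun _ : Fin n => (AddCircle.haarAddCircle : Measure UnitAddCircle)).map
    fun t i => (AddCircle.toCircle (t i) : ℂ)

/-- The measure `((lam-1)/π)^n ∏ (1-|z_i|²)^(lam-2) dV` on the polydisc, for `lam > 1`. -/
def bergmanMeasure (n : ℕ) (lam : ℝ) : Measure (Fin n → ℂ) :=
  (volume.restrict (polydisc n)).withDensity fun z =>
    ENNReal.ofReal (((lam - 1) / Real.pi) ^ n * ∏ i, (1 - ‖z i‖ ^ 2) ^ (lam - 2))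

open Classical in
/-- The measure whose `L²` space contains `𝔸^(lam)(𝔻^n)`: the weighted volume measure for
`lam > 1`, and the Lebesgue measure on the torus in the limiting case `lam = 1`. -/
def weightMeasure (n : ℕ) (lam : ℝ) : Measure (Fin n → ℂ) :=
  if lam = 1 then torusMeasure n else bergmanMeasure n lam

/-- `L²(𝔻^n, dV^(lam))` for `lam > 1`, and `L²(𝕋^n)` for `lam = 1`. -/
abbrev WeightedL2 (n : ℕ) (lam : ℝ) : Type := Lp ℂ 2 (weightMeasure n lam)

/-- The space of those elements of `L²(𝔻^n, dV^(lam))` that are (represented by) holomorphic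
functions on the polydisc. -/
def bergmanSpace (n : ℕ) (lam : ℝ) : Submodule ℂ (WeightedL2 n lam) where
  carrier := {F | ∃ f : (Fin n → ℂ) → ℂ, DifferentiableOn ℂ f (polydisc n) ∧
    F =ᵐ[weightMeasure n lam] f}
  zero_mem' := ⟨0, differentiableOn_const 0, Lp.coeFn_zero _ _ _⟩
  add_mem' := by
    rintro F G ⟨f, hf, hF⟩ ⟨g, hg, hG⟩
    exact ⟨f + g, hf.add hg, (Lp.coeFn_add F G).trans (hF.add hG)⟩
  smul_mem' := by
    rintro c F ⟨f, hf, hF⟩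
    exact ⟨c • f, hf.const_smul c, (Lp.coeFn_smul c F).trans (hF.const_smul c)⟩

/-- The subspace of `L²` consisting of the holomorphic polynomials. -/
def polynomialSpace (n : ℕ) (lam : ℝ) : Submodule ℂ (WeightedL2 n lam) where
  carrier := {F | ∃ f : MvPolynomial (Fin n) ℂ,
    F =ᵐ[weightMeasure n lam] fun z => MvPolynomial.eval z f}
  zero_mem' := ⟨0, (Lp.coeFn_zero _ _ _).trans (by simp; rfl)⟩
  add_mem' := by
    rintro F G ⟨f, hF⟩ ⟨g, hG⟩
    refine ⟨f + g, (Lp.coeFn_add F G).trans ((hF.add hG).trans (.of_forall fun z => ?_))⟩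
    simp
  smul_mem' := by
    rintro c F ⟨f, hF⟩
    refine ⟨c • f, (Lp.coeFn_smul c F).trans ((hF.const_smul c).trans (.of_forall fun z => ?_))⟩
    simp

open Classical in
/-- `𝔸^(lam)(𝔻^n)`: for `lam > 1` the weighted Bergman space; for `lam = 1` the Hardy space
`H²(𝔻^n)`, regarded through boundary values as a subspace of `L²(𝕋^n)`, namely the closure
of the holomorphic polynomials in `L²(𝕋^n)`. -/
def weightedBergman (n : ℕ) (lam : ℝ) : Submodule ℂ (WeightedL2 n lam) :=
  if lam = 1 then (polynomialSpace n lam).topologicalClosure else bergmanSpace n lam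

/-! ### The action of `𝔖_n` and the operators `ℙ_π^{ij}` -/

/-- `σ · z = (z_{σ(1)}, …, z_{σ(n)})`. -/
def permAct {n : ℕ} (σ : Equiv.Perm (Fin n)) (z : Fin n → ℂ) : Fin n → ℂ := fun i => z (σ i)

lemma measurable_permAct {n : ℕ} (σ : Equiv.Perm (Fin n)) : Measurable (permAct σ) :=
  measurable_pi_lambda _ fun i => measurable_pi_apply (σ i)

lemma measurable_toTorus (n : ℕ) : Measurable fun (t : UnitAddTorus (Fin n)) (i : Fin n) =>
    (AddCircle.toCircle (t i) : ℂ) :=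
  (continuous_pi fun i => continuous_subtype_val.comp
    (AddCircle.continuous_toCircle.comp (continuous_apply i))).measurable

lemma measurePreserving_permAct_torus {n : ℕ} (σ : Equiv.Perm (Fin n)) :
    MeasurePreserving (permAct σ) (torusMeasure n) (torusMeasure n) := by
  refine ⟨measurable_permAct σ, ?_⟩
  have h := measurePreserving_piCongrLeft
    (fun _ : Fin n => (AddCircle.haarAddCircle : Measure UnitAddCircle)) σ.symm
  have h2 : Measure.map (fun (t : UnitAddTorus (Fin n)) i => t (σ i))
      (Measure.pi fun _ => AddCircle.haarAddCircle) =
        Measure.pi fun _ => AddCircle.haarAddCircle := by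
    have h3 : (fun (t : UnitAddTorus (Fin n)) i => t (σ i)) =
        MeasurableEquiv.piCongrLeft (fun _ : Fin n => UnitAddCircle) σ.symm := by
      funext t i
      simpa using (MeasurableEquiv.piCongrLeft_apply_apply (β := fun _ : Fin n => UnitAddCircle)
        σ.symm t (σ i)).symm
    rw [h3]
    exact h.map_eq
  have hm : Measurable (fun (t : UnitAddTorus (Fin n)) i => t (σ i)) :=
    measurable_pi_lambda _ fun i => measurable_pi_apply (σ i)
  rw [torusMeasure, Measure.map_map (measurable_permAct σ) (measurable_toTorus n)]
  conv_rhs => rw [← h2, Measure.map_map (measurable_toTorus n) hm]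
  rfl

lemma measurePreserving_permAct_bergman {n : ℕ} (lam : ℝ) (σ : Equiv.Perm (Fin n)) :
    MeasurePreserving (permAct σ) (bergmanMeasure n lam) (bergmanMeasure n lam) := by
  have h : MeasurePreserving (permAct σ) volume volume := by
    convert volume_measurePreserving_piCongrLeft (fun _ : Fin n => ℂ) σ.symm using 1
    ext z i
    simpa [permAct] using (MeasurableEquiv.piCongrLeft_apply_apply (β := fun _ : Fin n => ℂ)
      σ.symm z (σ i)).symm
  have hD : permAct σ ⁻¹' polydisc n = polydisc n := by
    ext z
    exact ⟨fun H i => by simpa [permAct] using H (σ.symm i), fun H i => H (σ i)⟩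
  have hDm : MeasurableSet (polydisc n) := by
    have : polydisc n = ⋂ i, {z | ‖z i‖ < 1} := by ext; simp [polydisc]
    rw [this]
    exact MeasurableSet.iInter fun i =>
      measurableSet_lt (measurable_norm.comp (measurable_pi_apply i)) measurable_const
  have hr : MeasurePreserving (permAct σ) (volume.restrict (polydisc n))
      (volume.restrict (polydisc n)) := by
    have := h.restrict_preimage hDm
    rwa [hD] at this
  have hw : Measurable fun z : Fin n → ℂ =>
      ENNReal.ofReal (((lam - 1) / Real.pi) ^ n * ∏ i, (1 - ‖z i‖ ^ 2) ^ (lam - 2)) := by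
    fun_prop
  refine ⟨measurable_permAct σ, ?_⟩
  ext s hs
  rw [Measure.map_apply (measurable_permAct σ) hs, bergmanMeasure,
    withDensity_apply _ (measurable_permAct σ hs), withDensity_apply _ hs,
    ← hr.setLIntegral_comp_preimage hs hw]
  refine lintegral_congr fun z => ?_
  congr 2
  exact (Equiv.prod_comp σ fun i => (1 - ‖z i‖ ^ 2) ^ (lam - 2)).symm

lemma measurePreserving_permAct {n : ℕ} (lam : ℝ) (σ : Equiv.Perm (Fin n)) :
    MeasurePreserving (permAct σ) (weightMeasure n lam) (weightMeasure n lam) := by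
  unfold weightMeasure
  split_ifs
  · exact measurePreserving_permAct_torus σ
  · exact measurePreserving_permAct_bergman lam σ

/-- The operator `f ↦ (z ↦ f(σ · z))` on `L²`. -/
def permOp {n : ℕ} (lam : ℝ) (σ : Equiv.Perm (Fin n)) :
    WeightedL2 n lam →ₗ[ℂ] WeightedL2 n lam :=
  Lp.compMeasurePreservingₗ ℂ (permAct σ) (measurePreserving_permAct lam σ)

/-- `(ℙ_π^{ij} f)(z) = (deg π / n!) ∑_σ π^{ji}(σ⁻¹) f(σ⁻¹ · z)`. -/
def projOp {n d : ℕ} (lam : ℝ) (π : Equiv.Perm (Fin n) →* Matrix.unitaryGroup (Fin d) ℂ)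
    (i j : Fin d) : WeightedL2 n lam →ₗ[ℂ] WeightedL2 n lam :=
  ((d : ℂ) / (Nat.factorial n : ℂ)) • ∑ σ : Equiv.Perm (Fin n),
    (π σ⁻¹ : Matrix (Fin d) (Fin d) ℂ) j i • permOp lam σ⁻¹

/-- The space `ℙ_π^{ij}(𝔸^(lam)(𝔻^n))`. -/
def projSpace {n d : ℕ} (lam : ℝ) (π : Equiv.Perm (Fin n) →* Matrix.unitaryGroup (Fin d) ℂ)
    (i j : Fin d) : Submodule ℂ (WeightedL2 n lam) :=
  (weightedBergman n lam).map (projOp lam π i j)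

/-! ### `Γ_n`-contractions -/

/-- The symmetrization map `s = (s_1, …, s_n)`; the component with index `i : Fin n` is the
elementary symmetric polynomial of degree `i + 1`. -/
def symmetrization {n : ℕ} (z : Fin n → ℂ) : Fin n → ℂ :=
  fun i => MvPolynomial.eval z (MvPolynomial.esymm (Fin n) ℂ (i + 1))

/-- The closed symmetrized polydisc `Γ_n`. -/
def closedSymmetrizedPolydisc (n : ℕ) : Set (Fin n → ℂ) := closure (symmetrization '' polydisc n)

/-- The operator `f(T_1, …, T_n)`, for a commuting tuple `T` and a polynomial `f`. -/
def evalTuple {n : ℕ} {H : Type*} [NormedAddCommGroup H] [InnerProductSpace ℂ H]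
    (T : Fin n → H →L[ℂ] H) (f : MvPolynomial (Fin n) ℂ) : H →L[ℂ] H :=
  ∑ m ∈ f.support, f.coeff m • (List.ofFn fun i => T i ^ m i).prod

/-- `T` is a `Γ_n`-contraction: a commuting tuple of bounded operators on a Hilbert space
having `Γ_n` as a spectral set. (`Γ_n` is compact, so the supremum is a maximum.) -/
def IsGammaContraction {n : ℕ} {H : Type*} [NormedAddCommGroup H] [InnerProductSpace ℂ H]
    (T : Fin n → H →L[ℂ] H) : Prop :=
  CompleteSpace H ∧ (∀ i j, Commute (T i) (T j)) ∧
    ∀ f : MvPolynomial (Fin n) ℂ, ‖evalTuple T f‖ ≤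
      sSup ((fun w => ‖MvPolynomial.eval w f‖) '' closedSymmetrizedPolydisc n)

/-- Unitary equivalence of tuples of operators. -/
def UnitarilyEquivalent {n : ℕ} {H K : Type*} [NormedAddCommGroup H] [InnerProductSpace ℂ H]
    [NormedAddCommGroup K] [InnerProductSpace ℂ K]
    (T : Fin n → H →L[ℂ] H) (S : Fin n → K →L[ℂ] K) : Prop :=
  ∃ U : H ≃ₗᵢ[ℂ] K, ∀ (i : Fin n) (x : H), U (T i x) = S i (U x)

/-- `T` is the tuple `(M_{s_1}, …, M_{s_n})|_E` of multiplication operators on the subspace `E`. -/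
def IsMulTuple {n : ℕ} {lam : ℝ} (E : Submodule ℂ (WeightedL2 n lam)) (T : Fin n → E →L[ℂ] E) :
    Prop :=
  ∀ (i : Fin n) (F : E), ((T i F : WeightedL2 n lam) : (Fin n → ℂ) → ℂ)
    =ᵐ[weightMeasure n lam] fun z => symmetrization z i * (F : WeightedL2 n lam) z

end

/-! Inequivalence is the substance; the other claims are soft. Schur orthogonality makes `projOp lam
π i i` an orthogonal projection, and it commutes with multiplication by symmetric polynomials. Its
range on the closed space 𝔸^(lam) is therefore closed and invariant. A polynomial f in the tuple
acts as multiplication by f ∘ s, and s(z) lies in Γ_n for almost every z, so the supremum over Γ_n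
bounds its norm.

Power sums P_k are polynomials in the elementary symmetric ones. A unitary U joining the pieces of p
and q thus intertwines all multiplications by P_k, hence also their adjoints and self-commutators.
Multiplication by one coordinate commutes with the adjoint of multiplication by another, so the
self-commutator of P_k is diagonal on monomials: its eigenvalue at z^m is a sum over i of a weight
depending on m_i alone (`psumCommutator_monomial`). Over all k these eigenvalues determine the
multiset of exponents (`exponentCount_eq_of_sum_commutatorWeight`). Hence U sends a projected
monomial to a function in which only monomials with the same multiset of exponents occur.

The rest is combinatorics. A multiset occurring in the piece of q can be placed on a tableau of
shape q with distinct entries in every column (`BelongsTo.exists_isColumnInjective`), so at most as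
many exponents are below k as there are cells in the first k rows (`exponentCount_le_rowCount`). The
exponents of the Specht polynomials of p attain this bound for p, and they occur in the piece of p.
Transporting them by U gives `rowCount p ≤ rowCount q`; by symmetry equality holds, and p = q.

Two foundations are needed: irreducibility of Specht modules, by an argument in the style of James
(`eq_bot_or_eq_spechtModule`), and density of polynomials in 𝔸^(lam) (`weightedBergman_eq_closure`),
which reduces every closed condition to polynomials. -/

noncomputable section

open MvPolynomial

/-! ### Divisibility by differences of variables -/

section Divisibility

lemma X_sub_X_ne_zero {ι : Type*} {a b : ι} (hab : a ≠ b) :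
    (X a - X b : MvPolynomial ι ℂ) ≠ 0 :=
  sub_ne_zero.mpr fun h => hab (X_injective h)

variable {ι : Type*} [DecidableEq ι]

/-- The substitution `X a ↦ X b`. -/
def substVar (a b : ι) : MvPolynomial ι ℂ →ₐ[ℂ] MvPolynomial ι ℂ :=
  aeval fun i => if i = a then X b else X i

/-- Modulo the ideal of X a - X b the substitution is the identity; it suffices to check this on
variables. -/
lemma X_sub_X_dvd_sub_substVar (a b : ι) (f : MvPolynomial ι ℂ) :
    (X a - X b) ∣ f - substVar a b f := by
  rw [← Ideal.mem_span_singleton, ← Ideal.Quotient.mk_eq_mk_iff_sub_mem]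
  have h : (Ideal.Quotient.mkₐ ℂ (Ideal.span {(X a - X b : MvPolynomial ι ℂ)})) =
      (Ideal.Quotient.mkₐ ℂ _).comp (substVar a b) := by
    ext i
    simp only [substVar, AlgHom.comp_apply, aeval_X]
    split_ifs with h
    · subst h
      simp only [Ideal.Quotient.mkₐ_eq_mk]
      rw [Ideal.Quotient.mk_eq_mk_iff_sub_mem]
      exact Ideal.mem_span_singleton_self _
    · rfl
  exact congrArg (fun g => g f) h

lemma X_sub_X_dvd_iff {a b : ι} {f : MvPolynomial ι ℂ} :
    (X a - X b) ∣ f ↔ substVar a b f = 0 := by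
  refine ⟨?_, fun h => by simpa [h] using X_sub_X_dvd_sub_substVar a b f⟩
  rintro ⟨g, rfl⟩
  by_cases hab : b = a <;> simp [substVar, hab]

/-- The multiples of X a - X b form the kernel of `substVar a b`, a homomorphism into a domain. -/
lemma prime_X_sub_X {a b : ι} (hab : a ≠ b) : Prime (X a - X b : MvPolynomial ι ℂ) := by
  refine ⟨X_sub_X_ne_zero hab, fun h => ?_, fun f g h => ?_⟩
  · simpa using X_sub_X_dvd_iff.mp (h.dvd (a := (1 : MvPolynomial ι ℂ)))
  · rw [X_sub_X_dvd_iff, map_mul, mul_eq_zero] at h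
    simpa only [X_sub_X_dvd_iff] using h

lemma substVar_rename_swap (a b : ι) (f : MvPolynomial ι ℂ) :
    substVar a b (rename (Equiv.swap a b) f) = substVar a b f := by
  have h : (substVar a b).comp (rename (Equiv.swap a b)) = substVar a b := by
    ext i : 1
    simp only [substVar, AlgHom.comp_apply, rename_X, aeval_X]
    rcases eq_or_ne i a with rfl | hia
    · simp
    rcases eq_or_ne i b with rfl | hib
    · simp [hia]
    · simp [Equiv.swap_apply_of_ne_of_ne hia hib]
  exact congrArg (fun g => g f) h

/-- After the substitution the swap is invisible, so the substituted polynomial equals its own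
negative. -/
lemma X_sub_X_dvd_of_rename_swap {a b : ι} {f : MvPolynomial ι ℂ}
    (h : rename (Equiv.swap a b) f = -f) : (X a - X b) ∣ f := by
  rw [X_sub_X_dvd_iff]
  have := substVar_rename_swap a b f
  rw [h, map_neg] at this
  exact self_eq_neg.mp this.symm

lemma isRelPrime_X_sub_X {a b a' b' : ι} (hab : a ≠ b) (h : a' ≠ b')
    (h1 : ¬ (a' = a ∧ b' = b)) (h2 : ¬ (a' = b ∧ b' = a)) :
    IsRelPrime (X a - X b : MvPolynomial ι ℂ) (X a' - X b') := by
  rw [(prime_X_sub_X hab).irreducible.isRelPrime_iff_not_dvd, X_sub_X_dvd_iff]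
  simp only [substVar, map_sub, aeval_X, sub_eq_zero]
  split_ifs <;> intro h3 <;> have := X_injective h3 <;> grind

end Divisibility

/-! ### Specht polynomials -/

section Specht

variable {n : ℕ} {p : n.Partition}

/-- The pairs of cells lying in the same column, the first above the second. -/
def columnPairs (p : n.Partition) : Finset (p.diagram.cells × p.diagram.cells) :=
  Finset.univ.filter fun c => c.1.1.2 = c.2.1.2 ∧ c.1.1.1 < c.2.1.1

lemma spechtPolynomial_eq_prod (T : p.diagram.cells ≃ Fin n) :
    spechtPolynomial p T = ∏ c ∈ columnPairs p, (X (T c.1) - X (T c.2)) := by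
  rw [columnPairs, Finset.prod_filter, ← Finset.univ_product_univ, Finset.prod_product]
  rfl

lemma rename_spechtPolynomial (T : p.diagram.cells ≃ Fin n) (σ : Equiv.Perm (Fin n)) :
    rename σ (spechtPolynomial p T) = spechtPolynomial p (T.trans σ) := by
  simp [spechtPolynomial_eq_prod, map_prod]

lemma apply_ne_of_mem_columnPairs (T : p.diagram.cells ≃ Fin n)
    {c : p.diagram.cells × p.diagram.cells} (hc : c ∈ columnPairs p) : T c.1 ≠ T c.2 := by
  intro h
  have := T.injective h
  simp [columnPairs, this] at hc

lemma spechtPolynomial_ne_zero (T : p.diagram.cells ≃ Fin n) : spechtPolynomial p T ≠ 0 := by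
  rw [spechtPolynomial_eq_prod, Finset.prod_ne_zero_iff]
  exact fun c hc => X_sub_X_ne_zero (apply_ne_of_mem_columnPairs T hc)

lemma isHomogeneous_spechtPolynomial (T : p.diagram.cells ≃ Fin n) :
    (spechtPolynomial p T).IsHomogeneous (columnPairs p).card := by
  rw [spechtPolynomial_eq_prod, Finset.card_eq_sum_ones]
  exact IsHomogeneous.prod _ _ _ fun c _ => (isHomogeneous_X _ _).sub (isHomogeneous_X _ _)

/-- Group the pairs by their lower cell: a cell in row i has exactly i cells above it in its column.
The number is the degree of the Specht polynomials. -/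
lemma card_columnPairs : (columnPairs p).card = ∑ c : p.diagram.cells, c.1.1 := by
  rw [Finset.card_eq_sum_card_fiberwise (f := Prod.snd) (t := Finset.univ) (by simp)]
  refine Finset.sum_congr rfl fun c _ => ?_
  rw [← Finset.card_range c.1.1]
  symm
  refine Finset.card_bij (fun i hi => (⟨(i, c.1.2), ?_⟩, c)) ?_ ?_ ?_
  · have h := c.2
    rw [YoungDiagram.mem_cells] at h ⊢
    exact p.diagram.up_left_mem (Finset.mem_range.mp hi).le le_rfl h
  · intro i hi
    simpa [columnPairs] using hi
  · intro i _ j _ h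
    simpa using h
  · rintro ⟨a, b⟩ h
    simp only [columnPairs, Finset.mem_filter, Finset.mem_univ, true_and] at h
    obtain ⟨⟨h1, h2⟩, rfl⟩ := h
    exact ⟨a.1.1, by simpa using h2, by simp [← h1]⟩

/-- `v` changes sign under every transposition of two symbols in the same column of `T`. -/
def IsColumnAntisymm (T : p.diagram.cells ≃ Fin n) (v : MvPolynomial (Fin n) ℂ) : Prop :=
  ∀ c c' : p.diagram.cells, c.1.2 = c'.1.2 → c ≠ c' → rename (Equiv.swap (T c) (T c')) v = -v

/-- Antisymmetry makes each linear factor divide v, and these factors are pairwise coprime. -/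
lemma spechtPolynomial_dvd {T : p.diagram.cells ≃ Fin n} {v : MvPolynomial (Fin n) ℂ}
    (hv : IsColumnAntisymm T v) : spechtPolynomial p T ∣ v := by
  rw [spechtPolynomial_eq_prod]
  refine Finset.prod_dvd_of_isRelPrime ?_ fun c hc => ?_
  · intro c hc c' hc' hne
    refine isRelPrime_X_sub_X (apply_ne_of_mem_columnPairs T hc)
      (apply_ne_of_mem_columnPairs T hc') ?_ ?_
    · rintro ⟨h1, h2⟩
      exact hne (Prod.ext (T.injective h1).symm (T.injective h2).symm)
    · rintro ⟨h1, h2⟩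
      simp only [columnPairs, Finset.coe_filter, Finset.mem_univ, true_and,
        Set.mem_ofPred_eq] at hc hc'
      rw [T.injective h1, T.injective h2] at hc'
      omega
  · have hne := apply_ne_of_mem_columnPairs T hc
    simp only [columnPairs, Finset.mem_filter, Finset.mem_univ, true_and] at hc
    exact X_sub_X_dvd_of_rename_swap (hv c.1 c.2 hc.1 fun h => hne (by rw [h]))

/-- The product over all ordered pairs of distinct cells in the same column. -/
lemma spechtPolynomial_sq (T : p.diagram.cells ≃ Fin n) :
    (-1) ^ (columnPairs p).card * spechtPolynomial p T ^ 2 =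
      ∏ c : p.diagram.cells × p.diagram.cells,
        if c.1.1.2 = c.2.1.2 ∧ c.1 ≠ c.2 then X (T c.1) - X (T c.2) else 1 := by
  have h1 : (-1) ^ (columnPairs p).card * spechtPolynomial p T =
      ∏ c ∈ (columnPairs p).map (Equiv.prodComm _ _).toEmbedding, (X (T c.1) - X (T c.2)) := by
    rw [spechtPolynomial_eq_prod, Finset.prod_map, ← Finset.prod_const, ← Finset.prod_mul_distrib]
    exact Finset.prod_congr rfl fun c _ => by simp
  rw [sq, ← mul_assoc, h1, spechtPolynomial_eq_prod, ← Finset.prod_union, ← Finset.prod_filter]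
  · refine Finset.prod_congr ?_ fun _ _ => rfl
    ext c
    have h : c.1 = c.2 ↔ c.1.1.1 = c.2.1.1 ∧ c.1.1.2 = c.2.1.2 :=
      Subtype.ext_iff.trans Prod.ext_iff
    simp only [columnPairs, Finset.mem_union, Finset.mem_filter, Finset.mem_univ, true_and,
      Finset.mem_map_equiv, Equiv.prodComm_symm, Equiv.prodComm_apply, Prod.fst_swap,
      Prod.snd_swap, ne_eq, h]
    omega
  · rw [Finset.disjoint_left]
    intro c
    simp only [columnPairs, Finset.mem_filter, Finset.mem_univ, true_and,
      Finset.mem_map_equiv, Equiv.prodComm_symm, Equiv.prodComm_apply, Prod.fst_swap,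
      Prod.snd_swap]
    omega

/-- Up to a fixed sign the square is a product over ordered pairs of distinct cells in a column,
which any column-preserving permutation merely reindexes. Taking square roots leaves a sign, without
counting inversions. -/
lemma rename_swap_spechtPolynomial_eq_or (T : p.diagram.cells ≃ Fin n) {c c' : p.diagram.cells}
    (h : c.1.2 = c'.1.2) :
    rename (Equiv.swap (T c) (T c')) (spechtPolynomial p T) = spechtPolynomial p T ∨
    rename (Equiv.swap (T c) (T c')) (spechtPolynomial p T) = -spechtPolynomial p T := by
  rw [← sq_eq_sq_iff_eq_or_eq_neg, ← mul_right_inj' (pow_ne_zero (columnPairs p).card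
    (neg_ne_zero.mpr (one_ne_zero (α := MvPolynomial (Fin n) ℂ)))), rename_spechtPolynomial,
    spechtPolynomial_sq, spechtPolynomial_sq]
  have hT : T.trans (Equiv.swap (T c) (T c')) = (Equiv.swap c c').trans T := by
    ext x
    simp [Equiv.swap_apply_def, apply_ite T]
  have hcol : ∀ x, (Equiv.swap c c' x).1.2 = x.1.2 := by
    intro x
    rw [Equiv.swap_apply_def]
    split_ifs with h1 h2
    · rw [h1, h]
    · rw [h2, h]
    · rfl
  rw [hT, ← Equiv.prod_comp ((Equiv.swap c c').prodCongr (Equiv.swap c c')) fun x =>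
    if x.1.1.2 = x.2.1.2 ∧ x.1 ≠ x.2 then X (R := ℂ) (T x.1) - X (T x.2) else 1]
  refine Finset.prod_congr rfl fun x _ => ?_
  simp only [Equiv.prodCongr_apply, Prod.map_fst, Prod.map_snd, hcol, Equiv.trans_apply,
    ne_eq, EmbeddingLike.apply_eq_iff_eq]

lemma isColumnAntisymm_spechtPolynomial (T : p.diagram.cells ≃ Fin n) :
    IsColumnAntisymm T (spechtPolynomial p T) := by
  suffices H : ∀ c c' : p.diagram.cells, c.1.2 = c'.1.2 → c.1.1 < c'.1.1 →
      rename (Equiv.swap (T c) (T c')) (spechtPolynomial p T) = -spechtPolynomial p T by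
    intro c c' h hne
    rcases lt_trichotomy c.1.1 c'.1.1 with h1 | h1 | h1
    · exact H c c' h h1
    · exact absurd (Subtype.ext (Prod.ext h1 h)) hne
    · rw [Equiv.swap_comm]
      exact H c' c h.symm h1
  intro c c' h hlt
  -- Were the sign +1, the cofactor G of X a - X b would change sign under the swap and be divisible
  -- by X a - X b again. But every factor of G is coprime to it.
  refine (rename_swap_spechtPolynomial_eq_or T h).resolve_left fun h1 => ?_
  have hmem : (c, c') ∈ columnPairs p := by simp [columnPairs, h, hlt]
  have hne := apply_ne_of_mem_columnPairs T hmem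
  set a := T c with ha
  set b := T c' with hb
  set G : MvPolynomial (Fin n) ℂ :=
    ∏ x ∈ (columnPairs p).erase (c, c'), (X (T x.1) - X (T x.2)) with hG
  have hfac : spechtPolynomial p T = (X a - X b) * G := by
    rw [spechtPolynomial_eq_prod, hG, ha, hb, ← Finset.mul_prod_erase _ _ hmem]
  rw [hfac, map_mul, map_sub, rename_X, rename_X, Equiv.swap_apply_left,
    Equiv.swap_apply_right, ← neg_sub, neg_mul, ← mul_neg] at h1
  have h2 := mul_left_cancel₀ (X_sub_X_ne_zero hne) h1
  have h3 : substVar a b G = 0 := by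
    have := congrArg (substVar a b) h2
    rw [map_neg, substVar_rename_swap] at this
    exact self_eq_neg.mp this.symm
  rw [hG, ← X_sub_X_dvd_iff, (prime_X_sub_X hne).dvd_finsetProd_iff] at h3
  obtain ⟨x, hx, hdvd⟩ := h3
  rw [Finset.mem_erase] at hx
  refine ((prime_X_sub_X hne).irreducible.isRelPrime_iff_not_dvd).mp
    (isRelPrime_X_sub_X hne (apply_ne_of_mem_columnPairs T hx.2) ?_ ?_) hdvd
  · rintro ⟨h4, h5⟩
    exact hx.1 (Prod.ext (T.injective h4) (T.injective h5))
  · rintro ⟨h4, h5⟩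
    have := hx.2
    rw [columnPairs, Finset.mem_filter, T.injective h4, T.injective h5] at this
    omega

end Specht

/-! ### Irreducibility of the Specht module -/

section SpechtModule

variable {n : ℕ} {p : n.Partition}

lemma rename_rename_perm (σ τ : Equiv.Perm (Fin n)) (v : MvPolynomial (Fin n) ℂ) :
    rename σ (rename τ v) = rename (σ * τ : Equiv.Perm (Fin n)) v := by
  rw [rename_rename]
  rfl

lemma rename_one_perm (v : MvPolynomial (Fin n) ℂ) :
    rename (1 : Equiv.Perm (Fin n)) v = v := by
  exact rename_id_apply v

open Classical in
/-- The sign by which `σ` acts on the Specht polynomial of `T`, and `0` if it does not act by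
a sign. -/
def columnSign (T : p.diagram.cells ≃ Fin n) (σ : Equiv.Perm (Fin n)) : ℂ :=
  if rename σ (spechtPolynomial p T) = spechtPolynomial p T then 1 else
    if rename σ (spechtPolynomial p T) = -spechtPolynomial p T then -1 else 0

/-- The antisymmetrizer over the permutations which act on the Specht polynomial of `T`
by a sign. -/
def columnAntisymmetrizer (T : p.diagram.cells ≃ Fin n) :
    MvPolynomial (Fin n) ℂ →ₗ[ℂ] MvPolynomial (Fin n) ℂ :=
  ∑ σ : Equiv.Perm (Fin n), columnSign T σ • (rename σ).toLinearMap

lemma columnAntisymmetrizer_apply (T : p.diagram.cells ≃ Fin n) (v : MvPolynomial (Fin n) ℂ) :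
    columnAntisymmetrizer T v = ∑ σ : Equiv.Perm (Fin n), columnSign T σ • rename σ v := by
  simp [columnAntisymmetrizer, LinearMap.sum_apply]

lemma spechtPolynomial_ne_neg (T : p.diagram.cells ≃ Fin n) :
    spechtPolynomial p T ≠ -spechtPolynomial p T := fun h =>
  spechtPolynomial_ne_zero T (self_eq_neg.mp h)

lemma columnSign_mul {T : p.diagram.cells ≃ Fin n} {τ : Equiv.Perm (Fin n)}
    (hτ : rename τ (spechtPolynomial p T) = -spechtPolynomial p T) (σ : Equiv.Perm (Fin n)) :
    columnSign T (τ * σ) = -columnSign T σ := by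
  have hinj := rename_injective τ τ.injective (R := ℂ)
  have h0 := spechtPolynomial_ne_neg T
  have h1 : rename (τ * σ : Equiv.Perm (Fin n)) (spechtPolynomial p T) = spechtPolynomial p T ↔
      rename σ (spechtPolynomial p T) = -spechtPolynomial p T := by
    rw [← rename_rename_perm, ← hinj.eq_iff (a := rename σ (spechtPolynomial p T)), map_neg, hτ,
      neg_neg]
  have h2 : rename (τ * σ : Equiv.Perm (Fin n)) (spechtPolynomial p T) = -spechtPolynomial p T ↔
      rename σ (spechtPolynomial p T) = spechtPolynomial p T := by
    rw [← rename_rename_perm, ← hinj.eq_iff (a := rename σ (spechtPolynomial p T)), hτ]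
  simp only [columnSign, h1, h2]
  split_ifs <;> simp_all

lemma isColumnAntisymm_columnAntisymmetrizer (T : p.diagram.cells ≃ Fin n)
    (v : MvPolynomial (Fin n) ℂ) : IsColumnAntisymm T (columnAntisymmetrizer T v) := by
  intro c c' h hne
  have hτ := isColumnAntisymm_spechtPolynomial T c c' h hne
  set τ := Equiv.swap (T c) (T c')
  rw [columnAntisymmetrizer_apply, map_sum, ← Finset.sum_neg_distrib]
  refine Fintype.sum_equiv (Equiv.mulLeft τ) _ _ fun σ => ?_
  rw [Equiv.coe_mulLeft, columnSign_mul hτ, map_smul, rename_rename_perm, neg_smul, neg_neg]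

/-- The antisymmetrized polynomial is divisible by the Specht polynomial and, when nonzero, has the
same degree, so the quotient is constant. -/
lemma exists_columnAntisymmetrizer_eq_smul (T : p.diagram.cells ≃ Fin n)
    {v : MvPolynomial (Fin n) ℂ} (hv : v.IsHomogeneous (columnPairs p).card) :
    ∃ c : ℂ, columnAntisymmetrizer T v = c • spechtPolynomial p T := by
  obtain ⟨g, hg⟩ := spechtPolynomial_dvd (isColumnAntisymm_columnAntisymmetrizer T v)
  by_cases h0 : columnAntisymmetrizer T v = 0
  · exact ⟨0, by simp [h0]⟩
  have hg0 : g ≠ 0 := by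
    rintro rfl
    exact h0 (by simpa using hg)
  have hhom : (columnAntisymmetrizer T v).IsHomogeneous (columnPairs p).card := by
    rw [columnAntisymmetrizer_apply]
    refine IsHomogeneous.sum _ _ _ fun σ _ => ?_
    rw [smul_eq_C_mul]
    simpa using (isHomogeneous_C _ _).mul (hv.rename_isHomogeneous (f := σ))
  have hdeg := totalDegree_mul_of_isDomain (spechtPolynomial_ne_zero T) hg0
  rw [← hg, hhom.totalDegree h0,
    (isHomogeneous_spechtPolynomial T).totalDegree (spechtPolynomial_ne_zero T)] at hdeg
  have hg1 := totalDegree_eq_zero_iff_eq_C.mp (by omega : g.totalDegree = 0)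
  refine ⟨coeff 0 g, ?_⟩
  rw [hg, smul_eq_C_mul, mul_comm, ← hg1]

/-- The Hermitian form on homogeneous polynomials of degree `D` for which the monomials are
orthonormal. -/
def coeffPairing (D : ℕ) (u v : MvPolynomial (Fin n) ℂ) : ℂ :=
  ∑ m ∈ Finset.univ.finsuppAntidiag D, star (coeff m u) * coeff m v

lemma coeffPairing_rename (D : ℕ) (σ : Equiv.Perm (Fin n)) (u v : MvPolynomial (Fin n) ℂ) :
    coeffPairing D (rename σ u) v = coeffPairing D u (rename (σ⁻¹ : Equiv.Perm (Fin n)) v) := by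
  unfold coeffPairing
  symm
  refine Finset.sum_equiv (Finsupp.domCongr (M := ℕ) σ).toEquiv ?_ ?_
  · intro m
    simp only [Finset.mem_finsuppAntidiag, Finset.subset_univ, and_true, AddEquiv.toEquiv_eq_coe,
      EquivLike.coe_coe, Finsupp.domCongr_apply]
    have : ∑ i, (Finsupp.equivMapDomain σ m) i = ∑ i, m i := by
      simpa [Finsupp.equivMapDomain_apply] using Equiv.sum_comp σ.symm m
    rw [this]
  · intro m _
    simp only [AddEquiv.toEquiv_eq_coe, EquivLike.coe_coe, Finsupp.domCongr_apply,
      Finsupp.equivMapDomain_eq_mapDomain]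
    have h := coeff_rename_mapDomain _ σ⁻¹.injective v (Finsupp.mapDomain σ m)
    rw [← Finsupp.mapDomain_comp] at h
    have h2 : (σ⁻¹ : Equiv.Perm (Fin n)) ∘ σ = id := by ext; simp
    rw [h2, Finsupp.mapDomain_id] at h
    rw [coeff_rename_mapDomain _ σ.injective, h]

lemma columnSign_smul_rename_inv (T : p.diagram.cells ≃ Fin n) (σ : Equiv.Perm (Fin n)) :
    columnSign T σ • rename (σ⁻¹ : Equiv.Perm (Fin n)) (spechtPolynomial p T) =
      (columnSign T σ ^ 2) • spechtPolynomial p T := by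
  have hinj := rename_injective σ σ.injective (R := ℂ)
  have h0 := spechtPolynomial_ne_neg T
  unfold columnSign
  split_ifs with h1 h2
  · simp only [one_smul, one_pow]
    apply hinj
    rw [h1, rename_rename_perm, mul_inv_cancel, rename_one_perm]
  · apply hinj
    simp only [map_smul, h2]
    rw [rename_rename_perm, mul_inv_cancel, rename_one_perm]
    simp
  · simp

lemma isHomogeneous_of_mem_spechtModule {v : MvPolynomial (Fin n) ℂ} (hv : v ∈ spechtModule p) :
    v.IsHomogeneous (columnPairs p).card := by
  rw [← mem_homogeneousSubmodule]
  have h : spechtModule p ≤ homogeneousSubmodule (Fin n) ℂ (columnPairs p).card := by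
    rw [spechtModule, Submodule.span_le]
    rintro _ ⟨T, rfl⟩
    exact isHomogeneous_spechtPolynomial T
  exact h hv

/-- The antisymmetrizer is self-adjoint for the pairing, and on the Specht polynomial it is
multiplication by the number of permutations acting by a sign. That number is positive because of
the identity. -/
lemma coeffPairing_spechtPolynomial {T : p.diagram.cells ≃ Fin n} {u : MvPolynomial (Fin n) ℂ}
    (D : ℕ) (hu : columnAntisymmetrizer T u = 0) : coeffPairing D u (spechtPolynomial p T) = 0 := by
  have hreal : ∀ σ, star (columnSign T σ) = columnSign T σ := by
    intro σ
    unfold columnSign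
    split_ifs <;> simp
  have h1 : (∑ σ, columnSign T σ ^ 2) * coeffPairing D u (spechtPolynomial p T) =
      coeffPairing D (columnAntisymmetrizer T u) (spechtPolynomial p T) := by
    have h2 : coeffPairing D (columnAntisymmetrizer T u) (spechtPolynomial p T) =
        ∑ σ, columnSign T σ * coeffPairing D (rename σ u) (spechtPolynomial p T) := by
      simp only [coeffPairing, columnAntisymmetrizer_apply, coeff_sum, coeff_smul, star_sum,
        Finset.sum_mul, Finset.mul_sum]
      rw [Finset.sum_comm]
      refine Finset.sum_congr rfl fun σ _ => Finset.sum_congr rfl fun m _ => ?_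
      rw [smul_eq_mul, star_mul', hreal, mul_assoc]
    have h3 : ∀ (c : ℂ) (v : MvPolynomial (Fin n) ℂ),
        coeffPairing D u (c • v) = c * coeffPairing D u v := by
      intro c v
      simp only [coeffPairing, coeff_smul, smul_eq_mul, Finset.mul_sum]
      exact Finset.sum_congr rfl fun m _ => by ring
    rw [h2, Finset.sum_mul]
    refine Finset.sum_congr rfl fun σ _ => ?_
    rw [coeffPairing_rename, ← h3, ← h3, columnSign_smul_rename_inv]
  have h4 : (∑ σ, columnSign T σ ^ 2) ≠ 0 := by
    have h5 : ∀ σ, columnSign T σ ^ 2 = ((if columnSign T σ = 0 then 0 else 1 : ℕ) : ℂ) := by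
      intro σ
      unfold columnSign
      split_ifs <;> simp_all
    rw [Finset.sum_congr rfl fun σ _ => h5 σ, ← Nat.cast_sum, Nat.cast_ne_zero]
    refine (Finset.sum_pos' (fun _ _ => Nat.zero_le _) ⟨1, Finset.mem_univ _, ?_⟩).ne'
    simp [columnSign]
  rw [hu] at h1
  have h6 : coeffPairing D 0 (spechtPolynomial p T) = 0 := by simp [coeffPairing]
  rw [h6] at h1
  exact (mul_eq_zero.mp h1).resolve_left h4

lemma eq_zero_of_coeffPairing_self {D : ℕ} {u : MvPolynomial (Fin n) ℂ} (hu : u.IsHomogeneous D)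
    (h : coeffPairing D u u = 0) : u = 0 := by
  have h1 : (∑ m ∈ Finset.univ.finsuppAntidiag D, ‖coeff m u‖ ^ 2 : ℝ) = 0 := by
    have : ((∑ m ∈ Finset.univ.finsuppAntidiag D, ‖coeff m u‖ ^ 2 : ℝ) : ℂ) = 0 := by
      rw [← h, coeffPairing]
      push_cast
      exact Finset.sum_congr rfl fun m _ => by simpa using (Complex.conj_mul' (coeff m u)).symm
    exact_mod_cast this
  rw [Finset.sum_eq_zero_iff_of_nonneg (fun _ _ => by positivity)] at h1
  ext m
  by_contra hm
  have h2 : Finsupp.degree m = D := by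
    by_contra h3
    exact hm (hu.coeff_eq_zero h3)
  have := h1 m (by
    rw [Finset.mem_finsuppAntidiag]
    refine ⟨?_, Finset.subset_univ _⟩
    rw [← h2, Finsupp.degree_eq_sum])
  simp_all

/-- The Specht module is irreducible. -/
theorem eq_bot_or_eq_spechtModule {N : Submodule ℂ (MvPolynomial (Fin n) ℂ)}
    (hN : N ≤ spechtModule p) (hinv : ∀ (σ : Equiv.Perm (Fin n)), ∀ v ∈ N, rename σ v ∈ N) :
    N = ⊥ ∨ N = spechtModule p := by
  by_cases H : ∃ T, spechtPolynomial p T ∈ N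
  · obtain ⟨T, hT⟩ := H
    refine Or.inr (le_antisymm hN ?_)
    rw [spechtModule, Submodule.span_le]
    rintro _ ⟨T', rfl⟩
    have := hinv (T.symm.trans T') _ hT
    rw [rename_spechtPolynomial] at this
    have hT' : T.trans (T.symm.trans T') = T' := by
      ext
      simp
    rwa [hT'] at this
  -- Without a Specht polynomial in N, every antisymmetrizer kills N, since its values on N are
  -- multiples of one. Then N is orthogonal to the whole Specht module, in particular to itself.
  · refine Or.inl ((Submodule.eq_bot_iff _).mpr fun u hu => ?_)
    have hhom := isHomogeneous_of_mem_spechtModule (hN hu)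
    refine eq_zero_of_coeffPairing_self hhom ?_
    have h1 : ∀ T : p.diagram.cells ≃ Fin n, columnAntisymmetrizer T u = 0 := by
      intro T
      obtain ⟨c, hc⟩ := exists_columnAntisymmetrizer_eq_smul T hhom
      by_cases hc0 : c = 0
      · simp [hc, hc0]
      refine absurd ⟨T, ?_⟩ H
      have h2 : columnAntisymmetrizer T u ∈ N := by
        rw [columnAntisymmetrizer_apply]
        exact Submodule.sum_mem _ fun σ _ => N.smul_mem _ (hinv σ u hu)
      rw [hc] at h2
      simpa [smul_smul, inv_mul_cancel₀ hc0] using N.smul_mem c⁻¹ h2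
    have h3 : ∀ v ∈ spechtModule p, coeffPairing (columnPairs p).card u v = 0 := by
      intro v hv
      refine Submodule.span_induction ?_ ?_ ?_ ?_ hv
      · rintro _ ⟨T, rfl⟩
        exact coeffPairing_spechtPolynomial _ (h1 T)
      · simp [coeffPairing]
      · intro x y _ _ hx hy
        simp only [coeffPairing, coeff_add, mul_add, Finset.sum_add_distrib] at hx hy ⊢
        rw [hx, hy, add_zero]
      · intro c x _ hx
        have : coeffPairing (columnPairs p).card u (c • x) =
            c * coeffPairing (columnPairs p).card u x := by
          simp only [coeffPairing, coeff_smul, smul_eq_mul, Finset.mul_sum]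
          exact Finset.sum_congr rfl fun m _ => by ring
        rw [this, hx, mul_zero]
    exact h3 u (hN hu)

end SpechtModule

/-! ### Contents -/

section Content

variable {n : ℕ}

/-- The number of indices at which the exponent `m` is less than `k`. -/
def exponentCount (m : Fin n →₀ ℕ) (k : ℕ) : ℕ := (Finset.univ.filter fun x => m x < k).card

/-- The number of cells in the first `k` rows of the diagram of `p`. -/
def rowCount (p : n.Partition) (k : ℕ) : ℕ :=
  (Finset.univ.filter fun c : p.diagram.cells => c.1.1 < k).card

/-- `m` takes distinct values on the symbols in each column of `T`. -/
def IsColumnInjective {p : n.Partition} (T : p.diagram.cells ≃ Fin n) (m : Fin n →₀ ℕ) : Prop :=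
  ∀ c c' : p.diagram.cells, c.1.2 = c'.1.2 → m (T c) = m (T c') → c = c'

/-- Count column by column: a column of length l carries at most min(k, l) distinct values below k,
and exactly min(k, l) of its cells lie in the first k rows. -/
lemma exponentCount_le_rowCount {p : n.Partition} {T : p.diagram.cells ≃ Fin n}
    {m : Fin n →₀ ℕ} (hm : IsColumnInjective T m) (k : ℕ) :
    exponentCount m k ≤ rowCount p k := by
  have h1 : exponentCount m k =
      (Finset.univ.filter fun c : p.diagram.cells => m (T c) < k).card := by
    refine (Finset.card_bij (fun c _ => T c) (by simp) (by simp) fun x hx => ?_).symm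
    exact ⟨T.symm x, by simpa using hx, by simp⟩
  rw [h1, rowCount, Finset.card_eq_sum_card_fiberwise (f := fun c => c.1.2)
      (t := Finset.univ.image fun c : p.diagram.cells => c.1.2)
      (fun c _ => by simp only [Finset.coe_image]; exact ⟨c, by simp, rfl⟩),
    Finset.card_eq_sum_card_fiberwise (s := Finset.univ.filter _) (f := fun c => c.1.2)
      (t := Finset.univ.image fun c : p.diagram.cells => c.1.2)
      (fun c _ => by simp only [Finset.coe_image]; exact ⟨c, by simp, rfl⟩)]
  refine Finset.sum_le_sum fun j _ => ?_
  rw [Finset.filter_filter, Finset.filter_filter]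
  have hR : (Finset.univ.filter fun c : p.diagram.cells => c.1.1 < k ∧ c.1.2 = j).card =
      min k (p.diagram.colLen j) := by
    rw [← Finset.card_range (min k _)]
    refine Finset.card_bij (fun c _ => c.1.1) ?_ ?_ ?_
    · intro c hc
      simp only [Finset.mem_filter, Finset.mem_univ, true_and] at hc
      have h := c.2
      rw [YoungDiagram.mem_cells, ← Prod.mk.eta (p := c.1), hc.2,
        YoungDiagram.mem_iff_lt_colLen] at h
      simpa using ⟨hc.1, h⟩
    · intro c hc c' hc' h
      simp only [Finset.mem_filter, Finset.mem_univ, true_and] at hc hc'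
      exact Subtype.ext (Prod.ext h (hc.2.trans hc'.2.symm))
    · intro i hi
      simp only [Finset.mem_range, lt_min_iff] at hi
      exact ⟨⟨(i, j), by rw [YoungDiagram.mem_cells, YoungDiagram.mem_iff_lt_colLen]; exact hi.2⟩,
        by simpa using hi.1, rfl⟩
  rw [hR, le_min_iff]
  constructor
  · rw [← Finset.card_range k]
    refine Finset.card_le_card_of_injOn (fun c => m (T c)) ?_ ?_
    · intro c hc
      simp only [Finset.coe_filter, Finset.mem_univ, true_and, Set.mem_ofPred_eq] at hc
      simpa using hc.1
    · intro c hc c' hc' h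
      simp only [Finset.coe_filter, Finset.mem_univ, true_and, Set.mem_ofPred_eq] at hc hc'
      exact hm c c' (hc.2.trans hc'.2.symm) h
  · rw [← Finset.card_range (p.diagram.colLen j)]
    refine Finset.card_le_card_of_injOn (fun c => c.1.1) ?_ ?_
    · intro c hc
      simp only [Finset.coe_filter, Finset.mem_univ, true_and, Set.mem_ofPred_eq] at hc
      have h := c.2
      rw [YoungDiagram.mem_cells, ← Prod.mk.eta (p := c.1), hc.2,
        YoungDiagram.mem_iff_lt_colLen] at h
      simpa using h
    · intro c hc c' hc' h
      simp only [Finset.coe_filter, Finset.mem_univ, true_and, Set.mem_ofPred_eq] at hc hc'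
      exact Subtype.ext (Prod.ext h (hc.2.trans hc'.2.symm))

/-- Each x contributes f x to the first sum and K - f x to the second. -/
lemma sum_eq_sum_card_le {α : Type*} [Fintype α] (f : α → ℕ) (K : ℕ) (hK : ∀ x, f x ≤ K) :
    ∑ x, f x + ∑ k ∈ Finset.range K, (Finset.univ.filter fun x => f x < k + 1).card =
      K * Fintype.card α := by
  have h1 : ∀ k, (Finset.univ.filter fun x => f x < k + 1).card =
      ∑ x, if f x < k + 1 then 1 else 0 := fun k => Finset.card_filter _ _
  simp only [h1]
  rw [Finset.sum_comm, ← Finset.sum_add_distrib]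
  have h2 : ∀ x, f x + ∑ k ∈ Finset.range K, (if f x < k + 1 then 1 else 0) = K := by
    intro x
    rw [← Finset.card_filter]
    have : (Finset.range K).filter (fun k => f x < k + 1) = Finset.Ico (f x) K := by
      ext k
      simp
      omega
    rw [this, Nat.card_Ico]
    have := hK x
    omega
  rw [Finset.sum_congr rfl fun x _ => h2 x]
  simp [mul_comm]

/-- Equal total degrees make the sums over k of the two counting functions equal, so no termwise
inequality can be strict. -/
lemma exponentCount_eq_rowCount {p : n.Partition} {T : p.diagram.cells ≃ Fin n}
    {m : Fin n →₀ ℕ} (hm : IsColumnInjective T m)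
    (hdeg : ∑ x, m x = ∑ c : p.diagram.cells, c.1.1) (k : ℕ) :
    exponentCount m k = rowCount p k := by
  cases k with
  | zero => simp [exponentCount, rowCount]
  | succ k =>
    -- Any bound for all exponents and all row indices would serve; the summand k + 1 puts the given
    -- index into the range.
    set K := k + 1 + ∑ x, m x + ∑ c : p.diagram.cells, c.1.1
    have h1 := sum_eq_sum_card_le m K fun x =>
      (Finset.single_le_sum (f := m) (fun _ _ => Nat.zero_le _) (Finset.mem_univ x)).trans (by omega)
    have h2 := sum_eq_sum_card_le (fun c : p.diagram.cells => c.1.1) K fun x =>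
      (Finset.single_le_sum (f := fun c : p.diagram.cells => c.1.1)
        (fun _ _ => Nat.zero_le _) (Finset.mem_univ x)).trans (by omega)
    rw [Fintype.card_congr T, ← h1, hdeg] at h2
    have h3 := (add_left_cancel h2).symm
    exact (Finset.sum_eq_sum_iff_of_le fun i _ => exponentCount_le_rowCount hm (i + 1)).mp h3 k
      (by simp; omega)

lemma rowCount_succ (p : n.Partition) (k : ℕ) :
    rowCount p (k + 1) = rowCount p k + p.diagram.rowLen k := by
  have h : p.diagram.rowLen k =
      (Finset.univ.filter fun c : p.diagram.cells => c.1.1 = k).card := by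
    rw [YoungDiagram.rowLen_eq_card]
    refine (Finset.card_bij (fun c _ => c.1) ?_ ?_ ?_).symm
    · intro c hc
      rw [YoungDiagram.mem_row_iff]
      exact ⟨(YoungDiagram.mem_cells _).mp c.2, by simpa using hc⟩
    · intro c _ c' _ h
      exact Subtype.ext h
    · intro c hc
      rw [YoungDiagram.mem_row_iff] at hc
      exact ⟨⟨c, (YoungDiagram.mem_cells _).mpr hc.1⟩, by simpa using hc.2, rfl⟩
  rw [h, rowCount, rowCount, ← Finset.card_union_of_disjoint]
  · congr 1
    ext c
    simp
    omega
  · rw [Finset.disjoint_filter]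
    intro c _ h1 h2
    omega

lemma eq_of_rowCount_eq {p q : n.Partition} (h : ∀ k, rowCount p k = rowCount q k) : p = q := by
  have h1 : p.diagram = q.diagram := by
    ext ⟨i, j⟩
    have h2 := rowCount_succ p i
    have h3 := rowCount_succ q i
    rw [← h, ← h] at h3
    rw [YoungDiagram.mem_cells, YoungDiagram.mem_cells, YoungDiagram.mem_iff_lt_rowLen,
      YoungDiagram.mem_iff_lt_rowLen, show p.diagram.rowLen i = q.diagram.rowLen i by omega]
  have h2 : ∀ r : n.Partition, r.diagram.rowLens = r.parts.sort (· ≥ ·) := fun r =>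
    YoungDiagram.rowLens_ofRowLens_eq_self fun x hx => r.parts_pos (by simpa using hx)
  have h3 := congrArg YoungDiagram.rowLens h1
  rw [h2, h2] at h3
  ext1
  rw [← Multiset.sort_eq p.parts (· ≥ ·), h3, Multiset.sort_eq]

/-- If two symbols of a column carried the same exponent, their swap would fix m and force w m = -w
m. -/
lemma isColumnInjective_of_mem_support {p : n.Partition} {T : p.diagram.cells ≃ Fin n}
    {w : (Fin n →₀ ℕ) → ℂ}
    (hw : ∀ c c' : p.diagram.cells, c.1.2 = c'.1.2 → c ≠ c' →
      ∀ m, w (Finsupp.mapDomain (Equiv.swap (T c) (T c')) m) = -w m)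
    {m : Fin n →₀ ℕ} (hm : w m ≠ 0) : IsColumnInjective T m := by
  intro c c' h1 h2
  by_contra hne
  refine hm (self_eq_neg.mp ?_)
  rw [← hw c c' h1 hne m]
  congr 1
  ext x
  rw [← Finsupp.equivMapDomain_eq_mapDomain, Finsupp.equivMapDomain_apply, Equiv.symm_swap,
    Equiv.swap_apply_def]
  split_ifs with h3 h4
  · rw [h3, h2]
  · rw [h4, h2]
  · rfl

lemma exponentCount_of_mem_support_spechtPolynomial {p : n.Partition}
    {T : p.diagram.cells ≃ Fin n} {m : Fin n →₀ ℕ} (hm : coeff m (spechtPolynomial p T) ≠ 0)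
    (k : ℕ) : exponentCount m k = rowCount p k := by
  refine exponentCount_eq_rowCount (T := T) (isColumnInjective_of_mem_support
    (w := fun m => coeff m (spechtPolynomial p T)) ?_ hm) ?_ k
  · intro c c' h hne m
    rw [← coeff_neg, ← isColumnAntisymm_spechtPolynomial T c c' h hne]
    have := coeff_rename_mapDomain _ (Equiv.swap (T c) (T c')).injective
      (rename (Equiv.swap (T c) (T c')) (spechtPolynomial p T)) m
    rw [rename_rename_perm, Equiv.swap_mul_self, rename_one_perm] at this
    exact this
  · rw [← card_columnPairs, ← Finsupp.degree_eq_sum]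
    by_contra h3
    exact hm ((isHomogeneous_spechtPolynomial T).coeff_eq_zero h3)

lemma exponentCount_of_mem_support {p : n.Partition} {v : MvPolynomial (Fin n) ℂ}
    (hv : v ∈ spechtModule p) {m : Fin n →₀ ℕ} (hm : coeff m v ≠ 0) (k : ℕ) :
    exponentCount m k = rowCount p k := by
  by_contra hne
  refine hm ?_
  refine Submodule.span_induction ?_ ?_ ?_ ?_ hv
  · rintro _ ⟨T, rfl⟩
    by_contra h
    exact hne (exponentCount_of_mem_support_spechtPolynomial h k)
  · simp
  · intro x y _ _ hx hy
    rw [coeff_add, hx, hy, add_zero]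
  · intro c x _ hx
    rw [coeff_smul, hx, smul_zero]

end Content

/-! ### Schur orthogonality -/

section Schur

variable {n d : ℕ} {p : n.Partition} {π : Equiv.Perm (Fin n) →* Matrix.unitaryGroup (Fin d) ℂ}

/-- The matrix `π(σ)`. -/
abbrev repMat (π : Equiv.Perm (Fin n) →* Matrix.unitaryGroup (Fin d) ℂ) (σ : Equiv.Perm (Fin n)) :
    Matrix (Fin d) (Fin d) ℂ := π σ

lemma repMat_mul (σ τ : Equiv.Perm (Fin n)) : repMat π (σ * τ) = repMat π σ * repMat π τ := by
  simp [repMat]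

lemma repMat_inv_mul_self (σ : Equiv.Perm (Fin n)) : repMat π σ⁻¹ * repMat π σ = 1 := by
  rw [← repMat_mul, inv_mul_cancel]
  simp [repMat]

lemma repMat_inv_apply (σ : Equiv.Perm (Fin n)) (a b : Fin d) :
    repMat π σ⁻¹ a b = star (repMat π σ b a) := by
  simp [repMat, Matrix.star_apply]

lemma BelongsTo.eq_bot_or_eq_top (h : BelongsTo π p) {N : Submodule ℂ (Fin d → ℂ)}
    (hN : ∀ σ, ∀ v ∈ N, (repMat π σ).mulVec v ∈ N) : N = ⊥ ∨ N = ⊤ := by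
  obtain ⟨e, he⟩ := h
  set f : (Fin d → ℂ) →ₗ[ℂ] MvPolynomial (Fin n) ℂ :=
    (spechtModule p).subtype ∘ₗ e.toLinearMap with hf
  have hinj : Function.Injective f := Subtype.val_injective.comp e.injective
  have hle : N.map f ≤ spechtModule p := by
    rintro _ ⟨v, _, rfl⟩
    exact (e v).2
  rcases eq_bot_or_eq_spechtModule hle (by
    rintro σ _ ⟨v, hv, rfl⟩
    exact ⟨_, hN σ v hv, he σ v⟩) with h | h
  · left
    refine (Submodule.eq_bot_iff _).mpr fun v hv => hinj ?_
    rw [map_zero, ← Submodule.mem_bot ℂ, ← h]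
    exact ⟨v, hv, rfl⟩
  · right
    rw [eq_top_iff]
    intro v _
    have : f v ∈ N.map f := by
      rw [h]
      exact (e v).2
    obtain ⟨w, hw, hwv⟩ := this
    rwa [← hinj hwv]

/-- Schur's lemma: an eigenspace of M is a nonzero invariant subspace, hence everything. -/
lemma BelongsTo.exists_eq_smul_one (h : BelongsTo π p) [NeZero d] {M : Matrix (Fin d) (Fin d) ℂ}
    (hM : ∀ σ, repMat π σ * M = M * repMat π σ) : ∃ c : ℂ, M = c • 1 := by
  obtain ⟨c, hc⟩ := Module.End.exists_eigenvalue (Matrix.mulVecLin M)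
  refine ⟨c, ?_⟩
  have hbt := h.eq_bot_or_eq_top (N := Module.End.eigenspace (Matrix.mulVecLin M) c) (by
    intro σ v hv
    rw [Module.End.mem_eigenspace_iff, Matrix.mulVecLin_apply] at hv ⊢
    rw [Matrix.mulVec_mulVec, ← hM, ← Matrix.mulVec_mulVec, hv, Matrix.mulVec_smul])
  have htop := hbt.resolve_left hc
  apply Matrix.toLin'.injective
  ext1 i
  ext1 
  have : Pi.single i (1 : ℂ) ∈ Module.End.eigenspace (Matrix.mulVecLin M) c := by
    rw [htop]
    trivial
  rw [Module.End.mem_eigenspace_iff, Matrix.mulVecLin_apply] at this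
  simp only [LinearMap.comp_apply, LinearMap.single_apply, Matrix.toLin'_apply, this,
    Matrix.smul_mulVec, Matrix.one_mulVec]

/-- Schur orthogonality for matrix entries. -/
theorem BelongsTo.sum_repMat_mul (h : BelongsTo π p) (a i j b : Fin d) :
    ∑ σ : Equiv.Perm (Fin n), repMat π σ a i * repMat π σ⁻¹ j b =
      if i = j ∧ a = b then (n.factorial : ℂ) / d else 0 := by
  have : NeZero d := ⟨fun h0 => by subst h0; exact a.elim0⟩
  -- Averaging the matrix unit E_ij by conjugation gives a scalar matrix. Its trace fixes the
  -- scalar, and its (a, b) entry is the sum in question.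
  set M : Matrix (Fin d) (Fin d) ℂ :=
    ∑ σ : Equiv.Perm (Fin n), repMat π σ * Matrix.single i j 1 * repMat π σ⁻¹ with hM
  have hcomm : ∀ τ, repMat π τ * M = M * repMat π τ := by
    intro τ
    rw [hM, Finset.mul_sum, Finset.sum_mul]
    refine Fintype.sum_equiv (Equiv.mulLeft τ) _ _ fun σ => ?_
    rw [Equiv.coe_mulLeft, mul_inv_rev, repMat_mul, repMat_mul]
    simp only [Matrix.mul_assoc]
    rw [repMat_inv_mul_self, Matrix.mul_one]
  obtain ⟨c, hc⟩ := h.exists_eq_smul_one hcomm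
  have htr : M.trace = if i = j then (n.factorial : ℂ) else 0 := by
    have : ∀ σ, (repMat π σ * Matrix.single i j 1 * repMat π σ⁻¹).trace =
        if i = j then (1 : ℂ) else 0 := by
      intro σ
      rw [Matrix.trace_mul_comm, ← Matrix.mul_assoc, repMat_inv_mul_self, Matrix.one_mul]
      split_ifs with hij
      · subst hij
        simp
      · simp [Matrix.trace_single_eq_of_ne _ _ _ hij]
    rw [hM, Matrix.trace_sum, Finset.sum_congr rfl fun σ _ => this σ]
    simp [Fintype.card_perm]
  rw [hc, Matrix.trace_smul, Matrix.trace_one, Fintype.card_fin, smul_eq_mul] at htr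
  have hd : (d : ℂ) ≠ 0 := Nat.cast_ne_zero.mpr (NeZero.ne d)
  have hentry : M a b = ∑ σ : Equiv.Perm (Fin n), repMat π σ a i * repMat π σ⁻¹ j b := by
    rw [hM, Matrix.sum_apply]
    refine Finset.sum_congr rfl fun σ _ => ?_
    rw [Matrix.mul_apply, Finset.sum_eq_single j]
    · rw [Matrix.mul_single_apply_same, mul_one]
    · intro k _ hk
      rw [Matrix.mul_single_apply_of_ne _ _ _ _ _ hk, zero_mul]
    · simp
  rw [← hentry, hc, Matrix.smul_apply, Matrix.one_apply, smul_eq_mul]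
  by_cases hij : i = j <;> by_cases hab : a = b <;> simp_all [eq_div_iff]

end Schur

/-! ### The projections on `L²` -/

section Projection

variable {n d : ℕ} {lam : ℝ}

lemma permOp_coeFn (σ : Equiv.Perm (Fin n)) (F : WeightedL2 n lam) :
    permOp lam σ F =ᵐ[weightMeasure n lam] fun z => F (permAct σ z) :=
  Lp.coeFn_compMeasurePreserving F (measurePreserving_permAct lam σ)

lemma ae_comp_permAct {P : (Fin n → ℂ) → Prop} (σ : Equiv.Perm (Fin n))
    (h : ∀ᵐ z ∂weightMeasure n lam, P z) : ∀ᵐ z ∂weightMeasure n lam, P (permAct σ z) :=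
  (measurePreserving_permAct lam σ).quasiMeasurePreserving.ae h

lemma permOp_mul (σ τ : Equiv.Perm (Fin n)) (F : WeightedL2 n lam) :
    permOp lam (σ * τ) F = permOp lam σ (permOp lam τ F) := by
  ext1
  filter_upwards [permOp_coeFn (σ * τ) F, permOp_coeFn σ (permOp lam τ F),
    ae_comp_permAct σ (permOp_coeFn τ F)] with z h1 h2 h3
  rw [h1, h2, h3]
  rfl

lemma permOp_one (F : WeightedL2 n lam) : permOp lam 1 F = F := by
  ext1
  filter_upwards [permOp_coeFn 1 F] with z h1
  rw [h1]
  rfl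

lemma norm_permOp (σ : Equiv.Perm (Fin n)) (F : WeightedL2 n lam) : ‖permOp lam σ F‖ = ‖F‖ :=
  Lp.norm_compMeasurePreserving F (measurePreserving_permAct lam σ)

lemma continuous_permOp (σ : Equiv.Perm (Fin n)) : Continuous (permOp (n := n) lam σ) :=
  AddMonoidHomClass.continuous_of_bound (permOp lam σ) 1 fun F => by rw [norm_permOp, one_mul]

lemma inner_permOp (σ : Equiv.Perm (Fin n)) (F G : WeightedL2 n lam) :
    inner ℂ (permOp lam σ F) G = inner ℂ F (permOp lam σ⁻¹ G) := by
  let e : WeightedL2 n lam →ₗᵢ[ℂ] WeightedL2 n lam := ⟨permOp lam σ, norm_permOp σ⟩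
  have h : inner ℂ (e F) (e (permOp lam σ⁻¹ G)) = inner ℂ F (permOp lam σ⁻¹ G) :=
    e.inner_map_map _ _
  rw [← h]
  congr 1
  change G = permOp lam σ (permOp lam σ⁻¹ G)
  rw [← permOp_mul, mul_inv_cancel, permOp_one]

variable {p : n.Partition} {π : Equiv.Perm (Fin n) →* Matrix.unitaryGroup (Fin d) ℂ}

lemma projOp_apply (i j : Fin d) (F : WeightedL2 n lam) :
    projOp lam π i j F = ((d : ℂ) / n.factorial) • ∑ σ, repMat π σ j i • permOp lam σ F := by
  simp only [projOp, LinearMap.smul_apply, LinearMap.sum_apply]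
  congr 1
  exact Fintype.sum_equiv (Equiv.inv _) _ _ fun σ => rfl

lemma continuous_projOp (i j : Fin d) : Continuous (projOp (n := n) lam π i j) := by
  have : (projOp (n := n) lam π i j : WeightedL2 n lam → WeightedL2 n lam) = fun F =>
      ((d : ℂ) / n.factorial) • ∑ σ, repMat π σ j i • permOp lam σ F := by
    ext1 F
    exact projOp_apply i j F
  rw [this]
  refine Continuous.const_smul (M := ℂ) (continuous_finsetSum _ fun σ _ => ?_) _
  exact Continuous.const_smul (M := ℂ) (continuous_permOp σ) _

lemma inner_projOp (i : Fin d) (F G : WeightedL2 n lam) :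
    inner ℂ (projOp lam π i i F) G = inner ℂ F (projOp lam π i i G) := by
  rw [projOp_apply, projOp_apply, inner_smul_left, inner_smul_right, sum_inner, inner_sum]
  congr 1
  · simp
  refine Fintype.sum_equiv (Equiv.inv _) _ _ fun σ => ?_
  rw [inner_smul_left, inner_smul_right, inner_permOp, Equiv.inv_apply, repMat_inv_apply]
  rfl

lemma BelongsTo.dim_ne_zero (_ : BelongsTo π p) (i : Fin d) : (d : ℂ) ≠ 0 := by
  have : d ≠ 0 := fun h => by subst h; exact i.elim0
  exact_mod_cast this

/-- The diagonal matrix entry is, up to scale, idempotent under convolution on the group; this is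
what makes `projOp` idempotent. -/
lemma BelongsTo.sum_repMat_mul_repMat (h : BelongsTo π p) (i : Fin d) (ρ : Equiv.Perm (Fin n)) :
    ∑ σ, repMat π σ i i * repMat π (σ⁻¹ * ρ) i i = (n.factorial : ℂ) / d * repMat π ρ i i := by
  have h1 : ∀ σ, repMat π σ i i * repMat π (σ⁻¹ * ρ) i i =
      ∑ j, (repMat π σ i i * repMat π σ⁻¹ i j) * repMat π ρ j i := by
    intro σ
    rw [repMat_mul, Matrix.mul_apply, Finset.mul_sum]
    exact Finset.sum_congr rfl fun j _ => by ring
  rw [Finset.sum_congr rfl fun σ _ => h1 σ, Finset.sum_comm]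
  simp_rw [← Finset.sum_mul, h.sum_repMat_mul]
  simp

lemma BelongsTo.projOp_projOp (h : BelongsTo π p) (i : Fin d) (F : WeightedL2 n lam) :
    projOp lam π i i (projOp lam π i i F) = projOp lam π i i F := by
  have hd := h.dim_ne_zero i
  have hn : (n.factorial : ℂ) ≠ 0 := Nat.cast_ne_zero.mpr n.factorial_ne_zero
  conv_lhs => rw [projOp_apply]
  rw [projOp_apply]
  congr 1
  have h1 : ∀ σ, repMat π σ i i • permOp lam σ (((d : ℂ) / n.factorial) •
      ∑ τ, repMat π τ i i • permOp lam τ F) =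
      ∑ ρ, ((d : ℂ) / n.factorial * (repMat π σ i i * repMat π (σ⁻¹ * ρ) i i)) •
        permOp lam ρ F := by
    intro σ
    rw [map_smul, map_sum, Finset.smul_sum, Finset.smul_sum]
    refine Fintype.sum_equiv (Equiv.mulLeft σ) _ _ fun τ => ?_
    rw [Equiv.coe_mulLeft, inv_mul_cancel_left, map_smul, permOp_mul, smul_smul, smul_smul]
    congr 1
    ring
  rw [Finset.sum_congr rfl fun σ _ => h1 σ, Finset.sum_comm]
  refine Finset.sum_congr rfl fun ρ _ => ?_
  rw [← Finset.sum_smul, ← Finset.mul_sum, h.sum_repMat_mul_repMat, ← mul_assoc]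
  congr 1
  field_simp

end Projection

/-! ### The weight measure as a product measure -/

section DiscMeasure

/-- The density of the weighted area measure of the unit disc. -/
def discWeight (lam : ℝ) (z : ℂ) : ℝ := (lam - 1) / Real.pi * (1 - ‖z‖ ^ 2) ^ (lam - 2)

open Classical in
/-- The one variable factor of `weightMeasure`. -/
def discMeasure (lam : ℝ) : Measure ℂ :=
  if lam = 1 then (AddCircle.haarAddCircle : Measure UnitAddCircle).map
      fun t => (AddCircle.toCircle t : ℂ)
  else (volume.restrict (Metric.ball 0 1)).withDensity fun z => ENNReal.ofReal (discWeight lam z)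

lemma measurable_toCircle_coe : Measurable fun t : UnitAddCircle => (AddCircle.toCircle t : ℂ) :=
  (continuous_subtype_val.comp AddCircle.continuous_toCircle).measurable

lemma discMeasure_one : discMeasure 1 = (AddCircle.haarAddCircle : Measure UnitAddCircle).map
      fun t => (AddCircle.toCircle t : ℂ) := if_pos rfl

lemma discMeasure_of_ne_one {lam : ℝ} (h : lam ≠ 1) : discMeasure lam =
    (volume.restrict (Metric.ball 0 1)).withDensity fun z => ENNReal.ofReal (discWeight lam z) :=
  if_neg h

lemma measurable_discWeight (lam : ℝ) : Measurable (discWeight lam) := by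
  unfold discWeight
  fun_prop

lemma one_sub_sq_pos {z : ℂ} (hz : z ∈ Metric.ball (0 : ℂ) 1) : 0 < 1 - ‖z‖ ^ 2 := by
  rw [mem_ball_zero_iff] at hz
  nlinarith [norm_nonneg z]

lemma discWeight_pos {lam : ℝ} (h : 1 < lam) {z : ℂ} (hz : z ∈ Metric.ball (0 : ℂ) 1) :
    0 < discWeight lam z := by
  have := one_sub_sq_pos hz
  have := Real.pi_pos
  have : 0 < lam - 1 := by linarith
  unfold discWeight
  positivity

lemma integrableOn_discWeight {lam : ℝ} (h : 1 < lam) :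
    IntegrableOn (discWeight lam) (Metric.ball 0 1) := by
  have h1 : IntegrableOn (fun r : ℝ => r * (1 - r ^ 2) ^ (lam - 2)) (Set.Ioc 0 1) := by
    refine intervalIntegral.integrableOn_deriv_of_nonneg
      -- In polar coordinates the radial density has this antiderivative, continuous up to r = 1
      -- exactly because lam > 1. Integrability follows although the density may blow up there.
      (g := fun r => -(1 - r ^ 2) ^ (lam - 1) / (2 * (lam - 1))) ?_ ?_ ?_
    · have : Continuous fun r : ℝ => (1 - r ^ 2) ^ (lam - 1) :=
        (by fun_prop : Continuous fun r : ℝ => 1 - r ^ 2).rpow_const fun _ => Or.inr (by linarith)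
      exact (this.neg.div_const _).continuousOn
    · intro x hx
      have hx1 : 0 < 1 - x ^ 2 := by nlinarith [hx.1, hx.2]
      have h2 : HasDerivAt (fun r : ℝ => 1 - r ^ 2) (-(2 * x)) x := by
        simpa using (hasDerivAt_pow 2 x).const_sub 1
      have h3 := ((h2.rpow_const (p := lam - 1) (Or.inl hx1.ne')).neg).div_const (2 * (lam - 1))
      refine h3.congr_deriv ?_
      have : lam - 1 ≠ 0 := by linarith
      rw [show lam - 1 - 1 = lam - 2 by ring]
      field_simp
    · intro x hx
      have hx1 : 0 < 1 - x ^ 2 := by nlinarith [hx.1, hx.2]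
      have := hx.1
      positivity
  rw [← integrable_indicator_iff measurableSet_ball]
  have h2 : (Metric.ball (0 : ℂ) 1).indicator (discWeight lam) = fun z : ℂ =>
      (Set.Iio (1 : ℝ)).indicator (fun r => (lam - 1) / Real.pi * (1 - r ^ 2) ^ (lam - 2)) ‖z‖ := by
    ext z
    classical
    simp only [Set.indicator_apply, discWeight, mem_ball_zero_iff, Set.mem_Iio]
  rw [h2, integrable_fun_norm_addHaar (volume : Measure ℂ)]
  have h3 : (fun y : ℝ => y ^ (Module.finrank ℝ ℂ - 1) •
      (Set.Iio (1 : ℝ)).indicator (fun r => (lam - 1) / Real.pi * (1 - r ^ 2) ^ (lam - 2)) y) =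
      (Set.Iio (1 : ℝ)).indicator
        (fun r => (lam - 1) / Real.pi * (r * (1 - r ^ 2) ^ (lam - 2))) := by
    ext y
    simp only [Set.indicator_apply, Complex.finrank_real_complex, smul_eq_mul]
    split_ifs <;> ring
  rw [h3, IntegrableOn, integrable_indicator_iff measurableSet_Iio, IntegrableOn,
    Measure.restrict_restrict measurableSet_Iio]
  exact (h1.mono_set fun x hx => ⟨hx.2, (le_of_lt hx.1 : x ≤ 1)⟩).const_mul _

lemma isFiniteMeasure_discMeasure {lam : ℝ} (h : 1 ≤ lam) : IsFiniteMeasure (discMeasure lam) := by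
  rcases h.eq_or_lt with rfl | h
  · rw [discMeasure_one]
    infer_instance
  · rw [discMeasure_of_ne_one h.ne']
    exact isFiniteMeasure_withDensity_ofReal (integrableOn_discWeight h).2

lemma measurePreserving_mul_discMeasure (lam : ℝ) (t : Circle) :
    MeasurePreserving (fun z : ℂ => t * z) (discMeasure lam) (discMeasure lam) := by
  refine ⟨by fun_prop, ?_⟩
  by_cases h : lam = 1
  · subst h
    obtain ⟨s, rfl⟩ : ∃ s : UnitAddCircle, AddCircle.toCircle s = t :=
      ⟨(AddCircle.homeomorphCircle one_ne_zero).symm t,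
        by rw [← AddCircle.homeomorphCircle_apply one_ne_zero, Homeomorph.apply_symm_apply]⟩
    have h2 : Measure.map (fun x => s + x) (AddCircle.haarAddCircle : Measure UnitAddCircle) =
        AddCircle.haarAddCircle := map_add_left_eq_self _ s
    rw [discMeasure_one, Measure.map_map (by fun_prop) measurable_toCircle_coe]
    conv_rhs => rw [← h2, Measure.map_map measurable_toCircle_coe (measurable_const_add s)]
    congr 1
    ext x
    simp [AddCircle.toCircle_add]
  · have h1 : MeasurePreserving (fun z : ℂ => t * z) volume volume :=
      (rotation t).measurePreserving
    have h2 : (fun z : ℂ => t * z) ⁻¹' Metric.ball 0 1 = Metric.ball 0 1 := by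
      ext z
      simp [Circle.norm_coe]
    have h3 := h1.restrict_preimage (measurableSet_ball (x := (0 : ℂ)) (ε := 1))
    rw [h2] at h3
    rw [discMeasure_of_ne_one h]
    have hw : Measurable fun z => ENNReal.ofReal (discWeight lam z) :=
      (measurable_discWeight lam).ennreal_ofReal
    ext s hs
    have hm : Measurable fun z : ℂ => (t : ℂ) * z := by fun_prop
    rw [Measure.map_apply hm hs, withDensity_apply _ (hm hs), withDensity_apply _ hs,
      ← h3.setLIntegral_comp_preimage hs hw]
    refine lintegral_congr fun z => ?_
    simp [discWeight, Circle.norm_coe]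

lemma ae_norm_le_one_discMeasure (lam : ℝ) : ∀ᵐ z ∂discMeasure lam, ‖z‖ ≤ 1 := by
  by_cases h : lam = 1
  · subst h
    rw [discMeasure_one, ae_map_iff measurable_toCircle_coe.aemeasurable
      (measurableSet_le measurable_norm measurable_const)]
    exact .of_forall fun t => (Circle.norm_coe _).le
  · rw [discMeasure_of_ne_one h]
    refine (withDensity_absolutelyContinuous _ _).ae_le ?_
    filter_upwards [ae_restrict_mem measurableSet_ball] with z hz
    exact (mem_ball_zero_iff.mp hz).le

lemma ae_norm_eq_one_discMeasure_one : ∀ᵐ z ∂discMeasure 1, ‖z‖ = 1 := by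
  rw [discMeasure_one, ae_map_iff measurable_toCircle_coe.aemeasurable
    (measurableSet_eq_fun measurable_norm measurable_const)]
  exact .of_forall fun t => Circle.norm_coe _

lemma isProbabilityMeasure_discMeasure_one : IsProbabilityMeasure (discMeasure 1) := by
  rw [discMeasure_one]
  exact Measure.isProbabilityMeasure_map measurable_toCircle_coe.aemeasurable

lemma restrict_ball_absolutelyContinuous {lam : ℝ} (h : 1 < lam) :
    volume.restrict (Metric.ball (0 : ℂ) 1) ≪ discMeasure lam := by
  rw [discMeasure_of_ne_one h.ne']
  refine withDensity_absolutelyContinuous' (measurable_discWeight lam).ennreal_ofReal.aemeasurable ?_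
  filter_upwards [ae_restrict_mem measurableSet_ball] with z hz
  exact (ENNReal.ofReal_pos.mpr (discWeight_pos h hz)).ne'

/-- The measure charges every neighbourhood of the unit circle. This makes the moments positive and
keeps them from decaying faster than r ^ (2 * k) for any r < 1. -/
lemma discMeasure_annulus_pos {lam : ℝ} (h : 1 ≤ lam) {r : ℝ} (h1 : r < 1) :
    0 < discMeasure lam {z | r < ‖z‖} := by
  rw [pos_iff_ne_zero]
  intro h0
  rcases h.eq_or_lt with rfl | h
  · have := isProbabilityMeasure_discMeasure_one
    refine one_ne_zero (α := ℝ≥0∞) ?_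
    rw [← prob_compl_eq_zero_iff₀ (μ := discMeasure 1) (s := {z : ℂ | r < ‖z‖})
      (measurableSet_lt measurable_const measurable_norm).nullMeasurableSet |>.mp ?_, h0]
    filter_upwards [ae_norm_eq_one_discMeasure_one] with z hz
    simp [hz, h1]
  · have h2 := restrict_ball_absolutelyContinuous h h0
    have hs : MeasurableSet {z : ℂ | r < ‖z‖} := measurableSet_lt measurable_const measurable_norm
    rw [Measure.restrict_apply hs] at h2
    have ho : IsOpen ({z : ℂ | r < ‖z‖} ∩ Metric.ball 0 1) :=
      (isOpen_lt continuous_const continuous_norm).inter Metric.isOpen_ball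
    refine ho.measure_ne_zero volume ?_ h2
    obtain ⟨s, hs1, hs2⟩ := exists_between (max_lt h1 one_pos : max r 0 < 1)
    have hs0 : 0 ≤ s := (le_max_right r 0).trans hs1.le
    exact ⟨(s : ℂ), by simpa [abs_of_nonneg hs0] using (le_max_left r 0).trans_lt hs1,
      by simpa [abs_of_nonneg hs0] using hs2⟩

end DiscMeasure

/-! ### Product structure and torus invariance of the weight measure -/

section ProductMeasure

variable {n : ℕ} {lam : ℝ}

lemma measurableSet_polydisc : MeasurableSet (polydisc n) := by
  have : polydisc n = ⋂ i, {z | ‖z i‖ < 1} := by ext; simp [polydisc]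
  rw [this]
  exact MeasurableSet.iInter fun i =>
    measurableSet_lt (measurable_norm.comp (measurable_pi_apply i)) measurable_const

lemma weightMeasure_eq_pi (h : 1 ≤ lam) :
    weightMeasure n lam = Measure.pi fun _ : Fin n => discMeasure lam := by
  have := isFiniteMeasure_discMeasure h
  rcases h.eq_or_lt with rfl | h
  · have := isFiniteMeasure_discMeasure (le_refl 1)
    rw [discMeasure_one] at *
    rw [weightMeasure, if_pos rfl, torusMeasure]
    exact Measure.pi_map_pi fun i => measurable_toCircle_coe.aemeasurable
  · rw [weightMeasure, if_neg h.ne']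
    symm
    refine Measure.pi_eq fun s hs => ?_
    -- Truncating the density to the sides of the box turns the measure of the box into the integral
    -- of a product of functions of one variable.
    set g : Fin n → ℂ → ℝ := fun i => (s i ∩ Metric.ball 0 1).indicator (discWeight lam) with hg
    have hmeas : ∀ i, MeasurableSet (s i ∩ Metric.ball 0 1) := fun i =>
      (hs i).inter measurableSet_ball
    have hg0 : ∀ i z, 0 ≤ g i z := fun i z =>
      Set.indicator_nonneg (fun z hz => (discWeight_pos h hz.2).le) z
    have hgint : ∀ i, Integrable (g i) := fun i =>
      (integrable_indicator_iff (hmeas i)).mpr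
        ((integrableOn_discWeight h).mono_set Set.inter_subset_right)
    have h1 : ∀ i, discMeasure lam (s i) = ENNReal.ofReal (∫ z, g i z) := by
      intro i
      rw [ofReal_integral_eq_lintegral_ofReal (hgint i) (.of_forall (hg0 i)),
        discMeasure_of_ne_one h.ne', withDensity_apply _ (hs i), Measure.restrict_restrict (hs i),
        ← lintegral_indicator (hmeas i)]
      refine lintegral_congr fun z => ?_
      classical
      simp only [hg, Set.indicator_apply]
      split_ifs <;> simp
    have hI : Integrable fun z : Fin n → ℂ => ∏ i, g i (z i) := Integrable.fintype_prod hgint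
    have hmp : MeasurableSet (Set.univ.pi s ∩ polydisc n) :=
      (MeasurableSet.univ_pi hs).inter measurableSet_polydisc
    rw [Finset.prod_congr rfl fun i _ => h1 i,
      ← ENNReal.ofReal_prod_of_nonneg fun i _ => integral_nonneg (hg0 i),
      ← integral_fintype_prod_volume_eq_prod,
      ofReal_integral_eq_lintegral_ofReal hI
        (.of_forall fun z => Finset.prod_nonneg fun i _ => hg0 i (z i)),
      bergmanMeasure, withDensity_apply _ (MeasurableSet.univ_pi hs),
      Measure.restrict_restrict (MeasurableSet.univ_pi hs), ← lintegral_indicator hmp]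
    refine lintegral_congr fun z => ?_
    classical
    rw [Set.indicator_apply]
    split_ifs with hz
    · congr 1
      have : ∀ i, g i (z i) = discWeight lam (z i) := fun i =>
        
        Set.indicator_of_mem (s := s i ∩ Metric.ball 0 1)
          ⟨hz.1 i trivial, mem_ball_zero_iff.mpr (hz.2 i)⟩ _
      simp only [this, discWeight, Finset.prod_mul_distrib, Finset.prod_const, Finset.card_univ,
        Fintype.card_fin]
    · obtain ⟨i, hi⟩ : ∃ i, z i ∉ s i ∩ Metric.ball 0 1 := by
        by_contra! hcon
        exact hz ⟨fun i _ => (hcon i).1, fun i => mem_ball_zero_iff.mp (hcon i).2⟩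
      rw [Finset.prod_eq_zero (Finset.mem_univ i) (Set.indicator_of_notMem hi _),
        ENNReal.ofReal_zero]

lemma isFiniteMeasure_weightMeasure (h : 1 ≤ lam) : IsFiniteMeasure (weightMeasure n lam) := by
  have := isFiniteMeasure_discMeasure h
  rw [weightMeasure_eq_pi h]
  infer_instance

lemma ae_norm_le_one (h : 1 ≤ lam) : ∀ᵐ z ∂weightMeasure n lam, ∀ i, ‖z i‖ ≤ 1 := by
  have := isFiniteMeasure_discMeasure h
  rw [weightMeasure_eq_pi h, ae_all_iff]
  intro i
  exact (Measure.quasiMeasurePreserving_eval (μ := fun _ : Fin n => discMeasure lam) i).ae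
    (ae_norm_le_one_discMeasure lam)

lemma measurePreserving_rotation (h : 1 ≤ lam) (t : Fin n → Circle) :
    MeasurePreserving (fun z i => (t i : ℂ) * z i) (weightMeasure n lam) (weightMeasure n lam) := by
  have := isFiniteMeasure_discMeasure h
  rw [weightMeasure_eq_pi h]
  exact measurePreserving_pi _ _ fun i => measurePreserving_mul_discMeasure lam (t i)

lemma ae_mem_polydisc (h : 1 < lam) : ∀ᵐ z ∂weightMeasure n lam, z ∈ polydisc n := by
  rw [weightMeasure, if_neg h.ne', bergmanMeasure]
  exact (withDensity_absolutelyContinuous _ _).ae_le (ae_restrict_mem measurableSet_polydisc)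

end ProductMeasure

/-! ### Moments -/

section Moments

variable {n : ℕ} {lam : ℝ}

/-- The squared norm of `z ^ k` in one variable. -/
def moment (lam : ℝ) (k : ℕ) : ℝ := ∫ z, ‖z‖ ^ (2 * k) ∂discMeasure lam

lemma integrable_norm_pow (h : 1 ≤ lam) (k : ℕ) :
    Integrable (fun z => ‖z‖ ^ k) (discMeasure lam) := by
  have := isFiniteMeasure_discMeasure h
  refine Integrable.of_bound (C := 1) (by fun_prop) ?_
  filter_upwards [ae_norm_le_one_discMeasure lam] with z hz
  simpa using pow_le_one₀ (norm_nonneg z) hz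

lemma integral_conj_pow_mul_pow (lam : ℝ) (a b : ℕ) :
    ∫ z, star z ^ a * z ^ b ∂discMeasure lam = if a = b then (moment lam a : ℂ) else 0 := by
  split_ifs with hab
  · subst hab
    rw [moment, ← integral_complex_ofReal]
    congr 1
    ext z
    rw [← mul_pow]
    have : star z * z = ((‖z‖ ^ 2 : ℝ) : ℂ) := by
      simpa using Complex.conj_mul' z
    rw [this, pow_mul]
    norm_cast
  -- The angle is chosen so that rotation by t multiplies the integrand by exp(iπ) = -1, while the
  -- measure is invariant.
  · set t : Circle := Circle.exp (Real.pi / ((b : ℝ) - a)) with ht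
    have h0 : ((b : ℝ) - a) ≠ 0 := by
      rw [sub_ne_zero]
      exact_mod_cast Ne.symm hab
    have h1 : star (t : ℂ) ^ a * (t : ℂ) ^ b = -1 := by
      have e1 : star (t : ℂ) = Complex.exp (-(Real.pi / ((b : ℝ) - a) : ℝ) * Complex.I) := by
        rw [ht, Circle.coe_exp, Complex.star_def, ← Complex.exp_conj]
        simp
      rw [e1, ht, Circle.coe_exp, ← Complex.exp_nat_mul, ← Complex.exp_nat_mul, ← Complex.exp_add,
        ← Complex.exp_pi_mul_I]
      congr 1
      have h0' : ((b : ℂ) - a) ≠ 0 := by exact_mod_cast h0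
      push_cast
      field_simp
      ring
    have h2 := (measurePreserving_mul_discMeasure lam t).integral_comp
      (Homeomorph.mulLeft₀ (t : ℂ) t.coe_ne_zero).measurableEmbedding
      (fun z => star z ^ a * z ^ b)
    have h3 : ∀ z : ℂ, star ((t : ℂ) * z) ^ a * ((t : ℂ) * z) ^ b = -(star z ^ a * z ^ b) := by
      intro z
      rw [star_mul', mul_pow, mul_pow, mul_mul_mul_comm, h1, neg_one_mul]
    simp_rw [h3] at h2
    rw [integral_neg] at h2
    exact self_eq_neg.mp h2.symm

lemma pow_mul_le_moment (h : 1 ≤ lam) {r : ℝ} (hr : 0 ≤ r) (k : ℕ) :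
    r ^ (2 * k) * (discMeasure lam).real {z | r < ‖z‖} ≤ moment lam k := by
  have := isFiniteMeasure_discMeasure h
  have hs : MeasurableSet {z : ℂ | r < ‖z‖} := measurableSet_lt measurable_const measurable_norm
  have h1 := setIntegral_ge_of_const_le_real (c := r ^ (2 * k)) hs (measure_ne_top (discMeasure lam) _)
    (fun z hz => pow_le_pow_left₀ hr (le_of_lt hz) (2 * k))
    (integrable_norm_pow h (2 * k)).integrableOn
  exact h1.trans (setIntegral_le_integral (integrable_norm_pow h _)
    (.of_forall fun z => by positivity))

lemma moment_pos (h : 1 ≤ lam) (k : ℕ) : 0 < moment lam k := by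
  have := isFiniteMeasure_discMeasure h
  have h1 : 0 < (discMeasure lam).real {z | (1 / 2 : ℝ) < ‖z‖} :=
    ENNReal.toReal_pos (discMeasure_annulus_pos h (by norm_num)).ne' (measure_ne_top _ _)
  exact lt_of_lt_of_le (by positivity) (pow_mul_le_moment h (by norm_num : (0 : ℝ) ≤ 1 / 2) k)

lemma moment_one (k : ℕ) : moment 1 k = 1 := by
  have := isProbabilityMeasure_discMeasure_one
  have : ∫ z, ‖z‖ ^ (2 * k) ∂discMeasure 1 = ∫ _, (1 : ℝ) ∂discMeasure 1 := by
    refine integral_congr_ae ?_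
    filter_upwards [ae_norm_eq_one_discMeasure_one] with z hz
    simp [hz]
  rw [moment, this]
  simp

/-- The moments determine polynomials, outside of the Hardy case. -/
lemma eq_zero_of_sum_moment (h : 1 < lam) (q : Polynomial ℝ) (K : ℕ)
    (hq : ∀ k ≥ K, ∑ a ∈ q.support, q.coeff a * moment lam (a + k) = 0) : q = 0 := by
  have hint : ∀ k, ∫ z, q.eval (‖z‖ ^ 2) * ‖z‖ ^ (2 * k) ∂discMeasure lam =
      ∑ a ∈ q.support, q.coeff a * moment lam (a + k) := by
    intro k
    simp_rw [Polynomial.eval_eq_sum, Polynomial.sum_def, Finset.sum_mul, moment]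
    rw [integral_finsetSum]
    · refine Finset.sum_congr rfl fun a _ => ?_
      rw [← integral_const_mul]
      congr 1
      ext z
      ring
    · intro a _
      have := (integrable_norm_pow h.le (2 * a + 2 * k)).const_mul (q.coeff a)
      refine this.congr (.of_forall fun z => ?_)
      ring
  have hcont : Continuous fun z : ℂ => q.eval (‖z‖ ^ 2) := q.continuous.comp (by fun_prop)
  have hfin := isFiniteMeasure_discMeasure h.le
  have hint' : ∀ k, Integrable (fun z => q.eval (‖z‖ ^ 2) * ‖z‖ ^ (2 * k)) (discMeasure lam) := by
    intro k
    simp_rw [Polynomial.eval_eq_sum, Polynomial.sum_def, Finset.sum_mul]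
    refine integrable_finsetSum _ fun a _ => ?_
    have := (integrable_norm_pow h.le (2 * a + 2 * k)).const_mul (q.coeff a)
    refine this.congr (.of_forall fun z => ?_)
    ring
  have hexp : ∀ z : ℂ, q.eval (‖z‖ ^ 2) ^ 2 * ‖z‖ ^ (2 * K) =
      ∑ b ∈ q.support, q.coeff b * (q.eval (‖z‖ ^ 2) * ‖z‖ ^ (2 * (K + b))) := by
    intro z
    have he : q.eval (‖z‖ ^ 2) = ∑ b ∈ q.support, q.coeff b * (‖z‖ ^ 2) ^ b := by
      rw [Polynomial.eval_eq_sum, Polynomial.sum_def]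
    calc q.eval (‖z‖ ^ 2) ^ 2 * ‖z‖ ^ (2 * K)
        = (∑ b ∈ q.support, q.coeff b * (‖z‖ ^ 2) ^ b) *
            (q.eval (‖z‖ ^ 2) * ‖z‖ ^ (2 * K)) := by rw [← he]; ring
      _ = _ := by
        rw [Finset.sum_mul]
        exact Finset.sum_congr rfl fun b _ => by ring
  -- Combining the hypotheses for k = K + b with the coefficients of q itself yields the integral of
  -- a nonnegative function.
  have hsq : ∫ z, q.eval (‖z‖ ^ 2) ^ 2 * ‖z‖ ^ (2 * K) ∂discMeasure lam = 0 := by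
    simp_rw [hexp]
    rw [integral_finsetSum _ fun b _ => (hint' _).const_mul _]
    refine Finset.sum_eq_zero fun b _ => ?_
    rw [integral_const_mul, hint, hq _ (by omega), mul_zero]
  have hsqint : Integrable (fun z => q.eval (‖z‖ ^ 2) ^ 2 * ‖z‖ ^ (2 * K)) (discMeasure lam) := by
    simp_rw [hexp]
    exact integrable_finsetSum _ fun b _ => (hint' _).const_mul _
  rw [integral_eq_zero_iff_of_nonneg (fun z => by positivity) hsqint] at hsq
  have h1 := (restrict_ball_absolutelyContinuous h).ae_eq hsq
  have h2 := Measure.eqOn_open_of_ae_eq h1 Metric.isOpen_ball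
    (by fun_prop) (by fun_prop)
  refine Polynomial.eq_zero_of_infinite_isRoot q ?_
  -- The integrand is continuous and so vanishes on the whole disc; the point z = √t shows that
  -- every t in (0, 1) is a root of q.
  refine (Set.Ioo_infinite (zero_lt_one (α := ℝ))).mono fun t ht => ?_
  have h3 := h2 (x := ((Real.sqrt t : ℝ) : ℂ)) (by
    rw [mem_ball_zero_iff, Complex.norm_real, Real.norm_of_nonneg (Real.sqrt_nonneg t),
      Real.sqrt_lt' one_pos]
    simpa using ht.2)
  have hs : ‖((Real.sqrt t : ℝ) : ℂ)‖ ^ 2 = t := by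
    rw [Complex.norm_real, Real.norm_of_nonneg (Real.sqrt_nonneg t), Real.sq_sqrt ht.1.le]
  simp only [pow_mul, hs, Pi.zero_apply, mul_eq_zero] at h3
  rcases h3 with h3 | h3
  · exact eq_zero_of_pow_eq_zero h3
  · exact absurd (eq_zero_of_pow_eq_zero h3) ht.1.ne'

end Moments

/-! ### Polynomials in `L²` and multiplication operators -/

section PolyLp

variable {n : ℕ} {lam : ℝ}

lemma norm_eval_le (f : MvPolynomial (Fin n) ℂ) {z : Fin n → ℂ} (hz : ∀ i, ‖z i‖ ≤ 1) :
    ‖eval z f‖ ≤ ∑ m ∈ f.support, ‖coeff m f‖ := by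
  rw [eval_eq']
  refine (norm_sum_le _ _).trans (Finset.sum_le_sum fun m _ => ?_)
  rw [norm_mul, norm_prod]
  refine mul_le_of_le_one_right (norm_nonneg _) (Finset.prod_le_one (fun _ _ => norm_nonneg _) ?_)
  intro i _
  rw [norm_pow]
  exact pow_le_one₀ (norm_nonneg _) (hz i)

lemma continuous_eval_apply (f : MvPolynomial (Fin n) ℂ) : Continuous fun z => eval z f :=
  MvPolynomial.continuous_eval f

lemma ae_norm_eval_le (h : 1 ≤ lam) (f : MvPolynomial (Fin n) ℂ) :
    ∀ᵐ z ∂weightMeasure n lam, ‖eval z f‖ ≤ ∑ m ∈ f.support, ‖coeff m f‖ := by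
  filter_upwards [ae_norm_le_one h] with z hz
  exact norm_eval_le f hz

lemma memLp_eval (h : 1 ≤ lam) (f : MvPolynomial (Fin n) ℂ) :
    MemLp (fun z => eval z f) 2 (weightMeasure n lam) := by
  have := isFiniteMeasure_weightMeasure (n := n) h
  exact MemLp.of_bound (continuous_eval_apply f).aestronglyMeasurable _ (ae_norm_eval_le h f)

/-- A polynomial as an element of `L²`. -/
def polyLp (h : 1 ≤ lam) : MvPolynomial (Fin n) ℂ →ₗ[ℂ] WeightedL2 n lam where
  toFun f := (memLp_eval h f).toLp
  map_add' f g := by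
    rw [← MemLp.toLp_add]
    exact MemLp.toLp_congr _ _ (.of_forall fun z => by simp)
  map_smul' c f := by
    rw [← MemLp.toLp_const_smul]
    exact MemLp.toLp_congr _ _ (.of_forall fun z => by simp)

lemma polyLp_coeFn (h : 1 ≤ lam) (f : MvPolynomial (Fin n) ℂ) :
    polyLp h f =ᵐ[weightMeasure n lam] fun z => eval z f := MemLp.coeFn_toLp (memLp_eval h f)

lemma polynomialSpace_eq_range (h : 1 ≤ lam) :
    polynomialSpace n lam = LinearMap.range (polyLp h) := by
  ext F
  constructor
  · rintro ⟨f, hf⟩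
    exact ⟨f, Lp.ext ((polyLp_coeFn h f).trans hf.symm)⟩
  · rintro ⟨f, rfl⟩
    exact ⟨f, polyLp_coeFn h f⟩

lemma polyLp_mem_closure (h : 1 ≤ lam) (f : MvPolynomial (Fin n) ℂ) :
    polyLp h f ∈ (polynomialSpace n lam).topologicalClosure :=
  Submodule.le_topologicalClosure _ (by rw [polynomialSpace_eq_range h]; exact ⟨f, rfl⟩)

lemma permOp_polyLp (h : 1 ≤ lam) (σ : Equiv.Perm (Fin n)) (f : MvPolynomial (Fin n) ℂ) :
    permOp lam σ (polyLp h f) = polyLp h (rename σ f) := by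
  ext1
  filter_upwards [permOp_coeFn σ (polyLp h f), ae_comp_permAct σ (polyLp_coeFn h f),
    polyLp_coeFn h (rename σ f)] with z h1 h2 h3
  rw [h1, h2, h3, eval_rename]
  rfl

lemma memLp_eval_mul (h : 1 ≤ lam) (g : MvPolynomial (Fin n) ℂ) (F : WeightedL2 n lam) :
    MemLp (fun z => eval z g * F z) 2 (weightMeasure n lam) := by
  refine (Lp.memLp F).of_le_mul (c := ∑ m ∈ g.support, ‖coeff m g‖)
    ((continuous_eval_apply g).aestronglyMeasurable.mul (Lp.aestronglyMeasurable F)) ?_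
  filter_upwards [ae_norm_eval_le h g] with z hz
  rw [norm_mul]
  gcongr

/-- Multiplication by a polynomial on `L²`. -/
def mulOp (h : 1 ≤ lam) (g : MvPolynomial (Fin n) ℂ) : WeightedL2 n lam →L[ℂ] WeightedL2 n lam :=
  LinearMap.mkContinuous
    { toFun := fun F => (memLp_eval_mul h g F).toLp
      map_add' := fun F G => by
        rw [← MemLp.toLp_add]
        refine MemLp.toLp_congr _ _ ?_
        filter_upwards [Lp.coeFn_add F G] with z hz
        simp only [hz, Pi.add_apply, mul_add]
      map_smul' := fun c F => by
        rw [← MemLp.toLp_const_smul]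
        refine MemLp.toLp_congr _ _ ?_
        filter_upwards [Lp.coeFn_smul c F] with z hz
        simp only [hz, Pi.smul_apply, smul_eq_mul, mul_left_comm, RingHom.id_apply] }
    (∑ m ∈ g.support, ‖coeff m g‖) fun F => by
      refine Lp.norm_le_mul_norm_of_ae_le_mul ?_
      filter_upwards [ae_norm_eval_le h g, MemLp.coeFn_toLp (memLp_eval_mul h g F)] with z hz h2
      change ‖(memLp_eval_mul h g F).toLp _ z‖ ≤ _
      rw [h2, norm_mul]
      gcongr

lemma mulOp_coeFn (h : 1 ≤ lam) (g : MvPolynomial (Fin n) ℂ) (F : WeightedL2 n lam) :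
    mulOp h g F =ᵐ[weightMeasure n lam] fun z => eval z g * F z :=
  MemLp.coeFn_toLp (memLp_eval_mul h g F)

lemma mulOp_polyLp (h : 1 ≤ lam) (g f : MvPolynomial (Fin n) ℂ) :
    mulOp h g (polyLp h f) = polyLp h (g * f) := by
  ext1
  filter_upwards [mulOp_coeFn h g (polyLp h f), polyLp_coeFn h f, polyLp_coeFn h (g * f)]
    with z h1 h2 h3
  rw [h1, h2, h3, map_mul]

lemma mulOp_permOp (h : 1 ≤ lam) {g : MvPolynomial (Fin n) ℂ} (hg : g.IsSymmetric)
    (σ : Equiv.Perm (Fin n)) (F : WeightedL2 n lam) :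
    mulOp h g (permOp lam σ F) = permOp lam σ (mulOp h g F) := by
  ext1
  filter_upwards [mulOp_coeFn h g (permOp lam σ F), permOp_coeFn σ F, permOp_coeFn σ (mulOp h g F),
    ae_comp_permAct σ (mulOp_coeFn h g F)] with z h1 h2 h3 h4
  rw [h1, h2, h3, h4]
  congr 1
  conv_lhs => rw [← hg σ, eval_rename]
  rfl

lemma mulOp_projOp (h : 1 ≤ lam) {g : MvPolynomial (Fin n) ℂ} (hg : g.IsSymmetric) {d : ℕ}
    (π : Equiv.Perm (Fin n) →* Matrix.unitaryGroup (Fin d) ℂ) (i j : Fin d)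
    (F : WeightedL2 n lam) :
    mulOp h g (projOp lam π i j F) = projOp lam π i j (mulOp h g F) := by
  simp_rw [projOp_apply, map_smul, map_sum, map_smul, mulOp_permOp h hg]

/-- The squared norm of a monomial. -/
def monomialNormSq (lam : ℝ) (m : Fin n →₀ ℕ) : ℝ := ∏ i, moment lam (m i)

lemma monomialNormSq_pos (h : 1 ≤ lam) (m : Fin n →₀ ℕ) : 0 < monomialNormSq lam m :=
  Finset.prod_pos fun _ _ => moment_pos h _

lemma eval_monomial_one (z : Fin n → ℂ) (m : Fin n →₀ ℕ) :
    eval z (monomial m 1) = ∏ i, z i ^ m i := by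
  rw [eval_monomial, one_mul, Finsupp.prod_fintype _ _ (by simp)]

lemma inner_polyLp_left (h : 1 ≤ lam) (f : MvPolynomial (Fin n) ℂ) (F : WeightedL2 n lam) :
    inner ℂ (polyLp h f) F = ∫ z, star (eval z f) * F z ∂weightMeasure n lam := by
  rw [L2.inner_def]
  refine integral_congr_ae ?_
  filter_upwards [polyLp_coeFn h f] with z hz
  rw [hz, RCLike.inner_apply, mul_comm]
  rfl

lemma inner_monomial_monomial (h : 1 ≤ lam) (a b : Fin n →₀ ℕ) :
    inner ℂ (polyLp h (monomial a 1)) (polyLp h (monomial b 1)) =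
      if a = b then (monomialNormSq lam a : ℂ) else 0 := by
  have := isFiniteMeasure_discMeasure h
  rw [inner_polyLp_left]
  have h1 : ∫ z, star (eval z (monomial a 1)) * polyLp h (monomial b 1) z ∂weightMeasure n lam =
      ∫ z, ∏ i, (star (z i) ^ a i * z i ^ b i) ∂weightMeasure n lam := by
    refine integral_congr_ae ?_
    filter_upwards [polyLp_coeFn h (monomial b 1)] with z hz
    rw [hz, eval_monomial_one, eval_monomial_one, Finset.prod_mul_distrib]
    simp
  rw [h1, weightMeasure_eq_pi h, integral_fintype_prod_eq_prod (fun i z => star z ^ a i * z ^ b i)]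
  simp_rw [integral_conj_pow_mul_pow]
  split_ifs with hab
  · subst hab
    simp [monomialNormSq]
  · obtain ⟨i, hi⟩ := Finsupp.ne_iff.mp hab
    exact Finset.prod_eq_zero (Finset.mem_univ i) (if_neg hi)

lemma inner_monomial_polyLp (h : 1 ≤ lam) (a : Fin n →₀ ℕ) (f : MvPolynomial (Fin n) ℂ) :
    inner ℂ (polyLp h (monomial a 1)) (polyLp h f) = monomialNormSq lam a * coeff a f := by
  induction f using MvPolynomial.induction_on' with
  | monomial b c =>
    have : monomial b c = c • monomial b (1 : ℂ) := by simp [smul_monomial]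
    rw [this, map_smul, inner_smul_right, inner_monomial_monomial, coeff_smul, coeff_monomial]
    by_cases hab : a = b
    · simp [hab, mul_comm]
    · simp [hab, Ne.symm hab]
  | add f g hf hg => rw [map_add, inner_add_right, hf, hg, coeff_add, mul_add]

lemma polyLp_injective (h : 1 ≤ lam) : Function.Injective (polyLp (n := n) h) := by
  rw [injective_iff_map_eq_zero]
  intro f hf
  ext m
  have h1 := inner_monomial_polyLp h m f
  rw [hf, inner_zero_right] at h1
  have h2 : (monomialNormSq lam m : ℂ) ≠ 0 := by exact_mod_cast (monomialNormSq_pos h m).ne'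
  exact (mul_eq_zero.mp h1.symm).resolve_left h2

lemma norm_polyLp_monomial (h : 1 ≤ lam) (m : Fin n →₀ ℕ) :
    ‖polyLp h (monomial m (1 : ℂ))‖ ^ 2 = monomialNormSq lam m := by
  have h1 := inner_monomial_monomial h m m
  rw [if_pos rfl, inner_self_eq_norm_sq_to_K] at h1
  apply Complex.ofReal_injective
  rw [← h1]
  push_cast
  rfl

/-- Cauchy–Schwarz against the monomial, to which all other monomials are orthogonal. -/
lemma norm_coeff_mul_norm_le (h : 1 ≤ lam) (m : Fin n →₀ ℕ) (f : MvPolynomial (Fin n) ℂ) :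
    ‖coeff m f‖ * ‖polyLp h (monomial m (1 : ℂ))‖ ≤ ‖polyLp h f‖ := by
  have h1 := norm_inner_le_norm (𝕜 := ℂ) (polyLp h (monomial m (1 : ℂ))) (polyLp h f)
  have h0 : 0 < ‖polyLp h (monomial m (1 : ℂ))‖ ^ 2 := by
    rw [norm_polyLp_monomial]
    exact monomialNormSq_pos h m
  have h0' : 0 < ‖polyLp h (monomial m (1 : ℂ))‖ := by
    by_contra hcon
    rw [le_antisymm (not_lt.mp hcon) (norm_nonneg _)] at h0
    simp at h0
  rw [inner_monomial_polyLp, norm_mul, ← norm_polyLp_monomial h, Complex.norm_real, norm_pow,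
    norm_norm, sq, mul_assoc] at h1
  have := le_of_mul_le_mul_left h1 h0'
  linarith

/-- Point evaluations of polynomials are bounded, uniformly on compact subsets of the polydisc. -/
lemma exists_norm_eval_le (h : 1 ≤ lam) {r : ℝ} (hr0 : 0 ≤ r) (hr : r < 1) :
    ∃ C, 0 ≤ C ∧ ∀ (f : MvPolynomial (Fin n) ℂ) (w : Fin n → ℂ), (∀ i, ‖w i‖ ≤ r) →
      ‖eval w f‖ ≤ C * ‖polyLp h f‖ := by
  have := isFiniteMeasure_discMeasure h
  -- With c the mass of the annulus beyond ρ and s = √c, the norm of z^m is at least the product of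
  -- the s ρ^(m i). A coefficient bound then controls each term by powers of x = r / ρ < 1, and
  -- geometric series sum them.
  obtain ⟨ρ, hρ1, hρ2⟩ := exists_between hr
  have hρ0 : 0 < ρ := hr0.trans_lt hρ1
  set c := (discMeasure lam).real {z | ρ < ‖z‖} with hc
  have hc0 : 0 < c :=
    ENNReal.toReal_pos (discMeasure_annulus_pos h hρ2).ne' (measure_ne_top _ _)
  set x := r / ρ with hx
  have hx0 : 0 ≤ x := by positivity
  have hx1 : x < 1 := (div_lt_one hρ0).mpr hρ1
  set s := Real.sqrt c with hs
  have hs0 : 0 < s := Real.sqrt_pos.mpr hc0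
  refine ⟨∏ _i : Fin n, (s⁻¹ * (1 - x)⁻¹), Finset.prod_nonneg fun _ _ => ?_, fun f w hw => ?_⟩
  · have : 0 < 1 - x := by linarith
    positivity
  have hmon : ∀ m : Fin n →₀ ℕ, ∏ i, (s * ρ ^ m i) ≤ ‖polyLp h (monomial m (1 : ℂ))‖ := by
    intro m
    refine le_of_sq_le_sq ?_ (norm_nonneg _)
    rw [norm_polyLp_monomial, ← Finset.prod_pow, monomialNormSq]
    refine Finset.prod_le_prod (fun _ _ => by positivity) fun i _ => ?_
    rw [mul_pow, hs, Real.sq_sqrt hc0.le, ← pow_mul, mul_comm, mul_comm (m i)]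
    exact pow_mul_le_moment h hρ0.le (m i)
  have hterm : ∀ m ∈ f.support, ‖coeff m f * ∏ i, w i ^ m i‖ ≤
      (∏ i, (s⁻¹ * x ^ m i)) * ‖polyLp h f‖ := by
    intro m _
    have h1 : ‖coeff m f‖ * ∏ i, (s * ρ ^ m i) ≤ ‖polyLp h f‖ :=
      (mul_le_mul_of_nonneg_left (hmon m) (norm_nonneg _)).trans (norm_coeff_mul_norm_le h m f)
    have h2 : ∏ i, ‖w i‖ ^ m i ≤ ∏ i, r ^ m i :=
      Finset.prod_le_prod (fun _ _ => by positivity) fun i _ =>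
        pow_le_pow_left₀ (norm_nonneg _) (hw i) _
    have h3 : ∏ i, r ^ m i = (∏ i, (s⁻¹ * x ^ m i)) * ∏ i, (s * ρ ^ m i) := by
      rw [← Finset.prod_mul_distrib]
      refine Finset.prod_congr rfl fun i _ => ?_
      rw [hx, div_pow]
      field_simp
    rw [norm_mul, norm_prod]
    simp_rw [norm_pow]
    calc ‖coeff m f‖ * ∏ i, ‖w i‖ ^ m i ≤ ‖coeff m f‖ * ∏ i, r ^ m i := by gcongr
      _ = (∏ i, (s⁻¹ * x ^ m i)) * (‖coeff m f‖ * ∏ i, (s * ρ ^ m i)) := by rw [h3]; ring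
      _ ≤ _ := by
        refine mul_le_mul_of_nonneg_left h1 (Finset.prod_nonneg fun _ _ => by positivity)
  rw [eval_eq']
  refine (norm_sum_le _ _).trans ((Finset.sum_le_sum hterm).trans ?_)
  rw [← Finset.sum_mul]
  refine mul_le_mul_of_nonneg_right ?_ (norm_nonneg _)
  -- Enlarging the support to a box of exponents makes the sum factor into sums over one exponent.
  have h4 : ∑ m ∈ f.support, ∏ i, (s⁻¹ * x ^ m i) ≤
      ∑ m ∈ Fintype.piFinset fun _ : Fin n => Finset.range (f.totalDegree + 1),
        ∏ i, (s⁻¹ * x ^ m i) := by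
    rw [← Finset.sum_image (s := f.support) (g := fun m : Fin n →₀ ℕ => (m : Fin n → ℕ))
      (f := fun m => ∏ i, (s⁻¹ * x ^ m i)) (fun a _ b _ hab => DFunLike.coe_injective hab)]
    refine Finset.sum_le_sum_of_subset_of_nonneg ?_ fun _ _ _ =>
      Finset.prod_nonneg fun _ _ => by positivity
    intro m hm
    obtain ⟨a, ha, rfl⟩ := Finset.mem_image.mp hm
    rw [Fintype.mem_piFinset]
    intro i
    rw [Finset.mem_range, Nat.lt_succ_iff]
    refine le_trans ?_ (le_totalDegree ha)
    rw [Finsupp.sum_fintype _ _ (by simp)]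
    exact Finset.single_le_sum (f := fun i => a i) (fun _ _ => Nat.zero_le _) (Finset.mem_univ i)
  refine h4.trans ?_
  rw [← Finset.prod_univ_sum (fun _ : Fin n => Finset.range (f.totalDegree + 1))
    fun _ j => s⁻¹ * x ^ j]
  refine Finset.prod_le_prod (fun _ _ => Finset.sum_nonneg fun _ _ => by positivity) fun i _ => ?_
  rw [← Finset.mul_sum]
  refine mul_le_mul_of_nonneg_left ?_ (by positivity)
  rw [← tsum_geometric_of_lt_one hx0 hx1]
  exact (summable_geometric_of_lt_one hx0 hx1).sum_le_tsum _ fun _ _ => by positivity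

end PolyLp

/-! ### Limits of polynomials are holomorphic -/

section Closure

variable {n : ℕ} {lam : ℝ}

lemma polydisc_eq_ball : polydisc n = Metric.ball 0 1 := by
  ext z
  rw [mem_ball_zero_iff, pi_norm_lt_iff one_pos]
  rfl

lemma differentiable_eval (f : MvPolynomial (Fin n) ℂ) :
    Differentiable ℂ fun z : Fin n → ℂ => eval z f := by
  induction f using MvPolynomial.induction_on with
  | C a => simp
  | add f g hf hg =>
    simp only [map_add]
    exact hf.add hg
  | mul_X f i hf =>
    simp only [map_mul, eval_X]
    exact hf.mul (differentiable_apply i)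

lemma exists_norm_fderiv_eval_le (h : 1 ≤ lam) {r : ℝ} (hr0 : 0 ≤ r) (hr : r < 1) :
    ∃ C, 0 ≤ C ∧ ∀ (f : MvPolynomial (Fin n) ℂ) (w : Fin n → ℂ), ‖w‖ < r →
      ‖fderiv ℂ (fun z => eval z f) w‖ ≤ C * ‖polyLp h f‖ := by
  obtain ⟨ρ, hρ1, hρ2⟩ := exists_between hr
  obtain ⟨C, hC0, hC⟩ := exists_norm_eval_le (n := n) h (hr0.trans hρ1.le) hρ2
  have hpos : 0 < ρ - r := sub_pos.mpr hρ1
  -- Cauchy estimate on the ball of radius ρ - r about w; the factor 2 comes from bounding f(z) -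
  -- f(w) rather than f(z).
  refine ⟨2 * C / (ρ - r), by positivity, fun f w hw => ?_⟩
  have hball : ∀ z ∈ Metric.ball w (ρ - r), ‖eval z f‖ ≤ C * ‖polyLp h f‖ := by
    intro z hz
    refine hC f z fun i => (norm_le_pi_norm z i).trans ?_
    rw [mem_ball_iff_norm] at hz
    have := norm_le_norm_add_norm_sub' z w
    linarith
  have h1 := Complex.norm_fderiv_le_div_of_mapsTo_ball (f := fun z => eval z f) (c := w)
    (R₁ := ρ - r) (R₂ := 2 * (C * ‖polyLp h f‖)) (differentiable_eval f).differentiableOn ?_ hpos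
  · exact h1.trans_eq (by ring)
  · intro z hz
    rw [mem_closedBall_iff_norm]
    refine (norm_sub_le _ _).trans ?_
    have h2 := hball z hz
    have h3 := hball w (Metric.mem_ball_self hpos)
    linarith

lemma uniformCauchySeqOn_of_bound {X E : Type*} [NormedAddCommGroup E]
    {u : ℕ → WeightedL2 n lam} (hu : CauchySeq u) {φ : ℕ → X → E} {s : Set X} {C : ℝ}
    (hC : 0 ≤ C) (h : ∀ k l, ∀ x ∈ s, ‖φ k x - φ l x‖ ≤ C * ‖u k - u l‖) :
    UniformCauchySeqOn φ Filter.atTop s := by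
  rw [Metric.uniformCauchySeqOn_iff]
  intro ε hε
  obtain ⟨N, hN⟩ := Metric.cauchySeq_iff.mp hu (ε / (C + 1)) (by positivity)
  refine ⟨N, fun k hk l hl x hx => ?_⟩
  rw [dist_eq_norm]
  have h1 := hN k hk l hl
  rw [dist_eq_norm, lt_div_iff₀ (by positivity)] at h1
  have := h k l x hx
  nlinarith [norm_nonneg (u k - u l)]

/-- Norm convergence forces locally uniform convergence of the derivatives and pointwise convergence
of the values, so the pointwise limit is holomorphic. An almost everywhere convergent subsequence
identifies it with the L² limit. -/
lemma closure_le_bergmanSpace (h : 1 < lam) :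
    (polynomialSpace n lam).topologicalClosure ≤ bergmanSpace n lam := by
  intro F hF
  rw [← SetLike.mem_coe, Submodule.topologicalClosure_coe, mem_closure_iff_seq_limit] at hF
  obtain ⟨u, hu, hlim⟩ := hF
  rw [polynomialSpace_eq_range h.le] at hu
  choose f hf using hu
  have hcauchy := hlim.cauchySeq
  have hsub : ∀ k l, polyLp h.le (f k - f l) = u k - u l := fun k l => by rw [map_sub, hf, hf]
  have hcs : ∀ w ∈ polydisc n, CauchySeq fun k => eval w (f k) := by
    intro w hw
    have hw' : ‖w‖ < 1 := by simpa [polydisc_eq_ball] using hw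
    obtain ⟨C, hC0, hC⟩ := exists_norm_eval_le (n := n) h.le (norm_nonneg w) hw'
    refine (uniformCauchySeqOn_of_bound hcauchy (φ := fun k z => eval z (f k)) (s := {w}) hC0
      ?_).cauchySeq (Set.mem_singleton w)
    rintro k l x rfl
    rw [← map_sub, ← hsub]
    exact hC _ _ fun i => norm_le_pi_norm x i
  set g : (Fin n → ℂ) → ℂ := fun w => Filter.atTop.limUnder fun k => eval w (f k) with hg
  have hlimg : ∀ w ∈ polydisc n, Filter.Tendsto (fun k => eval w (f k)) Filter.atTop (nhds (g w)) :=
    fun w hw => (hcs w hw).tendsto_limUnder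
  refine ⟨g, ?_, ?_⟩
  · intro w hw
    have hw' : ‖w‖ < 1 := by simpa [polydisc_eq_ball] using hw
    obtain ⟨r, hr1, hr2⟩ := exists_between hw'
    have hr0 : 0 ≤ r := (norm_nonneg w).trans hr1.le
    obtain ⟨C, hC0, hC⟩ := exists_norm_fderiv_eval_le (n := n) h.le hr0 hr2
    have hUC : UniformCauchySeqOn (fun k => fderiv ℂ fun z => eval z (f k)) Filter.atTop
        (Metric.ball 0 r) := by
      refine uniformCauchySeqOn_of_bound hcauchy hC0 fun k l x hx => ?_
      rw [← hsub, ← fderiv_fun_sub (differentiable_eval _ x) (differentiable_eval _ x)]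
      have := hC (f k - f l) x (by simpa using hx)
      simpa using this
    have hlim' : ∀ x ∈ Metric.ball (0 : Fin n → ℂ) r, Filter.Tendsto
        (fun k => fderiv ℂ (fun z => eval z (f k)) x) Filter.atTop
        (nhds (Filter.atTop.limUnder fun k => fderiv ℂ (fun z => eval z (f k)) x)) :=
      fun x hx => (hUC.cauchySeq hx).tendsto_limUnder
    have hU := hUC.tendstoUniformlyOn_of_tendsto hlim'
    have hmem : w ∈ Metric.ball (0 : Fin n → ℂ) r := by simpa using hr1
    refine (hasFDerivAt_of_tendstoLocallyUniformlyOn Metric.isOpen_ball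
      hU.tendstoLocallyUniformlyOn (fun k x _ => (differentiable_eval (f k) x).hasFDerivAt)
      (fun x hx => hlimg x ?_) hmem).differentiableAt.differentiableWithinAt
    rw [polydisc_eq_ball]
    exact Metric.ball_subset_ball hr2.le hx
  · obtain ⟨ns, hmono, hns⟩ := (tendstoInMeasure_of_tendsto_Lp hlim).exists_seq_tendsto_ae
    have hall : ∀ᵐ z ∂weightMeasure n lam, ∀ k, u k z = eval z (f k) := by
      rw [ae_all_iff]
      intro k
      rw [← hf k]
      exact polyLp_coeFn h.le (f k)
    filter_upwards [hall, hns, ae_mem_polydisc h] with z h1 h2 h3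
    simp only [h1] at h2
    exact tendsto_nhds_unique h2 ((hlimg z h3).comp hmono.tendsto_atTop)

end Closure

/-! ### Fourier coefficients of holomorphic functions -/

section Fourier

open UnitAddTorus

lemma toCircle_pow_eq_fourier (t : UnitAddCircle) (m : ℕ) :
    (AddCircle.toCircle t : ℂ) ^ m = fourier (m : ℤ) t := by
  rw [fourier_apply, natCast_zsmul, AddCircle.toCircle_nsmul, Circle.coe_pow]

lemma integral_fourier (k : ℤ) :
    ∫ t : UnitAddCircle, fourier k t ∂AddCircle.haarAddCircle = if k = 0 then 1 else 0 := by
  split_ifs with h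
  · subst h
    simp
  · exact integral_eq_zero_of_add_right_eq_neg (fourier_add_half_inv_index h one_pos)

/-- Integrate the Taylor series termwise; only the term of degree k survives. The coefficient c does
not depend on ζ. -/
lemma integral_fourier_holomorphic {g : ℂ → ℂ} (hg : DifferentiableOn ℂ g (Metric.ball 0 1))
    (k : ℤ) : ∃ c : ℂ, ∀ ζ ∈ Metric.ball (0 : ℂ) 1,
      ∫ t : UnitAddCircle, fourier (-k) t * g (AddCircle.toCircle t * ζ) ∂AddCircle.haarAddCircle =
        if 0 ≤ k then c * ζ ^ k.toNat else 0 := by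
  set a : ℕ → ℂ := fun m => (m.factorial : ℂ)⁻¹ * iteratedDeriv m g 0 with ha
  refine ⟨a k.toNat, fun ζ hζ => ?_⟩
  have hser : ∀ z ∈ Metric.ball (0 : ℂ) 1, HasSum (fun m => a m * z ^ m) (g z) := by
    intro z hz
    have := Complex.hasSum_taylorSeries_on_ball hg hz
    simp only [sub_zero, smul_eq_mul] at this
    have h1 : (fun m => a m * z ^ m) =
        fun m => (m.factorial : ℂ)⁻¹ * (z ^ m * iteratedDeriv m g 0) := by
      ext m
      simp only [ha]
      ring
    rwa [h1]
  have hnorm : ∀ t : UnitAddCircle, ‖(AddCircle.toCircle t : ℂ) * ζ‖ = ‖ζ‖ := by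
    intro t
    rw [norm_mul, Circle.norm_coe, one_mul]
  have hterm : ∀ (m : ℕ) (t : UnitAddCircle),
      fourier (-k) t * (a m * ((AddCircle.toCircle t : ℂ) * ζ) ^ m) =
        a m * ζ ^ m * fourier (m - k) t := by
    intro m t
    rw [mul_pow, toCircle_pow_eq_fourier, sub_eq_add_neg, fourier_add]
    ring
  have hsum := hasSum_integral_of_summable_integral_norm
    (μ := (AddCircle.haarAddCircle : Measure UnitAddCircle))
    (F := fun (m : ℕ) (t : UnitAddCircle) =>
      fourier (-k) t * (a m * ((AddCircle.toCircle t : ℂ) * ζ) ^ m)) ?_ ?_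
  · have h1 : ∀ t : UnitAddCircle, ∑' m : ℕ,
        fourier (-k) t * (a m * ((AddCircle.toCircle t : ℂ) * ζ) ^ m) =
        fourier (-k) t * g (AddCircle.toCircle t * ζ) := by
      intro t
      refine ((hser _ ?_).mul_left _).tsum_eq
      rw [mem_ball_zero_iff, hnorm]
      exact mem_ball_zero_iff.mp hζ
    simp_rw [h1, hterm, integral_const_mul, integral_fourier] at hsum
    refine hsum.unique ?_
    split_ifs with hk
    · convert hasSum_single k.toNat ?_ using 1
      · rw [if_pos (by omega), mul_one]
      · intro m hm
        rw [if_neg (by omega), mul_zero]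
    · convert hasSum_zero using 2 with m
      rw [if_neg (by omega), mul_zero]
  · intro m
    simp_rw [hterm]
    exact ((map_continuous (fourier (T := (1 : ℝ)) (m - k))).integrable_of_hasCompactSupport
      (HasCompactSupport.of_compactSpace _)).const_mul _
  · simp_rw [hterm, norm_mul (a _ * ζ ^ _), fourier_apply, Circle.norm_coe]
    simpa using (hser ζ hζ).summable.norm

variable {n : ℕ}

/-- The action of the torus on `ℂ^n`. -/
def torusAct (t : UnitAddTorus (Fin n)) (z : Fin n → ℂ) : Fin n → ℂ :=
  fun i => (AddCircle.toCircle (t i) : ℂ) * z i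

lemma torusAct_mem_polydisc (t : UnitAddTorus (Fin n)) {z : Fin n → ℂ} (hz : z ∈ polydisc n) :
    torusAct t z ∈ polydisc n := by
  intro i
  rw [torusAct, norm_mul, Circle.norm_coe, one_mul]
  exact hz i

lemma continuous_torusAct_left (z : Fin n → ℂ) : Continuous fun t => torusAct t z :=
  continuous_pi fun i => (continuous_subtype_val.comp
    (AddCircle.continuous_toCircle.comp (continuous_apply i))).mul continuous_const

lemma torusAct_update (t : UnitAddTorus (Fin n)) (z : Fin n → ℂ) (i : Fin n) (ζ : ℂ) :
    torusAct t (Function.update z i ζ) =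
      Function.update (torusAct t z) i (AddCircle.toCircle (t i) * ζ) := by
  ext j
  rcases eq_or_ne j i with rfl | hj
  · simp [torusAct]
  · simp [torusAct, hj]

lemma update_mem_polydisc {z : Fin n → ℂ} (hz : z ∈ polydisc n) (i : Fin n) {ζ : ℂ}
    (hζ : ζ ∈ Metric.ball (0 : ℂ) 1) : Function.update z i ζ ∈ polydisc n := by
  intro j
  rcases eq_or_ne j i with rfl | hj
  · simpa using hζ
  · simpa [hj] using hz j

lemma fourier_apply_add (k : ℤ) (x y : UnitAddCircle) :
    fourier k (x + y) = fourier k x * fourier k y := by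
  simp [fourier_apply, smul_add, AddCircle.toCircle_add]

lemma mFourier_add_single (β : Fin n → ℤ) (t : UnitAddTorus (Fin n)) (i : Fin n)
    (s : UnitAddCircle) :
    mFourier β (t + Pi.single i s) = mFourier β t * fourier (β i) s := by
  change ∏ j, fourier (β j) (t j + (Pi.single i s : UnitAddTorus (Fin n)) j) =
    (∏ j, fourier (β j) (t j)) * fourier (β i) s
  simp_rw [fourier_apply_add, Finset.prod_mul_distrib]
  congr 1
  rw [Finset.prod_eq_single i]
  · rw [Pi.single_eq_same]
  · intro j _ hj
    rw [Pi.single_eq_of_ne hj, fourier_eval_zero]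
  · simp

/-- The Haar measure of the torus. -/
abbrev torusHaar (n : ℕ) : Measure (UnitAddTorus (Fin n)) :=
  Measure.pi fun _ => AddCircle.haarAddCircle

/-- The component of `f` of degree `β` for the action of the torus. -/
def torusPart (f : (Fin n → ℂ) → ℂ) (β : Fin n → ℤ) (z : Fin n → ℂ) : ℂ :=
  ∫ t, mFourier (-β) t * f (torusAct t z) ∂torusHaar n

lemma continuous_comp_torusAct {f : (Fin n → ℂ) → ℂ} (hf : DifferentiableOn ℂ f (polydisc n))
    {z : Fin n → ℂ} (hz : z ∈ polydisc n) : Continuous fun t => f (torusAct t z) :=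
  hf.continuousOn.comp_continuous (continuous_torusAct_left z) fun t => torusAct_mem_polydisc t hz

/-- By invariance of Haar measure an extra average over rotations of the i-th coordinate is free,
and the inner integral is then the one of `integral_fourier_holomorphic`. Measurability of c is not
needed, since only constants are pulled out of its integral. -/
lemma exists_torusPart_update_eq {f : (Fin n → ℂ) → ℂ} (hf : DifferentiableOn ℂ f (polydisc n))
    (β : Fin n → ℤ) {z : Fin n → ℂ} (hz : z ∈ polydisc n) (i : Fin n) :
    ∃ c : UnitAddTorus (Fin n) → ℂ, ∀ ζ ∈ Metric.ball (0 : ℂ) 1,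
      torusPart f β (Function.update z i ζ) =
        ∫ t, mFourier (-β) t * (if 0 ≤ β i then c t * ζ ^ (β i).toNat else 0) ∂torusHaar n := by
  have hdiff : ∀ t : UnitAddTorus (Fin n), DifferentiableOn ℂ
      (fun ζ => f (Function.update (torusAct t z) i (AddCircle.toCircle (t i) * ζ)))
      (Metric.ball 0 1) := by
    intro t
    refine hf.comp (fun ζ _ => ?_) fun ζ hζ => ?_
    · refine DifferentiableAt.differentiableWithinAt ?_
      rw [differentiableAt_pi]
      intro j
      rcases eq_or_ne j i with rfl | hj
      · simp only [Function.update_self]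
        fun_prop
      · simp only [Function.update_of_ne hj]
        fun_prop
    · rw [← torusAct_update]
      exact torusAct_mem_polydisc t (update_mem_polydisc hz i hζ)
  choose c hc using fun t => integral_fourier_holomorphic (hdiff t) (β i)
  refine ⟨c, fun ζ hζ => ?_⟩
  have hw := update_mem_polydisc hz i hζ
  set G : UnitAddTorus (Fin n) → ℂ := fun t =>
    mFourier (-β) t * f (torusAct t (Function.update z i ζ)) with hG
  have hGc : Continuous G := (map_continuous _).mul (continuous_comp_torusAct hf hw)
  have h1 : ∀ s : UnitAddCircle, ∫ t, G (t + Pi.single i s) ∂torusHaar n = ∫ t, G t ∂torusHaar n :=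
    fun s => integral_add_right_eq_self G _
  have hcont : Continuous (Function.uncurry fun (s : UnitAddCircle) (t : UnitAddTorus (Fin n)) =>
      G (t + Pi.single i s)) :=
    hGc.comp (continuous_snd.add ((continuous_single i).comp continuous_fst))
  have h2 : torusPart f β (Function.update z i ζ) = ∫ s : UnitAddCircle,
      ∫ t, G (t + Pi.single i s) ∂torusHaar n ∂AddCircle.haarAddCircle := by
    simp_rw [h1]
    simp [torusPart, hG]
  rw [h2, integral_integral_swap (hcont.integrable_of_hasCompactSupport
    (HasCompactSupport.of_compactSpace _))]
  refine integral_congr_ae (.of_forall fun t => ?_)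
  simp only []
  rw [← hc t ζ hζ, ← integral_const_mul]
  refine integral_congr_ae (.of_forall fun s => ?_)
  simp only [hG]
  rw [mFourier_add_single, Pi.neg_apply, mul_assoc]
  congr 3
  ext j
  rcases eq_or_ne j i with rfl | hj
  · simp [torusAct, AddCircle.toCircle_add, mul_assoc]
  · simp [torusAct, hj]

/-- Proportionality to a power of the i-th coordinate, cross-multiplied so that vanishing
coordinates need no separate case. -/
lemma torusPart_mul_pow {f : (Fin n → ℂ) → ℂ} (hf : DifferentiableOn ℂ f (polydisc n))
    {β : Fin n → ℤ} {z : Fin n → ℂ} (hz : z ∈ polydisc n) {i : Fin n} (hi : 0 ≤ β i) {ζ : ℂ}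
    (hζ : ζ ∈ Metric.ball (0 : ℂ) 1) :
    torusPart f β z * ζ ^ (β i).toNat =
      torusPart f β (Function.update z i ζ) * z i ^ (β i).toNat := by
  obtain ⟨c, hc⟩ := exists_torusPart_update_eq hf β hz i
  have h1 := hc (z i) (mem_ball_zero_iff.mpr (hz i))
  rw [Function.update_eq_self] at h1
  rw [h1, hc ζ hζ, ← integral_mul_const, ← integral_mul_const]
  refine integral_congr_ae (.of_forall fun t => ?_)
  simp only [if_pos hi]
  ring

lemma torusPart_eq_zero_of_neg {f : (Fin n → ℂ) → ℂ} (hf : DifferentiableOn ℂ f (polydisc n))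
    {β : Fin n → ℤ} {z : Fin n → ℂ} (hz : z ∈ polydisc n) {i : Fin n} (hi : β i < 0) :
    torusPart f β z = 0 := by
  obtain ⟨c, hc⟩ := exists_torusPart_update_eq hf β hz i
  have h1 := hc (z i) (mem_ball_zero_iff.mpr (hz i))
  rw [Function.update_eq_self] at h1
  rw [h1]
  simp [not_le.mpr hi]

/-- The components of a holomorphic function are multiples of monomials. -/
lemma torusPart_mul_prod {f : (Fin n → ℂ) → ℂ} (hf : DifferentiableOn ℂ f (polydisc n))
    (b : Fin n → ℕ) {z w : Fin n → ℂ} (hz : z ∈ polydisc n) (hw : w ∈ polydisc n) :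
    torusPart f (fun i => b i) z * ∏ i, w i ^ b i =
      torusPart f (fun i => b i) w * ∏ i, z i ^ b i := by
  have hpw : ∀ S : Finset (Fin n), S.piecewise w z ∈ polydisc n := by
    intro S i
    by_cases hi : i ∈ S
    · simpa [hi] using hw i
    · simpa [hi] using hz i
  have key : ∀ S : Finset (Fin n), torusPart f (fun i => b i) z * ∏ i ∈ S, w i ^ b i =
      torusPart f (fun i => b i) (S.piecewise w z) * ∏ i ∈ S, z i ^ b i := by
    intro S
    induction S using Finset.induction_on with
    | empty => simp
    | insert i S hi ih =>
      have h1 := torusPart_mul_pow hf (β := fun i => (b i : ℤ)) (hpw S) (i := i) (by positivity)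
        (mem_ball_zero_iff.mpr (hw i))
      simp only [Int.toNat_natCast, Finset.piecewise_eq_of_notMem _ _ _ hi] at h1
      rw [Finset.prod_insert hi, Finset.prod_insert hi, Finset.piecewise_insert, ← mul_assoc,
        mul_right_comm, ih, mul_right_comm, h1]
      ring
  have := key Finset.univ
  simpa using this

/-- The values on the torus orbit of z form a continuous function with vanishing Fourier
coefficients; evaluate its Fourier series at the identity. -/
lemma eq_zero_of_torusPart_eq_zero {f : (Fin n → ℂ) → ℂ}
    (hf : DifferentiableOn ℂ f (polydisc n)) {z : Fin n → ℂ} (hz : z ∈ polydisc n)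
    (h : ∀ β, torusPart f β z = 0) : f z = 0 := by
  let g : C(UnitAddTorus (Fin n), ℂ) := ⟨fun t => f (torusAct t z), continuous_comp_torusAct hf hz⟩
  have h0 : mFourierCoeff g = 0 := by
    ext β
    exact h β
  have h1 := hasSum_mFourier_series_apply_of_summable (f := g) (by rw [h0]; exact summable_zero) 0
  simp only [h0, Pi.zero_apply, zero_smul] at h1
  have h2 := h1.unique hasSum_zero
  have h3 : torusAct 0 z = z := by
    ext i
    simp [torusAct]
  simpa [g, h3] using h2

end Fourier

/-! ### Density of the polynomials -/

section Density

open UnitAddTorus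

variable {n : ℕ} {lam : ℝ}

lemma measurePreserving_torusAct (h : 1 ≤ lam) (t : UnitAddTorus (Fin n)) :
    MeasurePreserving (torusAct t) (weightMeasure n lam) (weightMeasure n lam) :=
  measurePreserving_rotation h fun i => AddCircle.toCircle (t i)

lemma measurable_torusAct :
    Measurable fun x : UnitAddTorus (Fin n) × (Fin n → ℂ) => torusAct x.1 x.2 :=
  measurable_pi_lambda _ fun i =>
    (measurable_toCircle_coe.comp ((measurable_pi_apply i).comp measurable_fst)).mul
      ((measurable_pi_apply i).comp measurable_snd)

lemma star_eval_monomial_torusAct (m : Fin n →₀ ℕ) (t : UnitAddTorus (Fin n)) (z : Fin n → ℂ) :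
    star (eval (torusAct t z) (monomial m 1)) =
      mFourier (-fun i => (m i : ℤ)) t * star (eval z (monomial m 1)) := by
  rw [mFourier_neg, eval_monomial_one, eval_monomial_one]
  change _ = star (∏ i, fourier (m i : ℤ) (t i)) * _
  rw [← star_mul', ← Finset.prod_mul_distrib]
  congr 1
  refine Finset.prod_congr rfl fun i _ => ?_
  rw [torusAct, mul_pow, toCircle_pow_eq_fourier]

/-- Average conj(z^m) f over torus orbits. By Fubini and invariance its integral is unchanged, while
the average over an orbit is a constant times |z^m|². The vanishing inner product is therefore this
constant times a positive norm. -/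
lemma torusPart_eq_zero_of_inner_eq_zero (h : 1 < lam) {f : (Fin n → ℂ) → ℂ}
    (hf : DifferentiableOn ℂ f (polydisc n)) {F : WeightedL2 n lam}
    (hF : F =ᵐ[weightMeasure n lam] f) (m : Fin n →₀ ℕ)
    (hm : inner ℂ (polyLp h.le (monomial m 1)) F = 0) {z : Fin n → ℂ} (hz : z ∈ polydisc n) :
    torusPart f (fun i => m i) z = 0 := by
  have hfin := isFiniteMeasure_weightMeasure (n := n) h.le
  -- Outside the polydisc f is arbitrary; cutting it off gives the joint measurability that Fubini
  -- requires.
  set g : (Fin n → ℂ) → ℂ := (polydisc n).indicator f with hg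
  have hgm : Measurable g := by
    classical
    have := hf.continuousOn.measurable_piecewise (g := 0) continuousOn_const
      measurableSet_polydisc
    rwa [Set.piecewise_eq_indicator] at this
  have hFg : F =ᵐ[weightMeasure n lam] g := by
    filter_upwards [hF, ae_mem_polydisc h] with x h1 h2
    rw [h1, hg, Set.indicator_of_mem h2]
  have hg2 : MemLp g 2 (weightMeasure n lam) := (memLp_congr_ae hFg).mp (Lp.memLp F)
  set K : (Fin n → ℂ) → ℂ := fun x => star (eval x (monomial m 1)) * g x with hK
  have hKm : Measurable K :=
    (continuous_star.comp (continuous_eval_apply _)).measurable.mul hgm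
  have hKint : Integrable K (weightMeasure n lam) :=
    (memLp_eval h.le (monomial m 1)).star.integrable_mul hg2
  have hK0 : ∫ x, K x ∂weightMeasure n lam = 0 := by
    rw [← hm, inner_polyLp_left]
    refine integral_congr_ae ?_
    filter_upwards [hFg] with x hx
    simp only [hK, hx]
  have hcomp : ∀ t, ∫ x, K (torusAct t x) ∂weightMeasure n lam = 0 := by
    intro t
    have h1 := measurePreserving_torusAct h.le t
    rw [← hK0]
    conv_rhs => rw [← h1.map_eq, integral_map h1.measurable.aemeasurable
      hKm.aestronglyMeasurable]
  have hint : Integrable (Function.uncurry fun t x => K (torusAct t x))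
      ((torusHaar n).prod (weightMeasure n lam)) := by
    have hmeas : Measurable (Function.uncurry fun t x => K (torusAct t x)) :=
      hKm.comp measurable_torusAct
    rw [integrable_prod_iff hmeas.aestronglyMeasurable]
    refine ⟨.of_forall fun t =>
      ((measurePreserving_torusAct h.le t).integrable_comp hKint.aestronglyMeasurable).mpr hKint,
      ?_⟩
    have h2 : ∀ t, ∫ x, ‖K (torusAct t x)‖ ∂weightMeasure n lam =
        ∫ x, ‖K x‖ ∂weightMeasure n lam := by
      intro t
      have h1 := measurePreserving_torusAct h.le t
      conv_rhs => rw [← h1.map_eq, integral_map h1.measurable.aemeasurable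
        hKm.norm.aestronglyMeasurable]
    simp only [Function.uncurry_apply_pair, h2]
    exact integrable_const _
  have hswap := integral_integral_swap hint
  simp only [hcomp, integral_zero] at hswap
  -- A base point without zero coordinates, at which the constant of proportionality can be read
  -- off.
  set w : Fin n → ℂ := fun _ => 1 / 2 with hw
  have hwp : w ∈ polydisc n := by
    intro i
    norm_num [hw]
  have hw0 : ∏ i, w i ^ m i ≠ 0 := Finset.prod_ne_zero_iff.mpr fun i _ => by simp [hw]
  have hinner : ∀ x ∈ polydisc n, ∫ t, K (torusAct t x) ∂torusHaar n =
      torusPart f (fun i => m i) w / (∏ i, w i ^ m i) *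
        (star (eval x (monomial m 1)) * eval x (monomial m 1)) := by
    intro x hx
    have h1 : ∀ t, K (torusAct t x) = star (eval x (monomial m 1)) *
        (mFourier (-fun i => (m i : ℤ)) t * f (torusAct t x)) := by
      intro t
      simp only [hK]
      rw [star_eval_monomial_torusAct, hg, Set.indicator_of_mem (torusAct_mem_polydisc t hx)]
      ring
    simp_rw [h1]
    rw [integral_const_mul]
    have h2 := torusPart_mul_prod hf (fun i => m i) hx hwp
    have h3 : torusPart f (fun i => m i) x =
        torusPart f (fun i => m i) w / (∏ i, w i ^ m i) * eval x (monomial m 1) := by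
      rw [eval_monomial_one, div_mul_eq_mul_div, eq_div_iff hw0, h2]
    rw [torusPart] at h3
    rw [h3]
    ring
  have hfinal : ∫ x, ∫ t, K (torusAct t x) ∂torusHaar n ∂weightMeasure n lam =
      torusPart f (fun i => m i) w / (∏ i, w i ^ m i) * monomialNormSq lam m := by
    have h1 := inner_monomial_monomial h.le m m
    rw [if_pos rfl, inner_polyLp_left] at h1
    rw [← h1, ← integral_const_mul]
    refine integral_congr_ae ?_
    filter_upwards [ae_mem_polydisc h, polyLp_coeFn h.le (monomial m 1)] with x hx h2
    rw [hinner x hx, h2]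
  rw [← hswap] at hfinal
  have hn0 : (monomialNormSq lam m : ℂ) ≠ 0 := by
    exact_mod_cast (monomialNormSq_pos h.le m).ne'
  have hw1 : torusPart f (fun i => m i) w = 0 := by
    have := mul_eq_zero.mp hfinal.symm
    simpa [hn0, hw0, div_eq_zero_iff] using this
  have h4 := torusPart_mul_prod hf (fun i => m i) hz hwp
  rw [hw1, zero_mul] at h4
  exact (mul_eq_zero.mp h4).resolve_right hw0

lemma eq_zero_of_inner_monomial_eq_zero (h : 1 < lam) {F : WeightedL2 n lam}
    (hF : F ∈ bergmanSpace n lam)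
    (hm : ∀ m : Fin n →₀ ℕ, inner ℂ (polyLp h.le (monomial m 1)) F = 0) : F = 0 := by
  obtain ⟨f, hf, hFf⟩ := hF
  have h1 : ∀ z ∈ polydisc n, f z = 0 := by
    intro z hz
    refine eq_zero_of_torusPart_eq_zero hf hz fun β => ?_
    by_cases hβ : ∃ i, β i < 0
    · obtain ⟨i, hi⟩ := hβ
      exact torusPart_eq_zero_of_neg hf hz hi
    · push Not at hβ
      have h2 := torusPart_eq_zero_of_inner_eq_zero h hf hFf
        (Finsupp.equivFunOnFinite.symm fun i => (β i).toNat) (hm _) hz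
      have h3 : (fun i => (((Finsupp.equivFunOnFinite.symm fun i => (β i).toNat) : Fin n →₀ ℕ) i : ℤ))
          = β := by
        ext i
        simpa using hβ i
      rwa [h3] at h2
  ext1
  filter_upwards [hFf, ae_mem_polydisc h, Lp.coeFn_zero ℂ 2 (weightMeasure n lam)] with z h2 h3 h4
  rw [h2, h1 z h3, h4]
  rfl

/-- For every `lam ≥ 1`, the space `𝔸^(lam)` is the closure of the polynomials. -/
theorem weightedBergman_eq_closure (h : 1 ≤ lam) :
    weightedBergman n lam = (polynomialSpace n lam).topologicalClosure := by
  rcases h.eq_or_lt with rfl | h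
  · exact if_pos rfl
  rw [weightedBergman, if_neg h.ne']
  refine le_antisymm (fun F hF => ?_) (closure_le_bergmanSpace h)
  set K := (polynomialSpace n lam).topologicalClosure with hK
  have : CompleteSpace K := (Submodule.isClosed_topologicalClosure _).completeSpace_coe
  -- The difference is again holomorphic and is orthogonal to all monomials.
  have h1 : F - K.starProjection F = 0 := by
    refine eq_zero_of_inner_monomial_eq_zero h ((bergmanSpace n lam).sub_mem hF
      (closure_le_bergmanSpace h (K.starProjection_apply_mem F))) fun m => ?_
    exact Submodule.inner_right_of_mem_orthogonal (polyLp_mem_closure h.le _)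
      (K.sub_starProjection_mem_orthogonal F)
  rw [sub_eq_zero.mp h1]
  exact K.starProjection_apply_mem F

lemma isClosed_weightedBergman (h : 1 ≤ lam) :
    IsClosed (weightedBergman n lam : Set (WeightedL2 n lam)) := by
  rw [weightedBergman_eq_closure h]
  exact Submodule.isClosed_topologicalClosure _

lemma polyLp_mem_weightedBergman (h : 1 ≤ lam) (f : MvPolynomial (Fin n) ℂ) :
    polyLp h f ∈ weightedBergman n lam := by
  rw [weightedBergman_eq_closure h]
  exact polyLp_mem_closure h f

/-- A closed condition on `𝔸^(lam)` may be checked on polynomials. -/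
lemma weightedBergman_induction (h : 1 ≤ lam) {P : WeightedL2 n lam → Prop}
    (hP : IsClosed {F | P F}) (hpoly : ∀ f, P (polyLp h f)) {F : WeightedL2 n lam}
    (hF : F ∈ weightedBergman n lam) : P F := by
  rw [weightedBergman_eq_closure h, ← SetLike.mem_coe, Submodule.topologicalClosure_coe,
    polynomialSpace_eq_range h] at hF
  refine closure_minimal ?_ hP hF
  rintro _ ⟨f, rfl⟩
  exact hpoly f

lemma mulOp_mem_weightedBergman (h : 1 ≤ lam) (g : MvPolynomial (Fin n) ℂ) {F : WeightedL2 n lam}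
    (hF : F ∈ weightedBergman n lam) : mulOp h g F ∈ weightedBergman n lam := by
  refine weightedBergman_induction h (P := fun F => mulOp h g F ∈ weightedBergman n lam)
    ((isClosed_weightedBergman h).preimage (mulOp h g).continuous) (fun f => ?_) hF
  rw [mulOp_polyLp]
  exact polyLp_mem_weightedBergman h _

lemma permOp_mem_weightedBergman (h : 1 ≤ lam) (σ : Equiv.Perm (Fin n)) {F : WeightedL2 n lam}
    (hF : F ∈ weightedBergman n lam) : permOp lam σ F ∈ weightedBergman n lam := by
  refine weightedBergman_induction h (P := fun F => permOp lam σ F ∈ weightedBergman n lam)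
    ((isClosed_weightedBergman h).preimage (continuous_permOp σ)) (fun f => ?_) hF
  rw [permOp_polyLp]
  exact polyLp_mem_weightedBergman h _

lemma eq_zero_of_inner_monomial (h : 1 ≤ lam) {F : WeightedL2 n lam}
    (hF : F ∈ weightedBergman n lam)
    (hm : ∀ m : Fin n →₀ ℕ, inner ℂ (polyLp h (monomial m 1)) F = 0) : F = 0 := by
  have h1 : ∀ f, inner ℂ (polyLp h f) F = 0 := by
    intro f
    induction f using MvPolynomial.induction_on' with
    | monomial b c =>
      have : monomial b c = c • monomial b (1 : ℂ) := by simp [smul_monomial]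
      rw [this, map_smul, inner_smul_left, hm, mul_zero]
    | add f g hf hg => rw [map_add, inner_add_left, hf, hg, add_zero]
  have h2 : inner ℂ F F = 0 :=
    weightedBergman_induction h (P := fun G => inner ℂ G F = 0)
      (isClosed_eq (by fun_prop) continuous_const) h1 hF
  exact inner_self_eq_zero.mp h2

end Density

/-! ### The isotypic pieces as closed invariant subspaces -/

section ProjSpace

variable {n d : ℕ} {lam : ℝ} {p : n.Partition}
  {π : Equiv.Perm (Fin n) →* Matrix.unitaryGroup (Fin d) ℂ}

lemma projOp_mem_weightedBergman (h : 1 ≤ lam) (i j : Fin d) {F : WeightedL2 n lam}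
    (hF : F ∈ weightedBergman n lam) : projOp lam π i j F ∈ weightedBergman n lam := by
  rw [projOp_apply]
  exact Submodule.smul_mem _ _ (Submodule.sum_mem _ fun σ _ =>
    Submodule.smul_mem _ _ (permOp_mem_weightedBergman h σ hF))

lemma BelongsTo.mem_projSpace_iff (hπ : BelongsTo π p) (h : 1 ≤ lam) {i : Fin d}
    {F : WeightedL2 n lam} :
    F ∈ projSpace lam π i i ↔ F ∈ weightedBergman n lam ∧ projOp lam π i i F = F := by
  constructor
  · rintro ⟨G, hG, rfl⟩
    exact ⟨projOp_mem_weightedBergman h i i hG, hπ.projOp_projOp i G⟩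
  · rintro ⟨h1, h2⟩
    exact ⟨F, h1, h2⟩

lemma BelongsTo.completeSpace_projSpace (hπ : BelongsTo π p) (h : 1 ≤ lam) (i : Fin d) :
    CompleteSpace (projSpace lam π i i) := by
  have h1 : (projSpace lam π i i : Set (WeightedL2 n lam)) =
      (weightedBergman n lam : Set (WeightedL2 n lam)) ∩ {F | projOp lam π i i F = F} := by
    ext F
    exact hπ.mem_projSpace_iff h
  have h2 : IsClosed (projSpace lam π i i : Set (WeightedL2 n lam)) := by
    rw [h1]
    exact (isClosed_weightedBergman h).inter (isClosed_eq (continuous_projOp i i) continuous_id)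
  exact h2.completeSpace_coe

lemma BelongsTo.mulOp_mem_projSpace (hπ : BelongsTo π p) (h : 1 ≤ lam) {i : Fin d}
    {g : MvPolynomial (Fin n) ℂ} (hg : g.IsSymmetric) {F : WeightedL2 n lam}
    (hF : F ∈ projSpace lam π i i) : mulOp h g F ∈ projSpace lam π i i := by
  rw [hπ.mem_projSpace_iff h] at hF ⊢
  refine ⟨mulOp_mem_weightedBergman h g hF.1, ?_⟩
  rw [← mulOp_projOp h hg, hF.2]

end ProjSpace

/-! ### The adjoint of multiplication by a power sum -/

section Lowering

variable {n : ℕ} {lam : ℝ}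

/-- The ratio of the squared norms of `z ^ a` and `z ^ (a - k)`. -/
def momentRatio (lam : ℝ) (k a : ℕ) : ℝ := moment lam a / moment lam (a - k)

lemma monomialNormSq_eq_momentRatio_mul (h : 1 ≤ lam) {m : Fin n →₀ ℕ} {i : Fin n} {k : ℕ}
    (_ : k ≤ m i) : monomialNormSq lam m =
      momentRatio lam k (m i) * monomialNormSq lam (m - Finsupp.single i k) := by
  unfold monomialNormSq momentRatio
  rw [← Finset.mul_prod_erase _ _ (Finset.mem_univ i), ← Finset.mul_prod_erase (a := i) Finset.univ
    (fun j => moment lam ((m - Finsupp.single i k) j)) (Finset.mem_univ i), ← mul_assoc]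
  have h1 : (m - Finsupp.single i k) i = m i - k := by simp
  rw [h1, div_mul_cancel₀ _ (moment_pos h _).ne']
  congr 1
  refine Finset.prod_congr rfl fun j hj => ?_
  have hj' := Finset.ne_of_mem_erase hj
  simp [Finsupp.single_eq_of_ne hj']

/-- The adjoint of multiplication by the `k`-th power sum, on polynomials. -/
def psumLower (n : ℕ) (lam : ℝ) (k : ℕ) : MvPolynomial (Fin n) ℂ →ₗ[ℂ] MvPolynomial (Fin n) ℂ :=
  (basisMonomials (Fin n) ℂ).constr ℂ fun m => ∑ i, if k ≤ m i then
    monomial (m - Finsupp.single i k) (momentRatio lam k (m i) : ℂ) else 0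

lemma psumLower_monomial (k : ℕ) (m : Fin n →₀ ℕ) :
    psumLower n lam k (monomial m 1) = ∑ i, if k ≤ m i then
      monomial (m - Finsupp.single i k) (momentRatio lam k (m i) : ℂ) else 0 := by
  have := (basisMonomials (Fin n) ℂ).constr_basis ℂ (fun m => ∑ i, if k ≤ m i then
    monomial (m - Finsupp.single i k) (momentRatio lam k (m i) : ℂ) else 0) m
  rwa [coe_basisMonomials] at this

lemma inner_psumLower_polyLp (h : 1 ≤ lam) (k : ℕ) (f g : MvPolynomial (Fin n) ℂ) :
    inner ℂ (polyLp h (psumLower n lam k f)) (polyLp h g) =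
      inner ℂ (polyLp h f) (polyLp h (psum (Fin n) ℂ k * g)) := by
  induction f using MvPolynomial.induction_on' with
  | add f₁ f₂ h₁ h₂ => rw [map_add, map_add, map_add, inner_add_left, inner_add_left, h₁, h₂]
  | monomial m c =>
    have : monomial m c = c • monomial m (1 : ℂ) := by simp [smul_monomial]
    rw [this, map_smul, map_smul, map_smul, inner_smul_left, inner_smul_left]
    congr 1
    rw [inner_monomial_polyLp, psumLower_monomial, map_sum, sum_inner, psum, Finset.sum_mul,
      coeff_sum, Finset.mul_sum]
    refine Finset.sum_congr rfl fun i _ => ?_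
    rw [X_pow_eq_monomial, coeff_monomial_mul']
    by_cases hk : k ≤ m i
    · rw [if_pos hk, if_pos (Finsupp.single_le_iff.mpr hk)]
      have : monomial (m - Finsupp.single i k) (momentRatio lam k (m i) : ℂ) =
          (momentRatio lam k (m i) : ℂ) • monomial (m - Finsupp.single i k) (1 : ℂ) := by
        simp [smul_monomial]
      rw [this, map_smul, inner_smul_left, inner_monomial_polyLp,
        monomialNormSq_eq_momentRatio_mul h hk, Complex.conj_ofReal]
      push_cast
      ring
    · rw [if_neg hk, if_neg fun hk' => hk (Finsupp.single_le_iff.mp hk')]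
      simp

lemma inner_psumLower (h : 1 ≤ lam) (k : ℕ) (f : MvPolynomial (Fin n) ℂ) {G : WeightedL2 n lam}
    (hG : G ∈ weightedBergman n lam) :
    inner ℂ (polyLp h (psumLower n lam k f)) G =
      inner ℂ (polyLp h f) (mulOp h (psum (Fin n) ℂ k) G) := by
  refine weightedBergman_induction h (P := fun G => inner ℂ (polyLp h (psumLower n lam k f)) G =
      inner ℂ (polyLp h f) (mulOp h (psum (Fin n) ℂ k) G))
    (isClosed_eq (by fun_prop) (by fun_prop)) (fun g => ?_) hG
  rw [mulOp_polyLp]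
  exact inner_psumLower_polyLp h k f g

/-- The commutator of multiplication by the `k`-th power sum with its adjoint. -/
def psumCommutator (n : ℕ) (lam : ℝ) (k : ℕ) :
    MvPolynomial (Fin n) ℂ →ₗ[ℂ] MvPolynomial (Fin n) ℂ :=
  psumLower n lam k ∘ₗ LinearMap.mulLeft ℂ (psum (Fin n) ℂ k) -
    LinearMap.mulLeft ℂ (psum (Fin n) ℂ k) ∘ₗ psumLower n lam k

/-- The eigenvalue of `psumCommutator` at `z ^ a` in one variable. -/
def commutatorWeight (lam : ℝ) (k a : ℕ) : ℝ :=
  momentRatio lam k (a + k) - if k ≤ a then momentRatio lam k a else 0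

/-- The adjoint in coordinate i and multiplication in coordinate j commute for i ≠ j, so the cross
terms cancel. The terms with i = j lower and raise the same exponent and return a multiple of the
monomial. -/
lemma psumCommutator_monomial (k : ℕ) (m : Fin n →₀ ℕ) :
    psumCommutator n lam k (monomial m 1) =
      ((∑ i, commutatorWeight lam k (m i) : ℝ) : ℂ) • monomial m 1 := by
  simp only [psumCommutator, LinearMap.sub_apply, LinearMap.comp_apply, LinearMap.mulLeft_apply]
  rw [psumLower_monomial]
  have h1 : psum (Fin n) ℂ k * monomial m 1 = ∑ j, monomial (Finsupp.single j k + m) 1 := by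
    rw [psum, Finset.sum_mul]
    refine Finset.sum_congr rfl fun j _ => ?_
    rw [X_pow_eq_monomial, monomial_mul, one_mul]
  rw [h1, map_sum, psum, Finset.sum_mul, ← Finset.sum_sub_distrib, Complex.ofReal_sum,
    Finset.sum_smul]
  refine Finset.sum_congr rfl fun j _ => ?_
  rw [psumLower_monomial, Finset.mul_sum, ← Finset.sum_sub_distrib, Finset.sum_eq_single j]
  · rw [Finsupp.add_apply, Finsupp.single_eq_same, if_pos (Nat.le_add_right _ _),
      add_tsub_cancel_left, X_pow_eq_monomial, commutatorWeight, add_comm k]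
    split_ifs with hk
    · rw [monomial_mul, one_mul, add_tsub_cancel_of_le (Finsupp.single_le_iff.mpr hk), ← map_sub,
        smul_monomial]
      simp
    · simp [smul_monomial]
  · intro i _ hij
    have h2 : (Finsupp.single j k + m) i = m i := by simp [Finsupp.single_eq_of_ne hij]
    rw [h2, X_pow_eq_monomial]
    split_ifs with hk
    · rw [monomial_mul, one_mul, add_tsub_assoc_of_le (Finsupp.single_le_iff.mpr hk), sub_self]
    · simp
  · simp

end Lowering

/-! ### Contents are determined by the commutators -/

section Determination

variable {n : ℕ} {lam : ℝ}

lemma exponentCount_eq_sum (m : Fin n →₀ ℕ) (k : ℕ) :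
    exponentCount m k = ∑ c ∈ Finset.range k, (Finset.univ.filter fun i => m i = c).card := by
  rw [exponentCount, Finset.card_eq_sum_card_fiberwise (f := m) (t := Finset.range k)
    (fun i hi => by simpa using hi)]
  refine Finset.sum_congr rfl fun c hc => ?_
  congr 1
  ext i
  have := Finset.mem_range.mp hc
  simp
  omega

lemma exponentCount_mapDomain (σ : Equiv.Perm (Fin n)) (m : Fin n →₀ ℕ) (k : ℕ) :
    exponentCount (Finsupp.mapDomain σ m) k = exponentCount m k := by
  refine Finset.card_bij (fun i _ => σ.symm i) ?_ (by simp) ?_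
  · intro i hi
    rw [← Finsupp.equivMapDomain_eq_mapDomain, Finset.mem_filter] at hi
    exact Finset.mem_filter.mpr ⟨Finset.mem_univ _, hi.2⟩
  · intro i hi
    refine ⟨σ i, ?_, by simp⟩
    rw [← Finsupp.equivMapDomain_eq_mapDomain]
    refine Finset.mem_filter.mpr ⟨Finset.mem_univ _, ?_⟩
    rw [Finsupp.equivMapDomain_apply, Equiv.symm_apply_apply]
    exact (Finset.mem_filter.mp hi).2

/-- In the Hardy case all moment ratios are 1, so the weight is the indicator of an exponent below
k. -/
lemma sum_commutatorWeight_one (m : Fin n →₀ ℕ) (k : ℕ) :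
    ∑ i, commutatorWeight 1 k (m i) = exponentCount m k := by
  rw [exponentCount, Finset.card_filter]
  push_cast
  refine Finset.sum_congr rfl fun i _ => ?_
  simp only [commutatorWeight, momentRatio, moment_one]
  split_ifs <;> first | omega | norm_num

/-- For k beyond all exponents the weight at c is `moment lam (c + k) / moment lam c`. The
eigenvalue is then a shifted moment of the polynomial with terms x^(m i) / `moment lam (m i)`. These
determine the polynomial, whose coefficients are the multiplicities up to known factors. At lam = 1
large k carries no information, whence the separate Hardy argument. -/
lemma card_eq_of_sum_commutatorWeight (h : 1 < lam) {a b : Fin n →₀ ℕ}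
    (hab : ∀ k, ∑ i, commutatorWeight lam k (a i) = ∑ i, commutatorWeight lam k (b i)) (c : ℕ) :
    (Finset.univ.filter fun i => a i = c).card = (Finset.univ.filter fun i => b i = c).card := by
  set q : (Fin n →₀ ℕ) → Polynomial ℝ := fun m =>
    ∑ i, Polynomial.monomial (m i) (moment lam (m i))⁻¹ with hq
  set K := ∑ i, a i + ∑ i, b i + 1 with hK
  let ℓ : ℕ → Polynomial ℝ →ₗ[ℝ] ℝ := fun k =>
    Polynomial.lsum fun c => moment lam (c + k) • LinearMap.id
  have hℓ : ∀ k f, ℓ k f = ∑ c ∈ f.support, f.coeff c * moment lam (c + k) := by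
    intro k f
    simp [ℓ, Polynomial.lsum_apply, Polynomial.sum_def, mul_comm]
  have hℓq : ∀ k m, (∀ i, m i < k) → ℓ k (q m) = ∑ i, commutatorWeight lam k (m i) := by
    intro k m hm
    rw [hq, map_sum]
    refine Finset.sum_congr rfl fun i _ => ?_
    rw [Polynomial.lsum_apply, Polynomial.sum_monomial_index _ _ (by simp), commutatorWeight,
      if_neg (not_le.mpr (hm i)), sub_zero, momentRatio, Nat.add_sub_cancel, LinearMap.smul_apply,
      LinearMap.id_apply, smul_eq_mul, div_eq_mul_inv]
  have h0 : q a - q b = 0 := by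
    refine eq_zero_of_sum_moment h _ K fun k hk => ?_
    rw [← hℓ, map_sub, hℓq, hℓq, hab, sub_self]
    · intro i
      have := Finset.single_le_sum (f := b) (fun _ _ => Nat.zero_le _) (Finset.mem_univ i)
      omega
    · intro i
      have := Finset.single_le_sum (f := a) (fun _ _ => Nat.zero_le _) (Finset.mem_univ i)
      omega
  have hcoeff : ∀ m, (q m).coeff c =
      (Finset.univ.filter fun i => m i = c).card * (moment lam c)⁻¹ := by
    intro m
    rw [hq, Polynomial.finsetSum_coeff, Finset.card_filter, Nat.cast_sum, Finset.sum_mul]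
    refine Finset.sum_congr rfl fun i _ => ?_
    rw [Polynomial.coeff_monomial]
    split_ifs with hc
    · simp [hc]
    · simp
  have h1 := congrArg (fun f => f.coeff c) (sub_eq_zero.mp h0)
  simp only [hcoeff] at h1
  exact_mod_cast mul_right_cancel₀ (inv_ne_zero (moment_pos h.le c).ne') h1

lemma exponentCount_eq_of_sum_commutatorWeight (h : 1 ≤ lam) {a b : Fin n →₀ ℕ}
    (hab : ∀ k, ∑ i, commutatorWeight lam k (a i) = ∑ i, commutatorWeight lam k (b i)) (k : ℕ) :
    exponentCount a k = exponentCount b k := by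
  rcases h.eq_or_lt with rfl | h
  · have := hab k
    rw [sum_commutatorWeight_one, sum_commutatorWeight_one] at this
    exact_mod_cast this
  · rw [exponentCount_eq_sum, exponentCount_eq_sum]
    exact Finset.sum_congr rfl fun c _ => card_eq_of_sum_commutatorWeight h hab c

end Determination

/-! ### The projections on polynomials -/

section PolyProj

variable {n d : ℕ} {lam : ℝ} {p : n.Partition}
  {π : Equiv.Perm (Fin n) →* Matrix.unitaryGroup (Fin d) ℂ}

/-- The operator `projOp π i i` on polynomials. -/
def polyProj (π : Equiv.Perm (Fin n) →* Matrix.unitaryGroup (Fin d) ℂ) (i : Fin d) :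
    MvPolynomial (Fin n) ℂ →ₗ[ℂ] MvPolynomial (Fin n) ℂ :=
  ((d : ℂ) / n.factorial) • ∑ σ : Equiv.Perm (Fin n), repMat π σ i i • (rename σ).toLinearMap

lemma polyProj_apply (i : Fin d) (f : MvPolynomial (Fin n) ℂ) :
    polyProj π i f = ((d : ℂ) / n.factorial) •
      ∑ σ : Equiv.Perm (Fin n), repMat π σ i i • rename σ f := by
  simp [polyProj, LinearMap.sum_apply]

lemma projOp_polyLp (h : 1 ≤ lam) (i : Fin d) (f : MvPolynomial (Fin n) ℂ) :
    projOp lam π i i (polyLp h f) = polyLp h (polyProj π i f) := by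
  rw [projOp_apply, polyProj_apply, map_smul, map_sum]
  simp_rw [map_smul, permOp_polyLp]

/-- The eigenvalue is symmetric in the exponents, hence shared by all translates of the monomial. -/
lemma psumCommutator_polyProj (i : Fin d) (k : ℕ) (m : Fin n →₀ ℕ) :
    psumCommutator n lam k (polyProj π i (monomial m 1)) =
      ((∑ i, commutatorWeight lam k (m i) : ℝ) : ℂ) • polyProj π i (monomial m 1) := by
  rw [polyProj_apply, map_smul, map_sum, smul_comm]
  congr 1
  rw [Finset.smul_sum]
  refine Finset.sum_congr rfl fun σ _ => ?_
  rw [map_smul, smul_comm, rename_monomial, psumCommutator_monomial]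
  congr 3
  rw [← Finsupp.equivMapDomain_eq_mapDomain]
  simp_rw [Finsupp.equivMapDomain_apply]
  exact Equiv.sum_comp σ.symm fun i => commutatorWeight lam k (m i)

lemma polyLp_polyProj_mem (h : 1 ≤ lam) (i : Fin d)
    (f : MvPolynomial (Fin n) ℂ) : polyLp h (polyProj π i f) ∈ projSpace lam π i i :=
  ⟨polyLp h f, polyLp_mem_weightedBergman h f, projOp_polyLp h i f⟩

/-- The projection is self-adjoint and commutes with multiplication by the power sum, hence also
with its adjoint. -/
lemma BelongsTo.polyLp_psumLower_mem (hπ : BelongsTo π p) (h : 1 ≤ lam) {i : Fin d} (k : ℕ)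
    {f : MvPolynomial (Fin n) ℂ} (hf : polyLp h f ∈ projSpace lam π i i) :
    polyLp h (psumLower n lam k f) ∈ projSpace lam π i i := by
  rw [hπ.mem_projSpace_iff h] at hf ⊢
  have hA := polyLp_mem_weightedBergman h (psumLower n lam k f)
  refine ⟨hA, sub_eq_zero.mp (eq_zero_of_inner_monomial h ?_ fun m => ?_)⟩
  · exact Submodule.sub_mem _ (projOp_mem_weightedBergman h i i hA) hA
  · rw [← inner_conj_symm, map_eq_zero, inner_sub_left, inner_projOp, inner_psumLower h _ _
      (polyLp_mem_weightedBergman h _), inner_psumLower h _ _ (projOp_mem_weightedBergman h i i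
      (polyLp_mem_weightedBergman h _)), mulOp_projOp h (psum_isSymmetric _ _ _), ← inner_projOp,
      hf.2, sub_self]

/-- The projection does not vanish on some monomial occurring in the Specht module: the complex
conjugate of the `i`-th basis vector of the module is fixed by it. -/
lemma BelongsTo.exists_polyProj_monomial_ne_zero (hπ : BelongsTo π p) (i : Fin d) :
    ∃ m : Fin n →₀ ℕ, (∀ k, exponentCount m k = rowCount p k) ∧
      polyProj π i (monomial m 1) ≠ 0 := by
  have hd := hπ.dim_ne_zero i
  have hn : (n.factorial : ℂ) ≠ 0 := Nat.cast_ne_zero.mpr n.factorial_ne_zero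
  have hsum := fun a => hπ.sum_repMat_mul a i i i
  obtain ⟨e, he⟩ := hπ
  set v : MvPolynomial (Fin n) ℂ := (e (Pi.single i 1)).1 with hv
  have hv0 : v ≠ 0 := by
    intro h0
    have h1 : e (Pi.single i 1) = 0 := Subtype.ext h0
    rw [LinearEquiv.map_eq_zero_iff] at h1
    have := congrFun h1 i
    simp at this
  -- Schur orthogonality fixes v under the projection built from π(σ⁻¹), whereas `polyProj` uses the
  -- entries of π(σ). For a unitary representation the diagonal entries are conjugate, so the
  -- conjugate of v is fixed by `polyProj`.
  have hfix : ((d : ℂ) / n.factorial) •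
      ∑ σ : Equiv.Perm (Fin n), repMat π σ⁻¹ i i • rename σ v = v := by
    have h1 : ∀ σ : Equiv.Perm (Fin n), repMat π σ⁻¹ i i • rename σ v =
        (spechtModule p).subtype
          (e (repMat π σ⁻¹ i i • (repMat π σ).mulVec (Pi.single i 1))) := by
      intro σ
      rw [map_smul, map_smul, Submodule.subtype_apply, he, hv]
    simp_rw [h1]
    rw [← map_sum, ← map_sum, ← map_smul, ← map_smul, Submodule.subtype_apply, hv]
    congr 2
    ext a
    rw [Pi.smul_apply, Finset.sum_apply]
    simp only [Pi.smul_apply, Matrix.mulVec_single_one, Matrix.col_apply, smul_eq_mul]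
    have h2 := hsum a
    simp_rw [mul_comm (repMat π _ a i)] at h2
    rw [h2]
    rcases eq_or_ne a i with rfl | hai
    · simp
      field_simp
    · simp [hai]
  set f := map (starRingEnd ℂ) v with hf
  have hf0 : f ≠ 0 := by
    intro h0
    refine hv0 (map_injective _ (starRingEnd ℂ).injective ?_)
    rw [← hf, h0, map_zero]
  have hPf : polyProj π i f = f := by
    conv_rhs => rw [hf, ← hfix]
    rw [polyProj_apply, smul_eq_C_mul, smul_eq_C_mul, map_mul, map_C, map_sum]
    congr 1
    · simp
    · refine Finset.sum_congr rfl fun σ _ => ?_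
      rw [smul_eq_C_mul, smul_eq_C_mul, map_mul, map_C, map_rename, repMat_inv_apply]
      simp [hf]
  by_contra! hcon
  refine hf0 ?_
  rw [← hPf, f.as_sum, map_sum]
  refine Finset.sum_eq_zero fun m hm => ?_
  have h3 : monomial m (coeff m f) = coeff m f • monomial m (1 : ℂ) := by simp [smul_monomial]
  rw [h3, map_smul, hcon m, smul_zero]
  intro k
  refine exponentCount_of_mem_support (v := v) (e _).2 ?_ k
  rw [mem_support_iff, hf, coeff_map] at hm
  exact fun h0 => hm (by rw [h0, map_zero])

end PolyProj

/-! ### Unitary intertwiners of power sums -/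

section Intertwiner

variable {n d e : ℕ} {lam : ℝ} {p q : n.Partition}
  {π : Equiv.Perm (Fin n) →* Matrix.unitaryGroup (Fin d) ℂ}
  {ρ : Equiv.Perm (Fin n) →* Matrix.unitaryGroup (Fin e) ℂ} {i : Fin d} {j : Fin e}

/-- A unitary map between two isotypic pieces that commutes with multiplication by power sums. -/
def IntertwinesPsum (h : 1 ≤ lam) (U : projSpace lam π i i ≃ₗᵢ[ℂ] projSpace lam ρ j j) : Prop :=
  ∀ (k : ℕ) (F G : projSpace lam π i i),
    (G : WeightedL2 n lam) = mulOp h (psum (Fin n) ℂ k) (F : WeightedL2 n lam) →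
    (U G : WeightedL2 n lam) = mulOp h (psum (Fin n) ℂ k) (U F : WeightedL2 n lam)

lemma IntertwinesPsum.symm {h : 1 ≤ lam} {U : projSpace lam π i i ≃ₗᵢ[ℂ] projSpace lam ρ j j}
    (hU : IntertwinesPsum h U) (hπ : BelongsTo π p) : IntertwinesPsum h U.symm := by
  intro k F G hFG
  have h1 := hπ.mulOp_mem_projSpace h (psum_isSymmetric (Fin n) ℂ k) (U.symm F).2
  have h2 := hU k (U.symm F) ⟨_, h1⟩ rfl
  rw [U.apply_symm_apply, ← hFG] at h2
  rw [← Subtype.ext h2, U.symm_apply_apply]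

lemma inner_polyLp_psumLower_right (h : 1 ≤ lam) (k : ℕ) (g : MvPolynomial (Fin n) ℂ)
    {F : WeightedL2 n lam} (hF : F ∈ weightedBergman n lam) :
    inner ℂ F (polyLp h (psumLower n lam k g)) =
      inner ℂ (mulOp h (psum (Fin n) ℂ k) F) (polyLp h g) := by
  rw [← inner_conj_symm, inner_psumLower h k g hF, inner_conj_symm]

/-- The adjoint of the intertwining relation, tested against H. The image under U of a polynomial
need not be a polynomial, so `psumLower` cannot be applied to it directly. -/
lemma IntertwinesPsum.inner_psumLower {h : 1 ≤ lam}
    {U : projSpace lam π i i ≃ₗᵢ[ℂ] projSpace lam ρ j j} (hU : IntertwinesPsum h U)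
    (hπ : BelongsTo π p) (hρ : BelongsTo ρ q) (k : ℕ) {f : MvPolynomial (Fin n) ℂ}
    (hf : polyLp h f ∈ projSpace lam π i i)
    (hLf : polyLp h (psumLower n lam k f) ∈ projSpace lam π i i) {H : WeightedL2 n lam}
    (hH : H ∈ projSpace lam ρ j j) :
    inner ℂ (U ⟨_, hLf⟩ : WeightedL2 n lam) H =
      inner ℂ (U ⟨_, hf⟩ : WeightedL2 n lam) (mulOp h (psum (Fin n) ℂ k) H) := by
  have hpH := hρ.mulOp_mem_projSpace h (psum_isSymmetric (Fin n) ℂ k) hH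
  have h1 := hU.symm hπ k ⟨H, hH⟩ ⟨_, hpH⟩ rfl
  have h2 := ((hπ.mem_projSpace_iff h).mp (U.symm ⟨H, hH⟩).2).1
  have h3 := _root_.inner_psumLower h k f h2
  rw [← h1] at h3
  have h4 : ∀ (x : projSpace lam π i i) (y : projSpace lam ρ j j),
      inner ℂ (U x : WeightedL2 n lam) (y : WeightedL2 n lam) =
        inner ℂ (x : WeightedL2 n lam) (U.symm y : WeightedL2 n lam) := by
    intro x y
    rw [← Submodule.coe_inner, ← Submodule.coe_inner, ← U.inner_map_map x, U.apply_symm_apply]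
  rw [h4 ⟨_, hLf⟩ ⟨H, hH⟩, h4 ⟨_, hf⟩ ⟨_, hpH⟩]
  exact h3

lemma IntertwinesPsum.inner_psumCommutator {h : 1 ≤ lam}
    {U : projSpace lam π i i ≃ₗᵢ[ℂ] projSpace lam ρ j j} (hU : IntertwinesPsum h U)
    (hπ : BelongsTo π p) (hρ : BelongsTo ρ q) (k : ℕ) {f g : MvPolynomial (Fin n) ℂ}
    (hf : polyLp h f ∈ projSpace lam π i i) (hg : polyLp h g ∈ projSpace lam ρ j j)
    (hXf : polyLp h (psumCommutator n lam k f) ∈ projSpace lam π i i) :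
    inner ℂ (U ⟨_, hf⟩ : WeightedL2 n lam) (polyLp h (psumCommutator n lam k g)) =
      inner ℂ (U ⟨_, hXf⟩ : WeightedL2 n lam) (polyLp h g) := by
  have hs := psum_isSymmetric (Fin n) ℂ k
  have hpf : polyLp h (psum (Fin n) ℂ k * f) ∈ projSpace lam π i i := by
    rw [← mulOp_polyLp]
    exact hπ.mulOp_mem_projSpace h hs hf
  have hLf := hπ.polyLp_psumLower_mem h k hf
  have hLg := hρ.polyLp_psumLower_mem h k hg
  have hLpf := hπ.polyLp_psumLower_mem h k hpf
  have hpLf : polyLp h (psum (Fin n) ℂ k * psumLower n lam k f) ∈ projSpace lam π i i := by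
    rw [← mulOp_polyLp]
    exact hπ.mulOp_mem_projSpace h hs hLf
  have hB : ∀ x : projSpace lam π i i, (U x : WeightedL2 n lam) ∈ weightedBergman n lam :=
    fun x => ((hρ.mem_projSpace_iff h).mp (U x).2).1
  have hUX : (U ⟨_, hXf⟩ : WeightedL2 n lam) = (U ⟨_, hLpf⟩ : WeightedL2 n lam) -
      (U ⟨_, hpLf⟩ : WeightedL2 n lam) := by
    rw [← Submodule.coe_sub, ← map_sub]
    congr 2
    ext1
    simp only [psumCommutator, LinearMap.sub_apply, LinearMap.comp_apply,
      LinearMap.mulLeft_apply, map_sub, Submodule.coe_sub]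
  have hXg : polyLp h (psumCommutator n lam k g) =
      polyLp h (psumLower n lam k (psum (Fin n) ℂ k * g)) -
        mulOp h (psum (Fin n) ℂ k) (polyLp h (psumLower n lam k g)) := by
    simp only [psumCommutator, LinearMap.sub_apply, LinearMap.comp_apply,
      LinearMap.mulLeft_apply, map_sub, mulOp_polyLp]
  rw [hUX, hXg, inner_sub_left, inner_sub_right, inner_polyLp_psumLower_right h k _ (hB _),
    ← hU.inner_psumLower hπ hρ k hf hLf hLg, inner_polyLp_psumLower_right h k _ (hB _),
    ← hU k ⟨_, hf⟩ ⟨_, hpf⟩ (mulOp_polyLp h _ f).symm,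
    ← hU k ⟨_, hLf⟩ ⟨_, hpLf⟩ (mulOp_polyLp h _ _).symm,
    hU.inner_psumLower hπ hρ k hpf hLpf hg, mulOp_polyLp]

/-- A function on exponents that is reproduced by the projection of shape `q` does not vanish at
some translate of an exponent which is injective on the columns of a tableau of shape `q`. -/
lemma BelongsTo.exists_isColumnInjective (hρ : BelongsTo ρ q) (j : Fin e)
    {w : (Fin n →₀ ℕ) → ℂ} {c : ℂ}
    (hw : ∀ b, w b = c * ∑ σ : Equiv.Perm (Fin n), repMat ρ σ j j * w (b.mapDomain σ))
    {b : Fin n →₀ ℕ} (hb : w b ≠ 0) :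
    ∃ (T : q.diagram.cells ≃ Fin n) (β : Fin n →₀ ℕ) (σ : Equiv.Perm (Fin n)),
      IsColumnInjective T β ∧ w (β.mapDomain σ) ≠ 0 := by
  -- The family φ is invariant under the simultaneous action on exponents and vectors, so its common
  -- kernel is an invariant subspace. At the basis vector j the reproducing formula recovers w up to
  -- c; the kernel is thus not everything and is zero by irreducibility.
  let φ : (Fin n →₀ ℕ) → (Fin e → ℂ) →ₗ[ℂ] ℂ := fun β =>
    ∑ σ : Equiv.Perm (Fin n), w (β.mapDomain σ) • (LinearMap.proj j ∘ₗ (repMat ρ σ).mulVecLin)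
  have hφ : ∀ β u, φ β u =
      ∑ σ : Equiv.Perm (Fin n), w (β.mapDomain σ) * (repMat ρ σ).mulVec u j := by
    intro β u
    simp [φ, LinearMap.sum_apply]
  have hφmul : ∀ β u τ, φ (β.mapDomain τ) ((repMat ρ τ).mulVec u) = φ β u := by
    intro β u τ
    rw [hφ, hφ]
    refine Fintype.sum_equiv (Equiv.mulRight τ) _ _ fun σ => ?_
    rw [Equiv.coe_mulRight, repMat_mul, Matrix.mulVec_mulVec, ← Finsupp.mapDomain_comp]
    rfl
  have hbot : (⨅ β, LinearMap.ker (φ β)) = ⊥ := by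
    refine (hρ.eq_bot_or_eq_top fun τ u hu => ?_).resolve_right fun htop => hb ?_
    · simp only [Submodule.mem_iInf, LinearMap.mem_ker] at hu ⊢
      intro β
      have h1 := hφmul (β.mapDomain (τ⁻¹ : Equiv.Perm (Fin n))) u τ
      have h2 : (β.mapDomain (τ⁻¹ : Equiv.Perm (Fin n))).mapDomain τ = β := by
        rw [← Finsupp.mapDomain_comp]
        convert Finsupp.mapDomain_id (v := β) using 2
        ext x
        simp
      rw [h2, hu] at h1
      exact h1
    · have h1 : Pi.single j 1 ∈ ⨅ β, LinearMap.ker (φ β) := by rw [htop]; trivial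
      simp only [Submodule.mem_iInf, LinearMap.mem_ker] at h1
      have h2 := h1 b
      rw [hφ] at h2
      simp only [Matrix.mulVec_single_one, Matrix.col_apply] at h2
      rw [hw b]
      simp_rw [mul_comm (repMat ρ _ j j)]
      rw [h2, mul_zero]
  obtain ⟨E, hE⟩ := hρ
  obtain ⟨T⟩ : Nonempty (q.diagram.cells ≃ Fin n) := by
    by_contra hemp
    rw [not_nonempty_iff] at hemp
    have h1 : spechtModule q = ⊥ := by rw [spechtModule, Set.range_eq_empty, Submodule.span_empty]
    have h2 : E (Pi.single j 1) = 0 := by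
      ext1
      exact (Submodule.mem_bot ℂ).mp (h1.le (E (Pi.single j 1)).2)
    rw [LinearEquiv.map_eq_zero_iff] at h2
    have := congrFun h2 j
    simp at this
  set u := E.symm ⟨spechtPolynomial q T, Submodule.subset_span ⟨T, rfl⟩⟩ with hu
  have hu0 : u ≠ 0 := by
    intro h0
    rw [hu, LinearEquiv.map_eq_zero_iff] at h0
    exact spechtPolynomial_ne_zero T (congrArg Subtype.val h0)
  have hu1 : ∃ β, φ β u ≠ 0 := by
    by_contra! hcon
    refine hu0 ?_
    rw [← Submodule.mem_bot ℂ, ← hbot]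
    simpa only [Submodule.mem_iInf, LinearMap.mem_ker] using hcon
  obtain ⟨β, hβ⟩ := hu1
  have hσ : ∃ σ : Equiv.Perm (Fin n), w (β.mapDomain σ) ≠ 0 := by
    by_contra! hcon
    refine hβ ?_
    rw [hφ]
    exact Finset.sum_eq_zero fun σ _ => by rw [hcon, zero_mul]
  obtain ⟨σ, hσ⟩ := hσ
  refine ⟨T, β, σ, isColumnInjective_of_mem_support (w := fun β => φ β u) ?_ hβ, hσ⟩
  -- A swap within a column of T negates u, so by invariance β ↦ φ β u is antisymmetric under column
  -- swaps.
  intro x x' hxx hne m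
  have h1 : (repMat ρ (Equiv.swap (T x) (T x'))).mulVec u = -u := by
    refine E.injective (Subtype.ext ?_)
    rw [hE, map_neg, hu, E.apply_symm_apply]
    exact isColumnAntisymm_spechtPolynomial T x x' hxx hne
  have h2 := hφmul m u (Equiv.swap (T x) (T x'))
  rw [h1, map_neg] at h2
  exact neg_eq_iff_eq_neg.mp h2

/-- The extremal exponents of p occur in the first piece and, transported by U, must satisfy the
dominance bound of shape q. -/
theorem IntertwinesPsum.rowCount_le {h : 1 ≤ lam}
    {U : projSpace lam π i i ≃ₗᵢ[ℂ] projSpace lam ρ j j} (hU : IntertwinesPsum h U)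
    (hπ : BelongsTo π p) (hρ : BelongsTo ρ q) (k : ℕ) : rowCount p k ≤ rowCount q k := by
  obtain ⟨a, ha, ha0⟩ := hπ.exists_polyProj_monomial_ne_zero i
  have hf := polyLp_polyProj_mem (π := π) h i (monomial a 1)
  set W : projSpace lam ρ j j := U ⟨_, hf⟩ with hW
  have hWmem := (hρ.mem_projSpace_iff h).mp W.2
  have hW0 : (W : WeightedL2 n lam) ≠ 0 := by
    intro h0
    have h1 : W = 0 := Subtype.ext h0
    rw [hW, map_eq_zero_iff U U.injective] at h1
    have h2 : polyLp h (polyProj π i (monomial a 1)) = 0 := congrArg Subtype.val h1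
    exact ha0 (polyLp_injective h (by rw [h2, map_zero]))
  let w : (Fin n →₀ ℕ) → ℂ := fun b => inner ℂ (W : WeightedL2 n lam) (polyLp h (monomial b 1))
  have hwP : ∀ b, inner ℂ (W : WeightedL2 n lam) (polyLp h (polyProj ρ j (monomial b 1))) =
      w b := by
    intro b
    rw [← projOp_polyLp, ← inner_projOp, hWmem.2]
  have hw : ∀ b, w b = ((e : ℂ) / n.factorial) *
      ∑ σ : Equiv.Perm (Fin n), repMat ρ σ j j * w (b.mapDomain σ) := by
    intro b
    rw [← hwP, polyProj_apply, map_smul, map_sum, inner_smul_right, inner_sum]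
    congr 1
    refine Finset.sum_congr rfl fun σ _ => ?_
    rw [map_smul, inner_smul_right, rename_monomial]
  -- W is weakly a joint eigenvector of the commutators with the eigenvalues of a. A monomial with
  -- nonzero coefficient w b must share these eigenvalues, hence the multiset of exponents.
  have hcount : ∀ b, w b ≠ 0 → ∀ k, exponentCount b k = rowCount p k := by
    intro b hb k
    rw [← ha]
    refine (exponentCount_eq_of_sum_commutatorWeight h (fun k => ?_) k).symm
    have hg := polyLp_polyProj_mem (π := ρ) h j (monomial b 1)
    have hX : polyLp h (psumCommutator n lam k (polyProj π i (monomial a 1))) =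
        ((∑ i, commutatorWeight lam k (a i) : ℝ) : ℂ) •
          polyLp h (polyProj π i (monomial a 1)) := by
      rw [psumCommutator_polyProj, map_smul]
    have hXf : polyLp h (psumCommutator n lam k (polyProj π i (monomial a 1))) ∈
        projSpace lam π i i := by
      rw [hX]
      exact Submodule.smul_mem _ _ hf
    have h1 := hU.inner_psumCommutator hπ hρ k hf hg hXf
    have h2 : (U ⟨_, hXf⟩ : WeightedL2 n lam) =
        ((∑ i, commutatorWeight lam k (a i) : ℝ) : ℂ) • (W : WeightedL2 n lam) := by
      rw [hW, ← Submodule.coe_smul, ← map_smul]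
      congr 2
      exact Subtype.ext hX
    rw [h2, inner_smul_left, psumCommutator_polyProj, map_smul, inner_smul_right, hwP,
      Complex.conj_ofReal] at h1
    exact_mod_cast (mul_right_cancel₀ hb h1).symm
  have hb : ∃ b, w b ≠ 0 := by
    by_contra! hcon
    refine hW0 (eq_zero_of_inner_monomial h hWmem.1 fun m => ?_)
    rw [← inner_conj_symm, map_eq_zero]
    exact hcon m
  obtain ⟨b, hb⟩ := hb
  obtain ⟨T, β, σ, hT, hσ⟩ := hρ.exists_isColumnInjective j hw hb
  rw [← hcount _ hσ, exponentCount_mapDomain]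
  exact exponentCount_le_rowCount hT k

theorem IntertwinesPsum.eq {h : 1 ≤ lam}
    {U : projSpace lam π i i ≃ₗᵢ[ℂ] projSpace lam ρ j j} (hU : IntertwinesPsum h U)
    (hπ : BelongsTo π p) (hρ : BelongsTo ρ q) : p = q :=
  eq_of_rowCount_eq fun k =>
    le_antisymm (hU.rowCount_le hπ hρ k) ((hU.symm hπ).rowCount_le hρ hπ k)

end Intertwiner

/-! ### Polynomials in the multiplication operators -/

section Calculus

/-- `evalTuple` multiplies operators in a fixed order. This transfers any multiplicative relation
from the entries to the product; it serves both for acting by multiplication and for being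
intertwined by U. -/
lemma List.prod_ofFn_rel {A B : Type*} [Monoid A] [Monoid B] {R : A → B → Prop} (h1 : R 1 1)
    (hmul : ∀ a a' b b', R a b → R a' b' → R (a * a') (b * b')) {k : ℕ} {a : Fin k → A}
    {b : Fin k → B} (h : ∀ i, R (a i) (b i)) : R (List.ofFn a).prod (List.ofFn b).prod := by
  induction k with
  | zero => simpa using h1
  | succ k ih =>
    rw [List.ofFn_succ, List.ofFn_succ, List.prod_cons, List.prod_cons]
    exact hmul _ _ _ _ (h 0) (ih fun i => h i.succ)

lemma Monoid.pow_rel {A B : Type*} [Monoid A] [Monoid B] {R : A → B → Prop} (h1 : R 1 1)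
    (hmul : ∀ a a' b b', R a b → R a' b' → R (a * a') (b * b')) {a : A} {b : B} (h : R a b)
    (k : ℕ) : R (a ^ k) (b ^ k) := by
  induction k with
  | zero => simpa using h1
  | succ k ih =>
    rw [pow_succ, pow_succ]
    exact hmul _ _ _ _ ih h

variable {n : ℕ} {lam : ℝ} {E : Submodule ℂ (WeightedL2 n lam)}

/-- The operator `A` is multiplication by the function `g`. -/
def IsMulBy (A : E →L[ℂ] E) (g : (Fin n → ℂ) → ℂ) : Prop :=
  ∀ F : E, ((A F : WeightedL2 n lam) : (Fin n → ℂ) → ℂ) =ᵐ[weightMeasure n lam]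
    fun z => g z * (F : WeightedL2 n lam) z

lemma IsMulBy.one : IsMulBy (1 : E →L[ℂ] E) 1 := fun F => .of_forall fun z => by simp

lemma IsMulBy.mul {A B : E →L[ℂ] E} {f g : (Fin n → ℂ) → ℂ} (hA : IsMulBy A f)
    (hB : IsMulBy B g) : IsMulBy (A * B) (f * g) := by
  intro F
  filter_upwards [hA (B F), hB F] with z h1 h2
  rw [mul_apply_eq_comp, h1, h2, Pi.mul_apply, mul_assoc]

lemma IsMulBy.smul (c : ℂ) {A : E →L[ℂ] E} {f : (Fin n → ℂ) → ℂ} (hA : IsMulBy A f) :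
    IsMulBy (c • A) (c • f) := by
  intro F
  filter_upwards [hA F, Lp.coeFn_smul c (A F : WeightedL2 n lam)] with z h1 h2
  rw [_root_.smul_apply, Submodule.coe_smul, h2, Pi.smul_apply, h1, Pi.smul_apply,
    smul_eq_mul, smul_eq_mul, mul_assoc]

lemma IsMulBy.add {A B : E →L[ℂ] E} {f g : (Fin n → ℂ) → ℂ} (hA : IsMulBy A f)
    (hB : IsMulBy B g) : IsMulBy (A + B) (f + g) := by
  intro F
  filter_upwards [hA F, hB F, Lp.coeFn_add (A F : WeightedL2 n lam) (B F : WeightedL2 n lam)]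
    with z h1 h2 h3
  rw [_root_.add_apply, Submodule.coe_add, h3, Pi.add_apply, h1, h2, Pi.add_apply,
    add_mul]

lemma IsMulBy.zero : IsMulBy (0 : E →L[ℂ] E) 0 := by
  intro F
  filter_upwards [Lp.coeFn_zero ℂ 2 (weightMeasure n lam)] with z h1
  rw [_root_.zero_apply, Submodule.coe_zero, h1, Pi.zero_apply,
    zero_mul]

lemma IsMulBy.sum {ι : Type*} {s : Finset ι} {A : ι → E →L[ℂ] E} {f : ι → (Fin n → ℂ) → ℂ}
    (h : ∀ x ∈ s, IsMulBy (A x) (f x)) : IsMulBy (∑ x ∈ s, A x) (∑ x ∈ s, f x) := by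
  classical
  induction s using Finset.induction_on with
  | empty => simpa using IsMulBy.zero
  | insert a s ha ih =>
    rw [Finset.sum_insert ha, Finset.sum_insert ha]
    exact (h a (Finset.mem_insert_self a s)).add
      (ih fun x hx => h x (Finset.mem_insert_of_mem hx))

lemma IsMulBy.eq {A B : E →L[ℂ] E} {f : (Fin n → ℂ) → ℂ} (hA : IsMulBy A f) (hB : IsMulBy B f) :
    A = B := by
  ext1 F
  refine Subtype.ext (Lp.ext ?_)
  exact (hA F).trans (hB F).symm

lemma IsMulTuple.isMulBy_evalTuple {T : Fin n → E →L[ℂ] E} (hT : IsMulTuple E T)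
    (f : MvPolynomial (Fin n) ℂ) : IsMulBy (evalTuple T f) fun z => eval (symmetrization z) f := by
  have h1 : (fun z : Fin n → ℂ => eval (symmetrization z) f) = ∑ m ∈ f.support,
      coeff m f • (List.ofFn fun i => (fun z : Fin n → ℂ => symmetrization z i) ^ m i).prod := by
    funext z
    rw [eval_eq', Finset.sum_apply]
    refine Finset.sum_congr rfl fun m _ => ?_
    rw [List.prod_ofFn, Pi.smul_apply, Finset.prod_apply, smul_eq_mul]
    rfl
  rw [h1]
  refine IsMulBy.sum fun m _ => IsMulBy.smul _ ?_
  have hmul : ∀ (a a' : E →L[ℂ] E) (b b' : (Fin n → ℂ) → ℂ), IsMulBy a b → IsMulBy a' b' →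
      IsMulBy (a * a') (b * b') := fun _ _ _ _ h h' => h.mul h'
  have hpow : ∀ i, IsMulBy (T i ^ m i) ((fun z : Fin n → ℂ => symmetrization z i) ^ m i) :=
    fun i => Monoid.pow_rel (R := IsMulBy (E := E)) IsMulBy.one hmul (hT i) _
  exact List.prod_ofFn_rel (R := IsMulBy (E := E)) IsMulBy.one hmul hpow

lemma IsMulTuple.commute {T : Fin n → E →L[ℂ] E} (hT : IsMulTuple E T) (i j : Fin n) :
    Commute (T i) (T j) := by
  have h1 := IsMulBy.mul (hT i) (hT j)
  rw [mul_comm] at h1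
  exact h1.eq (IsMulBy.mul (hT j) (hT i))

lemma continuous_symmetrization : Continuous (symmetrization (n := n)) :=
  continuous_pi fun _ => MvPolynomial.continuous_eval _

lemma polydisc_eq_pi : polydisc n = Set.univ.pi fun _ => Metric.ball (0 : ℂ) 1 := by
  ext z
  simp [polydisc]

/-- Boundary points have to be included because for lam = 1 the measure lives on the torus;
continuity carries them into the closure. -/
lemma symmetrization_mem {z : Fin n → ℂ} (hz : ∀ i, ‖z i‖ ≤ 1) :
    symmetrization z ∈ closedSymmetrizedPolydisc n := by
  refine image_closure_subset_closure_image continuous_symmetrization ⟨z, ?_, rfl⟩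
  rw [polydisc_eq_pi, closure_pi_set]
  intro i _
  rw [closure_ball _ one_ne_zero]
  simpa using hz i

lemma isCompact_closedSymmetrizedPolydisc : IsCompact (closedSymmetrizedPolydisc n) := by
  have h1 : IsCompact (Set.univ.pi fun _ : Fin n => Metric.closedBall (0 : ℂ) 1) :=
    isCompact_univ_pi fun _ => isCompact_closedBall _ _
  refine (h1.image continuous_symmetrization).closure_of_subset (Set.image_mono ?_)
  rw [polydisc_eq_pi]
  exact Set.pi_mono fun _ _ => Metric.ball_subset_closedBall

lemma norm_eval_symmetrization_le (f : MvPolynomial (Fin n) ℂ) {z : Fin n → ℂ}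
    (hz : ∀ i, ‖z i‖ ≤ 1) : ‖eval (symmetrization z) f‖ ≤
      sSup ((fun w => ‖eval w f‖) '' closedSymmetrizedPolydisc n) :=
  le_csSup (isCompact_closedSymmetrizedPolydisc.image
    (MvPolynomial.continuous_eval f).norm).bddAbove ⟨_, symmetrization_mem hz, rfl⟩

lemma IsMulTuple.isGammaContraction (h : 1 ≤ lam) [CompleteSpace E] {T : Fin n → E →L[ℂ] E}
    (hT : IsMulTuple E T) : IsGammaContraction T := by
  refine ⟨inferInstance, hT.commute, fun f => ?_⟩
  refine ContinuousLinearMap.opNorm_le_bound _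
    (Real.sSup_nonneg (by rintro _ ⟨w, _, rfl⟩; exact norm_nonneg _)) fun F => ?_
  refine Lp.norm_le_mul_norm_of_ae_le_mul (f := (evalTuple T f F : WeightedL2 n lam)) ?_
  filter_upwards [hT.isMulBy_evalTuple f F, ae_norm_le_one h] with z h1 h2
  rw [h1, norm_mul]
  exact mul_le_mul_of_nonneg_right (norm_eval_symmetrization_le f h2) (norm_nonneg _)

lemma map_evalTuple {H K : Type*} [NormedAddCommGroup H] [InnerProductSpace ℂ H]
    [NormedAddCommGroup K] [InnerProductSpace ℂ K] {T : Fin n → H →L[ℂ] H}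
    {S : Fin n → K →L[ℂ] K} (U : H ≃ₗᵢ[ℂ] K) (hU : ∀ i x, U (T i x) = S i (U x))
    (f : MvPolynomial (Fin n) ℂ) (x : H) : U (evalTuple T f x) = evalTuple S f (U x) := by
  simp only [evalTuple, _root_.sum_apply, _root_.smul_apply, map_sum,
    map_smul]
  refine Finset.sum_congr rfl fun m _ => congrArg _ ?_
  have h1 : ∀ x, U ((1 : H →L[ℂ] H) x) = (1 : K →L[ℂ] K) (U x) := fun x => rfl
  have hmul : ∀ (a a' : H →L[ℂ] H) (b b' : K →L[ℂ] K), (∀ x, U (a x) = b (U x)) →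
      (∀ x, U (a' x) = b' (U x)) → ∀ x, U ((a * a') x) = (b * b') (U x) := by
    intro a a' b b' ha ha' x
    rw [mul_apply_eq_comp, mul_apply_eq_comp, ha, ha']
  let R : (H →L[ℂ] H) → (K →L[ℂ] K) → Prop := fun a b => ∀ x, U (a x) = b (U x)
  have hpow : ∀ i, R (T i ^ m i) (S i ^ m i) :=
    fun i => Monoid.pow_rel (R := R) h1 hmul (hU i) _
  exact List.prod_ofFn_rel (R := R) h1 hmul hpow x

lemma IsMulTuple.evalTuple_eq_mulOp (h : 1 ≤ lam) {T : Fin n → E →L[ℂ] E} (hT : IsMulTuple E T)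
    {f g : MvPolynomial (Fin n) ℂ}
    (hfg : aeval (fun i : Fin n => esymm (Fin n) ℂ (i + 1)) f = g) (F : E) :
    (evalTuple T f F : WeightedL2 n lam) = mulOp h g F := by
  ext1
  filter_upwards [hT.isMulBy_evalTuple f F, mulOp_coeFn h g F] with z h1 h2
  have h3 : eval z g = eval (symmetrization z) f := by
    rw [← hfg, aeval_def, ← MvPolynomial.coe_eval₂Hom, ← RingHom.comp_apply, MvPolynomial.comp_eval₂Hom,
      MvPolynomial.coe_eval₂Hom, eval₂_eq', eval_eq']
    simp [symmetrization]
  rw [h1, h2, h3]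

end Calculus

/-! ### From the symmetrized tuple to power sums -/

section Main

variable {n d e : ℕ} {lam : ℝ} {p q : n.Partition}
  {π : Equiv.Perm (Fin n) →* Matrix.unitaryGroup (Fin d) ℂ}
  {ρ : Equiv.Perm (Fin n) →* Matrix.unitaryGroup (Fin e) ℂ} {i : Fin d} {j : Fin e}

lemma BelongsTo.exists_isMulTuple (hπ : BelongsTo π p) (h : 1 ≤ lam) (i : Fin d) :
    ∃ T : Fin n → projSpace lam π i i →L[ℂ] projSpace lam π i i,
      IsMulTuple (projSpace lam π i i) T :=
  ⟨fun a => (mulOp h (esymm (Fin n) ℂ (a + 1))).restrict fun _ hF =>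
    hπ.mulOp_mem_projSpace h (esymm_isSymmetric (Fin n) ℂ _) hF,
    fun a F => mulOp_coeFn h (esymm (Fin n) ℂ (a + 1)) F⟩

/-- By the fundamental theorem on symmetric polynomials a power sum is a polynomial f in the
elementary symmetric ones, so multiplication by it is `evalTuple` at f on both sides. -/
lemma IsMulTuple.intertwinesPsum (h : 1 ≤ lam)
    {T : Fin n → projSpace lam π i i →L[ℂ] projSpace lam π i i}
    {S : Fin n → projSpace lam ρ j j →L[ℂ] projSpace lam ρ j j}
    (hT : IsMulTuple (projSpace lam π i i) T) (hS : IsMulTuple (projSpace lam ρ j j) S)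
    {U : projSpace lam π i i ≃ₗᵢ[ℂ] projSpace lam ρ j j} (hU : ∀ a x, U (T a x) = S a (U x)) :
    IntertwinesPsum h U := by
  intro k F G hFG
  obtain ⟨f, hf⟩ := esymmAlgHom_surjective (σ := Fin n) ℂ (n := n) (by simp)
    ⟨psum (Fin n) ℂ k, psum_isSymmetric (Fin n) ℂ k⟩
  have hf' := congrArg Subtype.val hf
  rw [esymmAlgHom_apply] at hf'
  have hG : G = evalTuple T f F := Subtype.ext (by rw [hFG, hT.evalTuple_eq_mulOp h hf'])
  rw [hG, map_evalTuple U hU, hS.evalTuple_eq_mulOp h hf']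

end Main

end

theorem mainTheorem5 (n : ℕ) (hn : 1 ≤ n) (lam : ℝ) (hlam : 1 ≤ lam)
    (d : n.Partition → ℕ)
    (π : ∀ p : n.Partition, Equiv.Perm (Fin n) →* Matrix.unitaryGroup (Fin (d p)) ℂ)
    (hπ : ∀ p : n.Partition, BelongsTo (π p) p)
    (i : ∀ p : n.Partition, Fin (d p)) :
    ∃ T : ∀ p : n.Partition, Fin n →
        projSpace lam (π p) (i p) (i p) →L[ℂ] projSpace lam (π p) (i p) (i p),
      (∀ p, IsMulTuple (projSpace lam (π p) (i p) (i p)) (T p)) ∧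
      (∀ p, IsGammaContraction (T p)) ∧
      ∀ p q, p ≠ q → ¬ UnitarilyEquivalent (T p) (T q) := by
  choose T hT using fun p => (hπ p).exists_isMulTuple hlam (i p)
  refine ⟨T, hT, fun p => ?_, fun p q hpq ⟨U, hU⟩ => hpq ?_⟩
  · have := (hπ p).completeSpace_projSpace hlam (i p)
    exact (hT p).isGammaContraction hlam
  · exact ((hT p).intertwinesPsum hlam (hT q) hU).eq (hπ p) (hπ q)
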